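/- Let $p>1$ and $a,b,L>0$, and write $s^\pm=\max\{\pm s,0\}$. Let $\Delta_p^{a,b}u=\big(a^p[(u')^+]^{p-1}-b^p[(u')^-]^{p-1}\big)'$ and $\Delta_p u=(|u'|^{p-2}u')'$, both understood weakly. Let $\Sigma_p^{a,b}(0,L)$ be the set of all $(\mu,\nu)\in\mathbb{R}^2$ for which $$-\Delta_p^{a,b}u=\mu(u^+)^{p-1}-\nu(u^-)^{p-1}\ \text{ in }(0,L),\qquad u(0)=u(L)=0,\tag{F}$$ has a nontrivial weak solution $u\in W_0^{1,p}(0,L)$, and let $\Sigma_p(0,L)$ be the set defined in the same way with $\Delta_p$ in place of $\Delta_p^{a,b}$. Put $$\lambda_{1,p}^{a,b}(0,1)=\inf\Big\{\int_0^1 a^p[(u')^+]^p+b^p[(u')^-]^p\,dt:\ u\in W_0^{1,p}(0,1),\ \|u\|_p=1\Big\},$$ and let $\lambda_{1,p}(0,1)$ be the same infimum with $\int_0^1|u'|^p\,dt$. Let $\varphi_p\in W_0^{1,p}(0,1)$ be the continuous eigenfunction of $-\Delta_p$ on $(0,1)$ for the eigenvalue $\lambda_{1,p}(0,1)$ that is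 positive on $(0,1)$ and satisfies $\|\varphi_p\|_p=1$ (it exists). With $t_0=\frac{a}{a+b}$, define on $[0,1]$ $$\varphi_p^{a,b,+}(t)=\begin{cases}\varphi_p\big(\tfrac{t}{2t_0}\big),& t<t_0,\\ \varphi_p\big(\tfrac{t+1-2t_0}{2(1-t_0)}\big),& t\ge t_0,\end{cases}\qquad \varphi_p^{a,b,-}(t)=\begin{cases}-\varphi_p\big(\tfrac{t}{2(1-t_0)}\big),& t<1-t_0,\\ -\varphi_p\big(\tfrac{t+2t_0-1}{2t_0}\big),& t\ge 1-t_0.\end{cases}$$ Then: (I) $\displaystyle \Sigma_p^{a,b}(0,L)=\Big(\frac{a+b}{2}\Big)^p\,\Sigma_p(0,L)$. (II) Let $(\mu,\nu)\in\mathbb{R}^2$. A function $u$ is a nontrivial weak solution of (F) in $W_0^{1,p}(0,L)$ if and only if there are integers $P,N\ge 0$, with $\mu>0$ if $P\ge1$ and $\nu>0$ if $N\ge 1$, nonempty bounded open intervals $I_1,\dots,I_P$ of length $l_\mu=\big(\lambda_{1,p}^{a,b}(0,1)/\mu\big)^{1/p}$ and $J_1,\dots,J_N$ of length $l_\nu=\big(\lambda_{1,p}^{a,b}(0,1)/\nu\big)^{1/p}$,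 and a constant $c>0$ such that - (a) $\bar I_i\cap\bar I_{i'}=\emptyset$ for $i\ne i'$ and $\bar J_j\cap\bar J_{j'}=\emptyset$ for $j\neq j'$; - (b) $I_i\cap J_j=\emptyset$ for all $i,j$; - (c) $x\le y$ whenever $x\in I_i$, $y\in I_{i'}$, $i<i'$, and likewise for the $J_j$; - (d) $\bigcup_{i}\bar I_i\cup\bigcup_{j}\bar J_j=[0,L]$; and $u=c\,\Phi$ almost everywhere on $(0,L)$ (hence everywhere on $[0,L]$ for the continuous representative of $u$), where $$\Phi(t)=\begin{cases} l_\mu\,\varphi_p^{a,b,+}(\gamma_i(t)),& t\in\bar I_i,\\ l_\nu\,\varphi_p^{a,b,-}(\pi_j(t)),& t\in\bar J_j,\end{cases}$$ and $\gamma_i:\bar I_i\to[0,1]$, $\pi_j:\bar J_j\to[0,1]$ are the increasing affine bijections. -/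

import Mathlib

open Set MeasureTheory
open scoped ContDiff Pointwise

noncomputable section

namespace AsymPLap

/-- Lebesgue measure on the open interval `(0, L)`. -/
def intervalMeasure (L : ℝ) : Measure ℝ := volume.restrict (Ioo 0 L)

/-- `φ` is a test function on `(0, L)`: smooth with compact support contained in `(0, L)`. -/
def IsTestFunction (L : ℝ) (φ : ℝ → ℝ) : Prop :=
  ContDiff ℝ ∞ φ ∧ HasCompactSupport φ ∧ tsupport φ ⊆ Ioo 0 L

/-- `u'` is a weak derivative of `u` on `(0, L)`. -/
def HasWeakDeriv (L : ℝ) (u u' : ℝ → ℝ) : Prop :=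
  ∀ φ : ℝ → ℝ, IsTestFunction L φ →
    ∫ t in Ioo 0 L, u t * deriv φ t = - ∫ t in Ioo 0 L, u' t * φ t

/-- `u ∈ W₀^{1,p}(0, L)` with weak derivative `u'`: both are in `L^p(0, L)`, and `u` is in the
closure of the test functions for the `W^{1,p}(0, L)` norm. -/
structure IsW01p (p L : ℝ) (u u' : ℝ → ℝ) : Prop where
  memLp : MemLp u (ENNReal.ofReal p) (intervalMeasure L)
  memLp_deriv : MemLp u' (ENNReal.ofReal p) (intervalMeasure L)
  hasWeakDeriv : HasWeakDeriv L u u'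
  approx : ∀ ε : ENNReal, 0 < ε → ∃ φ : ℝ → ℝ, IsTestFunction L φ ∧
    eLpNorm (fun t => u t - φ t) (ENNReal.ofReal p) (intervalMeasure L) < ε ∧
    eLpNorm (fun t => u' t - deriv φ t) (ENNReal.ofReal p) (intervalMeasure L) < ε

/-- `u ∈ W₀^{1,p}(0, L)` is a weak solution of `-(A(u'))' = f(u)` in `(0, L)`,
`u(0) = u(L) = 0`. -/
def IsWeakSolution (p L : ℝ) (A f u : ℝ → ℝ) : Prop :=
  ∃ u' : ℝ → ℝ, IsW01p p L u u' ∧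
    ∀ φ φ' : ℝ → ℝ, IsW01p p L φ φ' →
      ∫ t in Ioo 0 L, A (u' t) * φ' t = ∫ t in Ioo 0 L, f (u t) * φ t

/-- `u` is not the zero element of `L^p(0, L)`. -/
def IsNontrivial (L : ℝ) (u : ℝ → ℝ) : Prop := ¬ (∀ᵐ t ∂(intervalMeasure L), u t = 0)

/-- The flux of the classical `p`-Laplace operator, `Δ_p u = (|u'|^{p-2} u')'`. -/
def classicalFlux (p : ℝ) (x : ℝ) : ℝ := |x| ^ (p - 2) * x

/-- The flux of the asymmetric operator,
`Δ_p^{a,b} u = (a^p [(u')⁺]^{p-1} - b^p [(u')⁻]^{p-1})'`. -/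
def asymFlux (p a b : ℝ) (x : ℝ) : ℝ :=
  a ^ p * (max x 0) ^ (p - 1) - b ^ p * (max (-x) 0) ^ (p - 1)

/-- The right-hand side `μ (u⁺)^{p-1} - ν (u⁻)^{p-1}`. -/
def fucikTerm (p μ ν : ℝ) (x : ℝ) : ℝ :=
  μ * (max x 0) ^ (p - 1) - ν * (max (-x) 0) ^ (p - 1)

/-- `u ∈ W₀^{1,p}(0, L)` is a nontrivial weak solution of
`-Δ_p^{a,b} u = μ (u⁺)^{p-1} - ν (u⁻)^{p-1}` in `(0, L)`, `u(0) = u(L) = 0`. -/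
def IsNontrivialSolution (p a b L μ ν : ℝ) (u : ℝ → ℝ) : Prop :=
  IsWeakSolution p L (asymFlux p a b) (fucikTerm p μ ν) u ∧ IsNontrivial L u

/-- The Fučík spectrum `Σ_p^{a,b}(0, L)`. -/
def fucikSpectrum (p a b L : ℝ) : Set (ℝ × ℝ) :=
  {q | ∃ u : ℝ → ℝ, IsNontrivialSolution p a b L q.1 q.2 u}

/-- The Fučík spectrum `Σ_p(0, L)` of the classical operator `-Δ_p`. -/
def classicalFucikSpectrum (p L : ℝ) : Set (ℝ × ℝ) :=
  {q | ∃ u : ℝ → ℝ,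
    IsWeakSolution p L (classicalFlux p) (fucikTerm p q.1 q.2) u ∧ IsNontrivial L u}

/-- `λ_{1,p}^{a,b}(0, L)`, the infimum of `∫ a^p [(u')⁺]^p + b^p [(u')⁻]^p` over
`u ∈ W₀^{1,p}(0, L)` with `‖u‖_p = 1`. -/
def firstEigenvalue (p a b L : ℝ) : ℝ :=
  sInf {E | ∃ u u' : ℝ → ℝ, IsW01p p L u u' ∧ ∫ t in Ioo 0 L, |u t| ^ p = 1 ∧
    E = ∫ t in Ioo 0 L, (a ^ p * (max (u' t) 0) ^ p + b ^ p * (max (-u' t) 0) ^ p)}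

/-- `λ_{1,p}(0, L)`, the first Dirichlet eigenvalue of the classical operator `-Δ_p`. -/
def classicalFirstEigenvalue (p L : ℝ) : ℝ :=
  sInf {E | ∃ u u' : ℝ → ℝ, IsW01p p L u u' ∧ ∫ t in Ioo 0 L, |u t| ^ p = 1 ∧
    E = ∫ t in Ioo 0 L, |u' t| ^ p}

/-- `φ` is (the continuous representative of) the positive eigenfunction of `-Δ_p` on `(0, 1)`
for the eigenvalue `λ_{1,p}(0, 1)`, normalized by `‖φ‖_p = 1`. -/
structure IsPrincipalEigenfunction (p : ℝ) (φ : ℝ → ℝ) : Prop where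
  continuousOn : ContinuousOn φ (Icc 0 1)
  pos : ∀ t ∈ Ioo (0 : ℝ) 1, 0 < φ t
  weakSolution : IsWeakSolution p 1 (classicalFlux p)
    (fun x => classicalFirstEigenvalue p 1 * (|x| ^ (p - 2) * x)) φ
  normalized : ∫ t in Ioo (0 : ℝ) 1, |φ t| ^ p = 1

/-- The principal eigenfunction `φ_p`; only its values on `[0, 1]`, which are determined by
`IsPrincipalEigenfunction`, are ever used. -/
def principalEigenfunction (p : ℝ) : ℝ → ℝ :=
  Classical.epsilon (IsPrincipalEigenfunction p)

/-- `φ_p^{a,b,+}` on `[0, 1]`, with `t₀ = a / (a + b)`. -/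
def phiPlus (p a b : ℝ) (t : ℝ) : ℝ :=
  let t₀ := a / (a + b)
  if t < t₀ then principalEigenfunction p (t / (2 * t₀))
  else principalEigenfunction p ((t + 1 - 2 * t₀) / (2 * (1 - t₀)))

/-- `φ_p^{a,b,-}` on `[0, 1]`, with `t₀ = a / (a + b)`. -/
def phiMinus (p a b : ℝ) (t : ℝ) : ℝ :=
  let t₀ := a / (a + b)
  if t < 1 - t₀ then - principalEigenfunction p (t / (2 * (1 - t₀)))
  else - principalEigenfunction p ((t + 2 * t₀ - 1) / (2 * t₀))

/-- The length `(λ_{1,p}^{a,b}(0, 1) / μ)^{1/p}`, meaningful for `μ > 0`. -/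
def nodalLength (p a b μ : ℝ) : ℝ := (firstEigenvalue p a b 1 / μ) ^ (1 / p)

/-- The nonempty open intervals `I_i = (α i, β i)`, `i < P`, and `J_j = (γ j, δ j)`, `j < N`, form
an interspersed cover of `[0, L]`. Either family may be empty. -/
structure IsInterspersedCover (L : ℝ) {P N : ℕ} (α β : Fin P → ℝ) (γ δ : Fin N → ℝ) : Prop where
  nonempty_I : ∀ i, α i < β i
  nonempty_J : ∀ j, γ j < δ j
  closure_disjoint_I : ∀ i i', i ≠ i' → Disjoint (Icc (α i) (β i)) (Icc (α i') (β i'))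
  closure_disjoint_J : ∀ j j', j ≠ j' → Disjoint (Icc (γ j) (δ j)) (Icc (γ j') (δ j'))
  disjoint_I_J : ∀ i j, Disjoint (Ioo (α i) (β i)) (Ioo (γ j) (δ j))
  ordered_I : ∀ i i', i < i' → ∀ x ∈ Ioo (α i) (β i), ∀ y ∈ Ioo (α i') (β i'), x ≤ y
  ordered_J : ∀ j j', j < j' → ∀ x ∈ Ioo (γ j) (δ j), ∀ y ∈ Ioo (γ j') (δ j'), x ≤ y
  cover : (⋃ i, Icc (α i) (β i)) ∪ (⋃ j, Icc (γ j) (δ j)) = Icc 0 L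

/-- `Φ` is the function on `[0, L]` equal to `l_μ φ_p^{a,b,+}` on each closed interval
`[α i, β i]` and to `l_ν φ_p^{a,b,-}` on each closed interval `[γ j, δ j]`, both precomposed with
the increasing affine bijection of that interval onto `[0, 1]`. -/
def IsGluedProfile (p a b μ ν : ℝ) {P N : ℕ} (α β : Fin P → ℝ) (γ δ : Fin N → ℝ)
    (Φ : ℝ → ℝ) : Prop :=
  (∀ i, ∀ t ∈ Icc (α i) (β i),
    Φ t = nodalLength p a b μ * phiPlus p a b ((t - α i) / (β i - α i))) ∧
  (∀ j, ∀ t ∈ Icc (γ j) (δ j),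
    Φ t = nodalLength p a b ν * phiMinus p a b ((t - γ j) / (δ j - γ j)))

end AsymPLap

end

/-! The problem is one-dimensional, autonomous and homogeneous, so it can be solved by quadrature.
With the flux `W = A(U')` as second unknown it becomes the system `U' = A⁻¹(W)`, `W' = -f(U)`. A du
Bois-Reymond argument (`IsWeakSolution.exists_isFlow`) shows that every weak solution has a
continuous representative solving this system classically. It rests on the description of `W₀^{1,p}`
as the primitives of `L^p` functions of zero mean.

The system conserves an energy (`IsFlowOn.energy_eq`). Between consecutive zeros the energy identity
is a separable equation, integrated by the generalized arcsine. A positive arch is therefore a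
rising half of `sinp` stretched by `a`, followed by a falling half stretched by `b`. Its length `(a
+ b) * halfPip p / freq p μ` is forced and only its amplitude is free (`IsFlowOn.rising`,
`IsFlowOn.positive_arch`). No uniqueness theorem for differential equations is used, although the
powers involved need not be Lipschitz.

Energy conservation also makes the flux of a nontrivial solution nonzero at `0`. So an arch starts
there, ends with a flux of the opposite sign, and is followed by an arch of the opposite sign with
the same scale, until `L` is hit exactly. Conversely, arches with a common scale have matching
fluxes at their junctions, and their concatenation is a weak solution (`isNontrivialSolution_iff`).

It remains to identify the constants. A Picone inequality against the explicit arch gives the sharp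
Poincaré constant `(p - 1) * (halfPip p * (a + b)) ^ p`, which the arch attains
(`firstEigenvalue_eq`). Hence the nodal lengths are the arch lengths. The principal eigenfunction is
a multiple of the symmetric arch, and its stretched halves form the asymmetric one. The spectral
identity follows since arch lengths depend only on `(a + b) / μ ^ (1/p)`. -/

noncomputable section

namespace AsymPLap

/-! ### Generalized arcsine, sine, and the flux of the sine -/

/-- The derivative of the generalized arcsine, extended by `1` outside `[0, 1)`. -/
def arcsinpDensity (p s : ℝ) : ℝ :=
  if s < 1 then (1 - (max s 0) ^ p) ^ (-(1 / p)) else 1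

lemma one_sub_rpow_pos {p : ℝ} (hp : 1 < p) {s : ℝ} (hs : s < 1) : 0 < 1 - (max s 0) ^ p := by
  have : (max s 0) ^ p < 1 := Real.rpow_lt_one (le_max_right _ _) (by simp [hs]) (by linarith)
  linarith

/-- Because this bound holds on the whole line, extension included, the primitive is strictly
increasing and onto, so its inverse is defined and continuous everywhere. -/
lemma one_le_arcsinpDensity {p : ℝ} (hp : 1 < p) (s : ℝ) : 1 ≤ arcsinpDensity p s := by
  unfold arcsinpDensity
  split_ifs with hs
  · apply Real.one_le_rpow_of_pos_of_le_one_of_nonpos (one_sub_rpow_pos hp hs)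
    · have : 0 ≤ (max s 0) ^ p := Real.rpow_nonneg (le_max_right _ _) _
      linarith
    · have : 0 < 1 / p := by positivity
      linarith
  · exact le_rfl

/-- Since `s ^ p ≤ s` on `[0, 1]`, the singularity at `1` is dominated by `|1 - s| ^ (-(1 / p))`,
which is integrable because `p > 1`. -/
lemma arcsinpDensity_le {p : ℝ} (hp : 1 < p) (s : ℝ) :
    arcsinpDensity p s ≤ 1 + |1 - s| ^ (-(1 / p)) := by
  have hn : 0 ≤ |1 - s| ^ (-(1 / p)) := Real.rpow_nonneg (abs_nonneg _) _
  have hp0 : 0 < 1 / p := by positivity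
  unfold arcsinpDensity
  split_ifs with hs
  · rcases le_total s 0 with h0 | h0
    · rw [max_eq_right h0, Real.zero_rpow (by linarith)]
      simp only [sub_zero, Real.one_rpow]; linarith
    · rw [max_eq_left h0, abs_of_pos (by linarith)]
      have h1 : s ^ p ≤ s := by
        have := Real.rpow_le_rpow_of_exponent_ge' h0 hs.le (zero_le_one) hp.le
        simpa using this
      have : (1 - s ^ p) ^ (-(1 / p)) ≤ (1 - s) ^ (-(1 / p)) :=
        Real.rpow_le_rpow_of_nonpos (by linarith) (by linarith) (by linarith)
      linarith
  · linarith

lemma measurable_arcsinpDensity (p : ℝ) : Measurable (arcsinpDensity p) := by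
  unfold arcsinpDensity
  refine Measurable.ite measurableSet_Iio ?_ measurable_const
  fun_prop

lemma intervalIntegrable_abs_rpow {r : ℝ} (hr : -1 < r) (x y : ℝ) :
    IntervalIntegrable (fun s => |s| ^ r) volume x y := by
  have key : ∀ c : ℝ, IntervalIntegrable (fun s => |s| ^ r) volume 0 c := by
    have pos : ∀ c : ℝ, 0 ≤ c → IntervalIntegrable (fun s => |s| ^ r) volume 0 c := by
      intro c hc
      refine (intervalIntegral.intervalIntegrable_rpow' (a := 0) (b := c) hr).congr ?_
      intro s hs
      rw [uIoc_of_le hc] at hs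
      simp [abs_of_pos hs.1]
    intro c
    rcases le_total 0 c with hc | hc
    · exact pos c hc
    · have := (pos (-c) (by linarith)).comp_sub_left 0
      simpa using this
  exact (key x).symm.trans (key y)

lemma intervalIntegrable_arcsinpDensity {p : ℝ} (hp : 1 < p) (x y : ℝ) :
    IntervalIntegrable (arcsinpDensity p) volume x y := by
  have hp1 : 1 / p < 1 := by rw [div_lt_one (by linarith)]; exact hp
  have h1 := (intervalIntegrable_abs_rpow (r := -(1 / p)) (by linarith) (1 - x) (1 - y)).comp_sub_left 1
  simp only [sub_sub_cancel] at h1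
  refine ((intervalIntegrable_const (c := (1 : ℝ))).add h1).mono_fun
    (measurable_arcsinpDensity p).aestronglyMeasurable ?_
  refine Filter.Eventually.of_forall fun s => ?_
  simp only [Real.norm_eq_abs]
  rw [abs_of_nonneg (by linarith [one_le_arcsinpDensity hp s])]
  exact (arcsinpDensity_le hp s).trans (le_abs_self _)

/-- The generalized arcsine `x ↦ ∫₀ˣ (1 - s ^ p) ^ (-1/p) ds`, extended to an increasing
bijection of the line. -/
def arcsinp (p x : ℝ) : ℝ := ∫ s in (0 : ℝ)..x, arcsinpDensity p s

lemma arcsinp_sub {p : ℝ} (hp : 1 < p) (x y : ℝ) :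
    arcsinp p y - arcsinp p x = ∫ s in x..y, arcsinpDensity p s :=
  intervalIntegral.integral_interval_sub_left (intervalIntegrable_arcsinpDensity hp _ _)
    (intervalIntegrable_arcsinpDensity hp _ _)

lemma sub_le_arcsinp_sub {p : ℝ} (hp : 1 < p) {x y : ℝ} (hxy : x ≤ y) :
    y - x ≤ arcsinp p y - arcsinp p x := by
  rw [arcsinp_sub hp]
  calc y - x = ∫ _ in x..y, (1 : ℝ) := by simp
    _ ≤ _ := intervalIntegral.integral_mono_on hxy intervalIntegrable_const
      (intervalIntegrable_arcsinpDensity hp _ _) fun s _ => one_le_arcsinpDensity hp s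

lemma arcsinp_zero (p : ℝ) : arcsinp p 0 = 0 := by simp [arcsinp]

lemma strictMono_arcsinp {p : ℝ} (hp : 1 < p) : StrictMono (arcsinp p) := fun x y h => by
  linarith [sub_le_arcsinp_sub hp h.le]

lemma continuous_arcsinp {p : ℝ} (hp : 1 < p) : Continuous (arcsinp p) :=
  intervalIntegral.continuous_primitive (intervalIntegrable_arcsinpDensity hp) 0

lemma surjective_arcsinp {p : ℝ} (hp : 1 < p) : Function.Surjective (arcsinp p) := by
  apply (continuous_arcsinp hp).surjective
  · refine Filter.tendsto_atTop_mono' _ ?_ Filter.tendsto_id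
    filter_upwards [Filter.eventually_ge_atTop 0] with x hx
    have := sub_le_arcsinp_sub hp hx
    rw [arcsinp_zero] at this
    simpa using this
  · refine Filter.tendsto_atBot_mono' _ ?_ Filter.tendsto_id
    filter_upwards [Filter.eventually_le_atBot 0] with x hx
    have := sub_le_arcsinp_sub hp hx
    rw [arcsinp_zero] at this
    simp only [id]; linarith

/-- The truncation by `max` keeps the density continuous on all of `(-∞, 1)`, so the point `0` needs
no one-sided treatment. -/
lemma hasDerivAt_arcsinp {p : ℝ} (hp : 1 < p) {x : ℝ} (hx : x < 1) :
    HasDerivAt (arcsinp p) ((1 - (max x 0) ^ p) ^ (-(1 / p))) x := by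
  have hx' : arcsinpDensity p x = (1 - (max x 0) ^ p) ^ (-(1 / p)) := by simp [arcsinpDensity, hx]
  rw [← hx']
  refine intervalIntegral.integral_hasDerivAt_right (intervalIntegrable_arcsinpDensity hp _ _)
    (measurable_arcsinpDensity p).stronglyMeasurable.stronglyMeasurableAtFilter ?_
  have : ContinuousAt (fun s : ℝ => (1 - (max s 0) ^ p) ^ (-(1 / p))) x := by
    refine ContinuousAt.rpow_const ?_ (Or.inl (one_sub_rpow_pos hp hx).ne')
    refine continuousAt_const.sub (ContinuousAt.rpow_const (by fun_prop) (Or.inr (by linarith)))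
  refine this.congr ?_
  filter_upwards [Iio_mem_nhds hx] with s hs
  simp [arcsinpDensity, mem_Iio.1 hs]

open Classical in
/-- The generalized sine on `[0, halfPip p]`, extended to an increasing bijection of the line. -/
def sinp (p : ℝ) : ℝ → ℝ := Function.invFun (arcsinp p)

/-- Half of the generalized `π`, the value `arcsinp p 1`. -/
def halfPip (p : ℝ) : ℝ := arcsinp p 1

lemma arcsinp_sinp {p : ℝ} (hp : 1 < p) (x : ℝ) : arcsinp p (sinp p x) = x :=
  Function.rightInverse_invFun (surjective_arcsinp hp) x

lemma sinp_arcsinp {p : ℝ} (hp : 1 < p) (x : ℝ) : sinp p (arcsinp p x) = x :=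
  Function.leftInverse_invFun (strictMono_arcsinp hp).injective x

lemma strictMono_sinp {p : ℝ} (hp : 1 < p) : StrictMono (sinp p) := fun x y h => by
  rw [← (strictMono_arcsinp hp).lt_iff_lt, arcsinp_sinp hp, arcsinp_sinp hp]; exact h

lemma continuous_sinp {p : ℝ} (hp : 1 < p) : Continuous (sinp p) :=
  (strictMono_sinp hp).monotone.continuous_of_surjective
    (fun x => ⟨arcsinp p x, sinp_arcsinp hp x⟩)

lemma sinp_zero {p : ℝ} (hp : 1 < p) : sinp p 0 = 0 := by
  simpa [arcsinp_zero] using sinp_arcsinp hp 0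

lemma sinp_halfPip {p : ℝ} (hp : 1 < p) : sinp p (halfPip p) = 1 := sinp_arcsinp hp 1

lemma halfPip_pos {p : ℝ} (hp : 1 < p) : 0 < halfPip p := by
  rw [← arcsinp_zero p]; exact strictMono_arcsinp hp one_pos

lemma sinp_pos {p : ℝ} (hp : 1 < p) {x : ℝ} (hx : 0 < x) : 0 < sinp p x := by
  rw [← sinp_zero hp]; exact strictMono_sinp hp hx

lemma sinp_nonneg {p : ℝ} (hp : 1 < p) {x : ℝ} (hx : 0 ≤ x) : 0 ≤ sinp p x := by
  rw [← sinp_zero hp]; exact (strictMono_sinp hp).monotone hx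

lemma sinp_lt_one {p : ℝ} (hp : 1 < p) {x : ℝ} (hx : x < halfPip p) : sinp p x < 1 := by
  rw [← sinp_halfPip hp]; exact strictMono_sinp hp hx

/-- The flux `(sinp')^(p-1)` of the generalized sine. -/
def cosFlux (p x : ℝ) : ℝ := (1 - (max (sinp p x) 0) ^ p) ^ ((p - 1) / p)

/-- Inverse function rule. The derivative `(1 - S ^ p) ^ (1 / p)`, with `S` the truncated sine, is
expressed through the flux, which is the natural second unknown of the first order system. -/
lemma hasDerivAt_sinp {p : ℝ} (hp : 1 < p) {x : ℝ} (hx : x < halfPip p) :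
    HasDerivAt (sinp p) ((cosFlux p x) ^ (1 / (p - 1))) x := by
  have h1 := sinp_lt_one hp hx
  have hpos := one_sub_rpow_pos hp h1
  have h2 := HasDerivAt.of_local_left_inverse (f := arcsinp p) (g := sinp p) (a := x)
    (continuous_sinp hp).continuousAt (hasDerivAt_arcsinp hp h1)
    (Real.rpow_pos_of_pos hpos _).ne' (Filter.Eventually.of_forall (arcsinp_sinp hp))
  refine h2.congr_deriv ?_
  rw [← Real.rpow_neg hpos.le, neg_neg, cosFlux, ← Real.rpow_mul hpos.le]
  congr 1
  have : p - 1 ≠ 0 := by linarith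
  have : p ≠ 0 := by linarith
  field_simp

lemma continuous_cosFlux {p : ℝ} (hp : 1 < p) : Continuous (cosFlux p) := by
  unfold cosFlux
  refine Continuous.rpow_const ?_ fun x => Or.inr (div_nonneg (by linarith) (by linarith))
  refine continuous_const.sub (Continuous.rpow_const ?_ fun x => Or.inr (by linarith))
  exact (continuous_sinp hp).max continuous_const

/-- Together with `hasDerivAt_sinp` this is the equation `(S' ^ (p - 1))' = -(p - 1) S ^ (p - 1)`:
the chain rule produces the powers `-1/p` and `1/p` of `1 - S ^ p`, which cancel. -/
lemma hasDerivAt_cosFlux {p : ℝ} (hp : 1 < p) {x : ℝ} (h0 : 0 < x) (hx : x < halfPip p) :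
    HasDerivAt (cosFlux p) (-((p - 1) * (sinp p x) ^ (p - 1))) x := by
  have hs := sinp_pos hp h0
  have h1 := sinp_lt_one hp hx
  have hpos := one_sub_rpow_pos hp h1
  have hpos' : 0 < 1 - (sinp p x) ^ p := by rwa [max_eq_left hs.le] at hpos
  have hd := (((hasDerivAt_sinp hp hx).rpow_const (p := p) (Or.inl hs.ne')).const_sub 1).rpow_const
    (p := (p - 1) / p) (Or.inl hpos'.ne')
  have hev : cosFlux p =ᶠ[nhds x] fun y => (1 - (sinp p y) ^ p) ^ ((p - 1) / p) := by
    filter_upwards [lt_mem_nhds h0] with y hy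
    rw [cosFlux, max_eq_left (sinp_nonneg hp hy.le)]
  refine (hd.congr_of_eventuallyEq hev).congr_deriv ?_
  rw [cosFlux, max_eq_left hs.le, ← Real.rpow_mul hpos'.le]
  have hp1 : p - 1 ≠ 0 := by linarith
  have hp0 : p ≠ 0 := by linarith
  have e1 : (p - 1) / p * (1 / (p - 1)) = 1 / p := by field_simp
  have e2 : (p - 1) / p - 1 = - (1 / p) := by field_simp; ring
  rw [e1, e2, Real.rpow_neg hpos'.le]
  have := (Real.rpow_pos_of_pos hpos' (1 / p)).ne'
  field_simp

lemma cosFlux_zero {p : ℝ} (hp : 1 < p) : cosFlux p 0 = 1 := by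
  rw [cosFlux, sinp_zero hp, max_self, Real.zero_rpow (by linarith)]; simp

lemma cosFlux_halfPip {p : ℝ} (hp : 1 < p) : cosFlux p (halfPip p) = 0 := by
  rw [cosFlux, sinp_halfPip hp]
  have : (p - 1) / p ≠ 0 := (div_pos (by linarith) (by linarith)).ne'
  simp only [zero_le_one, sup_of_le_left, Real.one_rpow, sub_self]
  exact Real.zero_rpow this

lemma cosFlux_pos {p : ℝ} (hp : 1 < p) {x : ℝ} (hx : x < halfPip p) : 0 < cosFlux p x :=
  Real.rpow_pos_of_pos (one_sub_rpow_pos hp (sinp_lt_one hp hx)) _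

/-! ### Algebra of the asymmetric flux, its inverse and its energy density -/

/-- The inverse of `asymFlux`. -/
def asymFluxInv (p a b w : ℝ) : ℝ :=
  (max w 0 / a ^ p) ^ (1 / (p - 1)) - (max (-w) 0 / b ^ p) ^ (1 / (p - 1))

lemma asymFlux_neg (p a b x : ℝ) : asymFlux p a b (-x) = -asymFlux p b a x := by
  simp only [asymFlux, neg_neg]; ring

lemma asymFluxInv_neg (p a b x : ℝ) : asymFluxInv p a b (-x) = -asymFluxInv p b a x := by
  simp only [asymFluxInv, neg_neg]; ring

lemma fucikTerm_neg (p μ ν x : ℝ) : fucikTerm p μ ν (-x) = -fucikTerm p ν μ x := by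
  simp only [fucikTerm, neg_neg]; ring

lemma asymFlux_of_nonneg {p a b x : ℝ} (hp : 1 < p) (hx : 0 ≤ x) :
    asymFlux p a b x = a ^ p * x ^ (p - 1) := by
  rw [asymFlux, max_eq_left hx, max_eq_right (by linarith), Real.zero_rpow (by linarith)]; ring

lemma fucikTerm_of_nonneg {p μ ν x : ℝ} (hp : 1 < p) (hx : 0 ≤ x) :
    fucikTerm p μ ν x = μ * x ^ (p - 1) := by
  rw [fucikTerm, max_eq_left hx, max_eq_right (by linarith), Real.zero_rpow (by linarith)]; ring

lemma asymFluxInv_of_nonneg {p a b w : ℝ} (hp : 1 < p) (hw : 0 ≤ w) :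
    asymFluxInv p a b w = (w / a ^ p) ^ (1 / (p - 1)) := by
  have : 1 / (p - 1) ≠ 0 := (one_div_pos.2 (by linarith)).ne'
  rw [asymFluxInv, max_eq_left hw, max_eq_right (by linarith), zero_div, Real.zero_rpow this,
    sub_zero]

lemma asymFluxInv_zero {p a b : ℝ} (hp : 1 < p) : asymFluxInv p a b 0 = 0 := by
  rw [asymFluxInv_of_nonneg hp le_rfl, zero_div,
    Real.zero_rpow (one_div_pos.2 (by linarith)).ne']

lemma asymFluxInv_pos {p a b w : ℝ} (hp : 1 < p) (ha : 0 < a) (hw : 0 < w) :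
    0 < asymFluxInv p a b w := by
  rw [asymFluxInv_of_nonneg hp hw.le]
  exact Real.rpow_pos_of_pos (div_pos hw (Real.rpow_pos_of_pos ha _)) _

lemma asymFluxInv_neg_of_neg {p a b w : ℝ} (hp : 1 < p) (hb : 0 < b) (hw : w < 0) :
    asymFluxInv p a b w < 0 := by
  have := asymFluxInv_pos (b := a) hp hb (neg_pos.2 hw)
  rw [asymFluxInv_neg] at this; linarith

lemma asymFluxInv_asymFlux {p a b : ℝ} (hp : 1 < p) (ha : 0 < a) (hb : 0 < b) (x : ℝ) :
    asymFluxInv p a b (asymFlux p a b x) = x := by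
  -- Only nonnegative arguments need computation: negation exchanges `a` and `b`, so the other sign
  -- is the same statement with the weights swapped.
  have key : ∀ {a b x : ℝ}, 0 < a → 0 ≤ x → asymFluxInv p a b (asymFlux p a b x) = x := by
    intro a b x ha hx
    have hap := Real.rpow_pos_of_pos ha p
    rw [asymFlux_of_nonneg hp hx, asymFluxInv_of_nonneg hp (by positivity),
      mul_div_cancel_left₀ _ hap.ne', ← Real.rpow_mul hx, mul_one_div_cancel (by linarith),
      Real.rpow_one]
  rcases le_total 0 x with hx | hx
  · exact key ha hx
  · have := key (b := a) hb (neg_nonneg.2 hx)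
    rw [asymFlux_neg, asymFluxInv_neg] at this; linarith

lemma asymFlux_asymFluxInv {p a b : ℝ} (hp : 1 < p) (ha : 0 < a) (hb : 0 < b) (w : ℝ) :
    asymFlux p a b (asymFluxInv p a b w) = w := by
  have key : ∀ {a b w : ℝ}, 0 < a → 0 ≤ w → asymFlux p a b (asymFluxInv p a b w) = w := by
    intro a b w ha hw
    have hap := Real.rpow_pos_of_pos ha p
    have hq : 0 ≤ w / a ^ p := by positivity
    rw [asymFluxInv_of_nonneg hp hw, asymFlux_of_nonneg hp (by positivity),
      ← Real.rpow_mul hq, one_div_mul_cancel (by linarith), Real.rpow_one]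
    field_simp
  rcases le_total 0 w with hx | hx
  · exact key ha hx
  · have := key (b := a) hb (neg_nonneg.2 hx)
    rw [asymFluxInv_neg, asymFlux_neg] at this; linarith

lemma continuous_asymFlux {p a b : ℝ} (hp : 1 < p) : Continuous (asymFlux p a b) := by
  unfold asymFlux
  have h : ∀ x : ℝ, x ≠ 0 ∨ 0 ≤ p - 1 := fun x => Or.inr (by linarith)
  refine (continuous_const.mul (Continuous.rpow_const (by fun_prop) fun x => ?_)).sub
    (continuous_const.mul (Continuous.rpow_const (by fun_prop) fun x => ?_)) <;> exact h _

lemma continuous_fucikTerm {p μ ν : ℝ} (hp : 1 < p) : Continuous (fucikTerm p μ ν) := by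
  unfold fucikTerm
  have h : ∀ x : ℝ, x ≠ 0 ∨ 0 ≤ p - 1 := fun x => Or.inr (by linarith)
  refine (continuous_const.mul (Continuous.rpow_const (by fun_prop) fun x => ?_)).sub
    (continuous_const.mul (Continuous.rpow_const (by fun_prop) fun x => ?_)) <;> exact h _

lemma continuous_asymFluxInv {p a b : ℝ} (hp : 1 < p) : Continuous (asymFluxInv p a b) := by
  unfold asymFluxInv
  have h : ∀ x : ℝ, x ≠ 0 ∨ 0 ≤ 1 / (p - 1) :=
    fun x => Or.inr (one_div_nonneg.2 (by linarith))
  refine (Continuous.rpow_const (by fun_prop) fun x => ?_).sub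
    (Continuous.rpow_const (by fun_prop) fun x => ?_) <;> exact h _

lemma abs_rpow_mul_self_of_nonneg {p x : ℝ} (hp : 1 < p) (hx : 0 ≤ x) :
    |x| ^ (p - 2) * x = x ^ (p - 1) := by
  rcases hx.eq_or_lt with rfl | hx
  · rw [Real.zero_rpow (by linarith)]; simp
  · rw [abs_of_pos hx, ← Real.rpow_add_one hx.ne']; congr 1; ring

lemma abs_rpow_mul_self {p : ℝ} (hp : 1 < p) (x : ℝ) :
    |x| ^ (p - 2) * x = (max x 0) ^ (p - 1) - (max (-x) 0) ^ (p - 1) := by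
  rcases le_total 0 x with hx | hx
  · rw [abs_rpow_mul_self_of_nonneg hp hx, max_eq_left hx, max_eq_right (by linarith : -x ≤ 0),
      Real.zero_rpow (by linarith)]; ring
  · have := abs_rpow_mul_self_of_nonneg hp (neg_nonneg.2 hx)
    rw [abs_neg] at this
    rw [max_eq_right hx, max_eq_left (by linarith : 0 ≤ -x), Real.zero_rpow (by linarith), ← this]
    ring

lemma classicalFlux_eq {p : ℝ} (hp : 1 < p) : classicalFlux p = asymFlux p 1 1 := by
  ext x; rw [classicalFlux, abs_rpow_mul_self hp, asymFlux]; simp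

lemma fucikTerm_diag {p : ℝ} (hp : 1 < p) (c : ℝ) :
    (fun x : ℝ => c * (|x| ^ (p - 2) * x)) = fucikTerm p c c := by
  ext x; rw [abs_rpow_mul_self hp, fucikTerm]; ring

/-- For `q > 1` both one-sided derivatives at `0` vanish. This lets the energy and the Picone
quotient be differentiated without separating signs. -/
lemma hasDerivAt_posPart_rpow {q : ℝ} (hq : 1 < q) (x : ℝ) :
    HasDerivAt (fun s : ℝ => (max s 0) ^ q) (q * (max x 0) ^ (q - 1)) x := by
  rcases lt_trichotomy x 0 with hx | rfl | hx
  · rw [max_eq_right hx.le, Real.zero_rpow (by linarith), mul_zero]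
    refine (hasDerivAt_const x (0 : ℝ)).congr_of_eventuallyEq ?_
    filter_upwards [gt_mem_nhds hx] with s hs
    rw [max_eq_right hs.le, Real.zero_rpow (by linarith)]
  · rw [max_self, Real.zero_rpow (by linarith), mul_zero]
    have h1 : HasDerivWithinAt (fun s : ℝ => (max s 0) ^ q) 0 (Ici 0) 0 := by
      have := (Real.hasDerivAt_rpow_const (x := 0) (p := q) (Or.inr hq.le)).hasDerivWithinAt
        (s := Ici (0 : ℝ))
      rw [Real.zero_rpow (by linarith), mul_zero] at this
      refine this.congr (fun s hs => ?_) (by simp)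
      rw [max_eq_left (mem_Ici.1 hs)]
    have h2 : HasDerivWithinAt (fun s : ℝ => (max s 0) ^ q) 0 (Iic 0) 0 := by
      refine (hasDerivWithinAt_const (0 : ℝ) (Iic 0) (0 : ℝ)).congr (fun s hs => ?_) ?_
      · rw [max_eq_right (mem_Iic.1 hs), Real.zero_rpow (by linarith)]
      · rw [max_self, Real.zero_rpow (by linarith)]
    have := h1.union h2
    rwa [Ici_union_Iic, hasDerivWithinAt_univ] at this
  · rw [max_eq_left hx.le]
    refine (Real.hasDerivAt_rpow_const (Or.inr hq.le)).congr_of_eventuallyEq ?_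
    filter_upwards [lt_mem_nhds hx] with s hs
    rw [max_eq_left hs.le]

/-- The density `a^p (x⁺)^p + b^p (x⁻)^p` of the energy. -/
def asymEnergy (p a b x : ℝ) : ℝ := a ^ p * (max x 0) ^ p + b ^ p * (max (-x) 0) ^ p

lemma asymEnergy_neg (p a b x : ℝ) : asymEnergy p a b (-x) = asymEnergy p b a x := by
  simp only [asymEnergy, neg_neg]; ring

lemma asymEnergy_of_nonneg {p a b x : ℝ} (hp : 1 < p) (hx : 0 ≤ x) :
    asymEnergy p a b x = a ^ p * x ^ p := by
  rw [asymEnergy, max_eq_left hx, max_eq_right (by linarith), Real.zero_rpow (by linarith)]; ring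

lemma posPart_rpow_mul_self {p : ℝ} (hp : 1 < p) (x : ℝ) :
    (max x 0) ^ (p - 1) * x = (max x 0) ^ p := by
  rcases le_or_gt x 0 with hx | hx
  · rw [max_eq_right hx, Real.zero_rpow (by linarith), Real.zero_rpow (by linarith), zero_mul]
  · rw [max_eq_left hx.le, ← Real.rpow_add_one hx.ne']; congr 1; ring

lemma asymFlux_mul_self {p : ℝ} (hp : 1 < p) (a b x : ℝ) :
    asymFlux p a b x * x = asymEnergy p a b x := by
  have h1 := posPart_rpow_mul_self hp x
  have h2 := posPart_rpow_mul_self hp (-x)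
  rw [asymFlux, asymEnergy, ← h1, ← h2]; ring

lemma fucikTerm_mul_self {p : ℝ} (hp : 1 < p) (c x : ℝ) :
    fucikTerm p c c x * x = c * |x| ^ p := by
  have h1 := posPart_rpow_mul_self hp x
  have h2 := posPart_rpow_mul_self hp (-x)
  have : |x| ^ p = (max x 0) ^ p + (max (-x) 0) ^ p := by
    rcases le_total 0 x with hx | hx
    · rw [max_eq_left hx, max_eq_right (by linarith : -x ≤ 0), Real.zero_rpow (by linarith),
        abs_of_nonneg hx, add_zero]
    · rw [max_eq_right hx, max_eq_left (by linarith : 0 ≤ -x), Real.zero_rpow (by linarith),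
        abs_of_nonpos hx, zero_add]
  rw [this, fucikTerm, ← h1, ← h2]; ring

/-! ### The space `W₀^{1,p}` as primitives of `L^p` functions of zero mean -/

instance isFiniteMeasure_intervalMeasure (L : ℝ) : IsFiniteMeasure (intervalMeasure L) := by
  unfold intervalMeasure; infer_instance

lemma one_le_ofReal {p : ℝ} (hp : 1 < p) : 1 ≤ ENNReal.ofReal p := by
  rw [← ENNReal.ofReal_one]; exact ENNReal.ofReal_le_ofReal hp.le

lemma tendsto_const_mul_nhds_zero {C : ENNReal} (hC : C ≠ ⊤) :
    Filter.Tendsto (fun e : ℝ => C * ENNReal.ofReal e) (nhdsWithin 0 (Ioi 0)) (nhds 0) := by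
  have h1 : Filter.Tendsto (fun e : ℝ => ENNReal.ofReal e) (nhds 0) (nhds 0) := by
    simpa using (ENNReal.continuous_ofReal.tendsto 0)
  have := ENNReal.Tendsto.const_mul h1 (Or.inr hC)
  rw [mul_zero] at this
  exact this.mono_left nhdsWithin_le_nhds

lemma eq_zero_of_forall_le_const_mul {X C : ENNReal} (hC : C ≠ ⊤)
    (h : ∀ e : ℝ, 0 < e → X ≤ C * ENNReal.ofReal e) : X = 0 := by
  refine le_antisymm (ge_of_tendsto (tendsto_const_mul_nhds_zero hC) ?_) zero_le
  filter_upwards [self_mem_nhdsWithin] with e he using h e he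

lemma exists_pos_const_mul_lt {C ε : ENNReal} (hC : C ≠ ⊤) (hε : 0 < ε) :
    ∃ e : ℝ, 0 < e ∧ C * ENNReal.ofReal e < ε := by
  have h := (tendsto_const_mul_nhds_zero hC).eventually (gt_mem_nhds hε)
  obtain ⟨e, h1, h2⟩ := (h.and self_mem_nhdsWithin).exists
  exact ⟨e, h2, h1⟩

/-- The constant in the inclusion of `L^p(0, L)` in `L^1(0, L)`. -/
def lpToL1Const (p L : ℝ) : ENNReal :=
  intervalMeasure L univ ^ (1 / (1 : ENNReal).toReal - 1 / (ENNReal.ofReal p).toReal)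

lemma lpToL1Const_ne_top {p L : ℝ} (hp : 1 < p) : lpToL1Const p L ≠ ⊤ := by
  refine ENNReal.rpow_ne_top_of_nonneg ?_ (measure_ne_top _ _)
  rw [ENNReal.toReal_ofReal (by linarith)]
  simp only [ENNReal.toReal_one, div_one, sub_nonneg]
  rw [one_div]; exact inv_le_one_of_one_le₀ hp.le

lemma lintegral_enorm_le_eLpNorm {p L : ℝ} (hp : 1 < p) {f : ℝ → ℝ}
    (hf : AEStronglyMeasurable f (intervalMeasure L)) :
    ∫⁻ t in Ioo 0 L, ‖f t‖ₑ ≤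
      lpToL1Const p L * eLpNorm f (ENNReal.ofReal p) (intervalMeasure L) := by
  have := eLpNorm_le_eLpNorm_mul_rpow_measure_univ (one_le_ofReal hp) hf
  rw [eLpNorm_one_eq_lintegral_enorm] at this
  rw [mul_comm]; exact this

lemma intervalIntegrable_of_memLp {p L : ℝ} (hp : 1 < p) (hL : 0 < L) {f : ℝ → ℝ}
    (hf : MemLp f (ENNReal.ofReal p) (intervalMeasure L)) : IntervalIntegrable f volume 0 L := by
  rw [intervalIntegrable_iff_integrableOn_Ioo_of_le hL.le]
  exact hf.integrable (one_le_ofReal hp)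

lemma enorm_intervalIntegral_sub_le {L : ℝ} {f g : ℝ → ℝ}
    (hf : IntervalIntegrable f volume 0 L) (hg : IntervalIntegrable g volume 0 L) {t : ℝ}
    (ht : t ∈ Icc 0 L) :
    ‖(∫ s in (0 : ℝ)..t, f s) - ∫ s in (0 : ℝ)..t, g s‖ₑ ≤ ∫⁻ s in Ioo 0 L, ‖f s - g s‖ₑ := by
  have hsub : uIcc 0 t ⊆ uIcc 0 L := by
    rw [uIcc_of_le ht.1, uIcc_of_le (ht.1.trans ht.2)]; exact Icc_subset_Icc_right ht.2
  rw [← intervalIntegral.integral_sub (hf.mono_set hsub) (hg.mono_set hsub),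
    intervalIntegral.integral_of_le ht.1]
  refine (enorm_integral_le_lintegral_enorm _).trans ?_
  rw [restrict_Ioo_eq_restrict_Ioc]
  exact lintegral_mono_set (Ioc_subset_Ioc_right ht.2)

/-- Integration by parts for primitives of integrable functions. -/
lemma integral_primitive_mul {L c : ℝ} (hL : 0 < L) {f g : ℝ → ℝ}
    (hf : IntervalIntegrable f volume 0 L) (hg : IntervalIntegrable g volume 0 L)
    (h0 : ∫ s in (0 : ℝ)..L, g s = 0) :
    ∫ t in Ioo 0 L, (c + ∫ s in (0 : ℝ)..t, f s) * g t =
      - ∫ t in Ioo 0 L, f t * ∫ s in (0 : ℝ)..t, g s := by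
  have hF := hf.absolutelyContinuousOnInterval_intervalIntegral (c := 0) (by simp)
  have hG := hg.absolutelyContinuousOnInterval_intervalIntegral (c := 0) (by simp)
  have hF' : ∀ᵐ x, x ∈ uIcc 0 L → deriv (fun x => ∫ s in (0 : ℝ)..x, f s) x = f x := by
    filter_upwards [hf.ae_hasDerivAt_integral] with x hx hx'
    exact (hx hx' 0 (by simp)).deriv
  have hG' : ∀ᵐ x, x ∈ uIcc 0 L → deriv (fun x => ∫ s in (0 : ℝ)..x, g s) x = g x := by
    filter_upwards [hg.ae_hasDerivAt_integral] with x hx hx'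
    exact (hx hx' 0 (by simp)).deriv
  have key := hF.integral_mul_deriv_eq_deriv_mul hG
  have e1 : ∫ x in (0 : ℝ)..L, (∫ s in (0 : ℝ)..x, f s) * deriv (fun x => ∫ s in (0 : ℝ)..x, g s) x
      = ∫ x in (0 : ℝ)..L, (∫ s in (0 : ℝ)..x, f s) * g x := by
    apply intervalIntegral.integral_congr_ae
    filter_upwards [hG'] with x hx hx'
    rw [hx (uIoc_subset_uIcc hx')]
  have e2 : ∫ x in (0 : ℝ)..L, deriv (fun x => ∫ s in (0 : ℝ)..x, f s) x * (∫ s in (0 : ℝ)..x, g s)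
      = ∫ x in (0 : ℝ)..L, f x * (∫ s in (0 : ℝ)..x, g s) := by
    apply intervalIntegral.integral_congr_ae
    filter_upwards [hF'] with x hx hx'
    rw [hx (uIoc_subset_uIcc hx')]
  -- Both boundary terms drop: the primitive of `g` vanishes at `0` trivially and at `L` by `h0`.
  rw [e1, e2, h0] at key
  have e3 : ∫ x in (0 : ℝ)..L, (c + ∫ s in (0 : ℝ)..x, f s) * g x
      = c * (∫ x in (0 : ℝ)..L, g x) + ∫ x in (0 : ℝ)..L, (∫ s in (0 : ℝ)..x, f s) * g x := by
    rw [← intervalIntegral.integral_const_mul, ← intervalIntegral.integral_add]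
    · simp_rw [add_mul]
    · exact hg.const_mul c
    · exact hg.continuousOn_mul hF.continuousOn
  rw [h0] at e3
  simp only [← integral_Ioc_eq_integral_Ioo]
  rw [← intervalIntegral.integral_of_le hL.le, ← intervalIntegral.integral_of_le hL.le, e3, key]
  simp

namespace IsTestFunction

variable {L : ℝ} {φ : ℝ → ℝ}

lemma hasDerivAt (h : IsTestFunction L φ) (t : ℝ) : HasDerivAt φ (deriv φ t) t :=
  (h.1.differentiable (by simp)).differentiableAt.hasDerivAt

lemma continuous_deriv (h : IsTestFunction L φ) : Continuous (deriv φ) :=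
  h.1.continuous_deriv (by simp)

lemma eq_zero (h : IsTestFunction L φ) {t : ℝ} (ht : t ∉ Ioo 0 L) : φ t = 0 :=
  image_eq_zero_of_notMem_tsupport fun h' => ht (h.2.2 h')

lemma eq_integral (h : IsTestFunction L φ) (t : ℝ) : ∫ s in (0 : ℝ)..t, deriv φ s = φ t := by
  rw [intervalIntegral.integral_eq_sub_of_hasDerivAt (fun x _ => h.hasDerivAt x)
    (h.continuous_deriv.intervalIntegrable _ _), h.eq_zero (t := 0) (by simp), sub_zero]

lemma integral_deriv (h : IsTestFunction L φ) : ∫ s in (0 : ℝ)..L, deriv φ s = 0 := by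
  rw [h.eq_integral, h.eq_zero (by simp)]

end IsTestFunction

/-- Test functions have derivatives of zero integral, and the integral over a bounded interval is
continuous for `L^p` convergence. This carries the boundary condition at `L`. -/
lemma IsW01p.integral_deriv_eq_zero {p L : ℝ} (hp : 1 < p) (hL : 0 < L) {u u' : ℝ → ℝ}
    (h : IsW01p p L u u') : ∫ s in (0 : ℝ)..L, u' s = 0 := by
  rw [← enorm_eq_zero]
  refine eq_zero_of_forall_le_const_mul (lpToL1Const_ne_top (L := L) hp) fun e he => ?_
  obtain ⟨φ, hφ, -, h2⟩ := h.approx (ENNReal.ofReal e) (by simpa using he)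
  have hi := intervalIntegrable_of_memLp hp hL h.memLp_deriv
  have := enorm_intervalIntegral_sub_le hi
    (hφ.continuous_deriv.intervalIntegrable _ _) (t := L) ⟨hL.le, le_rfl⟩
  rw [hφ.integral_deriv, sub_zero] at this
  refine (this.trans (lintegral_enorm_le_eLpNorm hp ?_)).trans (by gcongr)
  exact h.memLp_deriv.1.sub hφ.continuous_deriv.aestronglyMeasurable

/-- For a test function this is the fundamental theorem of calculus. Under approximation in
`W^{1,p}` the left side converges in `L^1` and the primitives converge uniformly. -/
lemma IsW01p.ae_eq_primitive {p L : ℝ} (hp : 1 < p) (hL : 0 < L) {u u' : ℝ → ℝ}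
    (h : IsW01p p L u u') :
    ∀ᵐ t ∂(intervalMeasure L), u t = ∫ s in (0 : ℝ)..t, u' s := by
  have hi := intervalIntegrable_of_memLp hp hL h.memLp_deriv
  have hcont : ContinuousOn (fun t => ∫ s in (0 : ℝ)..t, u' s) (Icc 0 L) := by
    have := intervalIntegral.continuousOn_primitive_interval' hi left_mem_uIcc
    rwa [uIcc_of_le hL.le] at this
  have hm : AEStronglyMeasurable (fun t => u t - ∫ s in (0 : ℝ)..t, u' s) (intervalMeasure L) :=
    h.memLp.1.sub ((hcont.mono Ioo_subset_Icc_self).aestronglyMeasurable measurableSet_Ioo)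
  have hzero : ∫⁻ t in Ioo 0 L, ‖u t - ∫ s in (0 : ℝ)..t, u' s‖ₑ = 0 := by
    refine eq_zero_of_forall_le_const_mul
      (C := lpToL1Const p L + lpToL1Const p L * volume (Ioo 0 L)) ?_ fun e he => ?_
    · exact ENNReal.add_ne_top.2 ⟨lpToL1Const_ne_top hp,
        ENNReal.mul_ne_top (lpToL1Const_ne_top hp) measure_Ioo_lt_top.ne⟩
    obtain ⟨φ, hφ, h1, h2⟩ := h.approx (ENNReal.ofReal e) (by simpa using he)
    have b1 : ∫⁻ t in Ioo 0 L, ‖u t - φ t‖ₑ ≤ lpToL1Const p L * ENNReal.ofReal e :=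
      (lintegral_enorm_le_eLpNorm hp
        (h.memLp.1.sub hφ.1.continuous.aestronglyMeasurable)).trans (by gcongr; exact h1.le)
    have b2 : ∫⁻ t in Ioo 0 L, ‖u' t - deriv φ t‖ₑ ≤ lpToL1Const p L * ENNReal.ofReal e :=
      (lintegral_enorm_le_eLpNorm hp
        (h.memLp_deriv.1.sub hφ.continuous_deriv.aestronglyMeasurable)).trans
          (by gcongr; exact h2.le)
    have b3 : ∀ t ∈ Ioo 0 L, ‖φ t - ∫ s in (0 : ℝ)..t, u' s‖ₑ ≤
        lpToL1Const p L * ENNReal.ofReal e := by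
      intro t ht
      have := enorm_intervalIntegral_sub_le hi
        (hφ.continuous_deriv.intervalIntegrable _ _) (Ioo_subset_Icc_self ht)
      rw [hφ.eq_integral] at this
      rw [← enorm_neg, neg_sub]
      exact this.trans b2
    calc ∫⁻ t in Ioo 0 L, ‖u t - ∫ s in (0 : ℝ)..t, u' s‖ₑ
        ≤ ∫⁻ t in Ioo 0 L, (‖u t - φ t‖ₑ + lpToL1Const p L * ENNReal.ofReal e) := by
          refine setLIntegral_mono' measurableSet_Ioo fun t ht => ?_
          have : u t - ∫ s in (0 : ℝ)..t, u' s = (u t - φ t) + (φ t - ∫ s in (0 : ℝ)..t, u' s) := by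
            ring
          rw [this]
          exact (enorm_add_le _ _).trans (by gcongr; exact b3 t ht)
      _ = (∫⁻ t in Ioo 0 L, ‖u t - φ t‖ₑ) +
            lpToL1Const p L * ENNReal.ofReal e * volume (Ioo 0 L) := by
          rw [lintegral_add_right _ measurable_const, setLIntegral_const]
      _ ≤ lpToL1Const p L * ENNReal.ofReal e +
            lpToL1Const p L * ENNReal.ofReal e * volume (Ioo 0 L) := by gcongr
      _ = _ := by ring
  rw [lintegral_eq_zero_iff' (by exact hm.enorm)] at hzero
  filter_upwards [hzero] with t ht
  simpa [sub_eq_zero] using ht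

/-- Smooth functions with compact support in `(0, L)` are dense in `L^p(0, L)`. -/
lemma exists_smooth_tsupport_subset_Ioo {p L : ℝ} (hp : 1 < p) (hL : 0 < L) {f : ℝ → ℝ}
    (hf : MemLp f (ENNReal.ofReal p) (intervalMeasure L)) {e : ℝ} (he : 0 < e) :
    ∃ ψ : ℝ → ℝ, ContDiff ℝ ∞ ψ ∧ (∃ s, 0 < s ∧ ∀ t ∉ Icc s (L - s), ψ t = 0) ∧
      eLpNorm (fun t => f t - ψ t) (ENNReal.ofReal p) (intervalMeasure L) ≤ ENNReal.ofReal e := by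
  -- Half of the error is spent on a smooth `g` on the line, the other half on cutting `g` off near
  -- the end points. If `|g| ≤ M`, a cut-off in strips of width `d` costs at most `M * (2 * d) ^ (1
  -- / p)`.
  obtain ⟨g, hg1, hg2, hg3⟩ := hf.exist_eLpNorm_sub_le ENNReal.ofReal_ne_top (one_le_ofReal hp)
    (half_pos he)
  obtain ⟨M, hM⟩ := hg1.exists_bound_of_continuous hg2.continuous
  have hM0 : 0 ≤ M := (norm_nonneg _).trans (hM 0)
  have hlim : Filter.Tendsto (fun d : ℝ => M * (2 * d) ^ (1 / p)) (nhdsWithin 0 (Ioi 0))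
      (nhds 0) := by
    have : Continuous fun d : ℝ => M * (2 * d) ^ (1 / p) :=
      continuous_const.mul (Continuous.rpow_const (by fun_prop)
        fun x => Or.inr (one_div_nonneg.2 (by linarith)))
    have h0 := this.tendsto 0
    rw [mul_zero, Real.zero_rpow (one_div_pos.2 (by linarith)).ne', mul_zero] at h0
    exact h0.mono_left nhdsWithin_le_nhds
  obtain ⟨d, ⟨hd1, hd2⟩, hd3⟩ := ((hlim.eventually (gt_mem_nhds (half_pos he))).and
    (Ioo_mem_nhdsGT (show (0 : ℝ) < L / 2 by linarith)) |>.and self_mem_nhdsWithin).exists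
  have hd3 : 0 < d := hd3
  let χ : ContDiffBump (L / 2) := ⟨L / 2 - d, L / 2 - d / 2, by linarith [hd2.2], by linarith⟩
  have hχ0 : ∀ t ∉ Icc (d / 2) (L - d / 2), χ t = 0 := by
    intro t ht
    apply χ.zero_of_le_dist
    rw [Real.dist_eq]
    by_contra hcon
    rw [not_le, abs_lt] at hcon
    exact ht ⟨by linarith [hcon.1, show χ.rOut = L / 2 - d / 2 from rfl],
      by linarith [hcon.2, show χ.rOut = L / 2 - d / 2 from rfl]⟩
  have hχ1 : ∀ t ∈ Icc d (L - d), χ t = 1 := by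
    intro t ht
    apply χ.one_of_mem_closedBall
    rw [Metric.mem_closedBall, Real.dist_eq, abs_le]
    exact ⟨by linarith [ht.1, show χ.rIn = L / 2 - d from rfl],
      by linarith [ht.2, show χ.rIn = L / 2 - d from rfl]⟩
  refine ⟨fun t => χ t * g t, χ.contDiff.mul hg2, ⟨d / 2, by linarith,
    fun t ht => by simp [hχ0 t ht]⟩, ?_⟩
  have hχc : Continuous χ := χ.continuous
  have hsplit : (fun t => f t - χ t * g t) = (f - g) + fun t => (1 - χ t) * g t := by
    ext t; simp only [Pi.add_apply, Pi.sub_apply]; ring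
  set E : Set ℝ := Ioo 0 d ∪ Ioo (L - d) L
  have hE : MeasurableSet E := measurableSet_Ioo.union measurableSet_Ioo
  have hsecond : eLpNorm (fun t => (1 - χ t) * g t) (ENNReal.ofReal p) (intervalMeasure L)
      ≤ ENNReal.ofReal (e / 2) := by
    calc eLpNorm (fun t => (1 - χ t) * g t) (ENNReal.ofReal p) (intervalMeasure L)
        ≤ eLpNorm (E.indicator fun _ => M) (ENNReal.ofReal p) (intervalMeasure L) := by
          refine eLpNorm_mono_ae_real ?_
          rw [intervalMeasure, ae_restrict_iff' measurableSet_Ioo]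
          have hnull : ∀ᵐ t : ℝ, t ∉ ({d, L - d} : Set ℝ) :=
            measure_eq_zero_iff_ae_notMem.1 ((Set.toFinite _).measure_zero _)
          filter_upwards [hnull] with t htn ht
          by_cases htE : t ∈ E
          · rw [indicator_of_mem htE, norm_mul]
            have : ‖1 - χ t‖ ≤ 1 := by
              rw [Real.norm_eq_abs, abs_le]
              constructor <;> linarith [χ.nonneg (x := t), χ.le_one (x := t)]
            calc _ ≤ 1 * M := by gcongr; exact hM t
              _ = M := one_mul _
          · rw [indicator_of_notMem htE]
            simp only [E, mem_union, mem_Ioo, not_or, not_and_or, not_lt] at htE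
            have : t ∈ Icc d (L - d) := by
              constructor
              · rcases htE.1 with h | h
                · linarith [ht.1]
                · exact h
              · rcases htE.2 with h | h
                · exact h
                · linarith [ht.2]
            simp [hχ1 t this]
      _ = ‖M‖ₑ * intervalMeasure L E ^ (1 / p) := by
          rw [eLpNorm_indicator_const hE (by simpa using (by linarith : 0 < p))
            ENNReal.ofReal_ne_top, ENNReal.toReal_ofReal (by linarith)]
      _ ≤ ENNReal.ofReal M * ENNReal.ofReal (2 * d) ^ (1 / p) := by
          rw [Real.enorm_of_nonneg hM0]
          gcongr
          calc intervalMeasure L E ≤ volume E := Measure.restrict_apply_le _ _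
            _ ≤ volume (Ioo 0 d) + volume (Ioo (L - d) L) := measure_union_le _ _
            _ = ENNReal.ofReal (2 * d) := by
                rw [Real.volume_Ioo, Real.volume_Ioo, ← ENNReal.ofReal_add] <;>
                  first | linarith | (congr 1; ring)
      _ = ENNReal.ofReal (M * (2 * d) ^ (1 / p)) := by
          rw [ENNReal.ofReal_rpow_of_nonneg (by linarith) (one_div_nonneg.2 (by linarith)),
            ENNReal.ofReal_mul hM0]
      _ ≤ _ := ENNReal.ofReal_le_ofReal hd1.le
  rw [hsplit]
  refine (eLpNorm_add_le (hf.1.sub hg2.continuous.aestronglyMeasurable)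
    (Continuous.aestronglyMeasurable (by fun_prop)) (one_le_ofReal hp)).trans ?_
  calc _ ≤ ENNReal.ofReal (e / 2) + ENNReal.ofReal (e / 2) := add_le_add hg3 hsecond
    _ = _ := by rw [← ENNReal.ofReal_add (by linarith) (by linarith), add_halves]

lemma contDiff_primitive {ψ : ℝ → ℝ} (hψ : ContDiff ℝ ∞ ψ) :
    ContDiff ℝ ∞ (fun t => ∫ s in (0 : ℝ)..t, ψ s) := by
  have hd : ∀ t, HasDerivAt (fun t => ∫ s in (0 : ℝ)..t, ψ s) (ψ t) t := fun t =>
    intervalIntegral.integral_hasDerivAt_right (hψ.continuous.intervalIntegrable _ _)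
      (hψ.continuous.stronglyMeasurableAtFilter _ _) hψ.continuous.continuousAt
  rw [contDiff_infty_iff_deriv]
  refine ⟨fun t => (hd t).differentiableAt, ?_⟩
  rwa [show deriv (fun t => ∫ s in (0 : ℝ)..t, ψ s) = ψ from funext fun t => (hd t).deriv]

/-- The primitive of a smooth function with compact support and zero mean is a test function. -/
lemma isTestFunction_primitive {L s : ℝ} (hs : 0 < s) {ψ : ℝ → ℝ}
    (hψ : ContDiff ℝ ∞ ψ) (h0 : ∀ t ∉ Icc s (L - s), ψ t = 0)
    (hint : ∫ t in (0 : ℝ)..L, ψ t = 0) :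
    IsTestFunction L (fun t => ∫ r in (0 : ℝ)..t, ψ r) := by
  have hzero : ∀ t ∉ Icc s (L - s), ∫ r in (0 : ℝ)..t, ψ r = 0 := by
    intro t ht
    rcases lt_or_ge t s with h | h
    · apply intervalIntegral.integral_zero_ae
      refine Filter.Eventually.of_forall fun r hr => h0 r fun hr' => ?_
      have : r ≤ max 0 t := hr.2
      have : max 0 t < s := max_lt hs h
      linarith [hr'.1]
    · have hLt : L - s < t := by
        by_contra hcon
        exact ht ⟨h, not_lt.1 hcon⟩
      rw [← intervalIntegral.integral_add_adjacent_intervals (b := L)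
        (hψ.continuous.intervalIntegrable _ _) (hψ.continuous.intervalIntegrable _ _), hint,
        zero_add]
      apply intervalIntegral.integral_zero_ae
      refine Filter.Eventually.of_forall fun r hr => h0 r fun hr' => ?_
      have h1 : min L t < r := hr.1
      have : L - s < min L t := lt_min (by linarith) hLt
      linarith [hr'.2]
  have hsupp : tsupport (fun t => ∫ r in (0 : ℝ)..t, ψ r) ⊆ Icc s (L - s) := by
    refine closure_minimal (fun t ht => ?_) isClosed_Icc
    by_contra hcon
    exact ht (hzero t hcon)
  exact ⟨contDiff_primitive hψ, isCompact_Icc.of_isClosed_subset (isClosed_tsupport _) hsupp,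
    hsupp.trans fun t ht => ⟨hs.trans_le ht.1, by linarith [ht.2]⟩⟩

/-- `L^p` functions of zero mean are limits of derivatives of test functions. -/
lemma exists_isTestFunction_deriv_sub_lt {p L : ℝ} (hp : 1 < p) (hL : 0 < L) {f : ℝ → ℝ}
    (hf : MemLp f (ENNReal.ofReal p) (intervalMeasure L)) (hint : ∫ t in (0 : ℝ)..L, f t = 0)
    {ε : ENNReal} (hε : 0 < ε) :
    ∃ φ : ℝ → ℝ, IsTestFunction L φ ∧
      eLpNorm (fun t => f t - deriv φ t) (ENNReal.ofReal p) (intervalMeasure L) < ε := by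
  -- Smoothing spoils the zero mean. A multiple of a bump of integral `1` inside the interval
  -- restores it, and the multiple `m` is small because `f` itself has zero mean.
  let η : ContDiffBump (L / 2) := ⟨L / 8, L / 4, by linarith, by linarith⟩
  have hη0 : ∀ t ∉ Icc (L / 4) (L - L / 4), η.normed volume t = 0 := by
    intro t ht
    rw [ContDiffBump.normed_def, η.zero_of_le_dist, zero_div]
    rw [Real.dist_eq]
    by_contra hcon
    rw [not_le, abs_lt] at hcon
    exact ht ⟨by linarith [hcon.1, show η.rOut = L / 4 from rfl],
      by linarith [hcon.2, show η.rOut = L / 4 from rfl]⟩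
  have hηs : ContDiff ℝ ∞ (η.normed volume) := η.contDiff_normed
  have hη1 : ∫ t in (0 : ℝ)..L, η.normed volume t = 1 := by
    rw [← η.integral_normed (μ := volume), intervalIntegral.integral_of_le hL.le]
    apply setIntegral_eq_integral_of_forall_compl_eq_zero
    intro t ht
    apply hη0
    intro h
    exact ht ⟨by linarith [h.1], by linarith [h.2]⟩
  have hηp : MemLp (η.normed volume) (ENNReal.ofReal p) (intervalMeasure L) :=
    hηs.continuous.memLp_of_hasCompactSupport η.hasCompactSupport_normed
  set Nη := eLpNorm (η.normed volume) (ENNReal.ofReal p) (intervalMeasure L)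
  obtain ⟨e, he, heε⟩ := exists_pos_const_mul_lt (C := 1 + lpToL1Const p L * Nη)
    (ENNReal.add_ne_top.2 ⟨ENNReal.one_ne_top,
      ENNReal.mul_ne_top (lpToL1Const_ne_top hp) hηp.2.ne⟩) hε
  obtain ⟨ψ, hψ, ⟨s, hs, hψ0⟩, hψe⟩ := exists_smooth_tsupport_subset_Ioo hp hL hf he
  set m := ∫ t in (0 : ℝ)..L, ψ t
  have hm : ‖m‖ₑ ≤ lpToL1Const p L * ENNReal.ofReal e := by
    have := enorm_intervalIntegral_sub_le (intervalIntegrable_of_memLp hp hL hf)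
      (hψ.continuous.intervalIntegrable _ _) (t := L) ⟨hL.le, le_rfl⟩
    rw [hint, zero_sub, enorm_neg] at this
    refine this.trans ((lintegral_enorm_le_eLpNorm hp
      (hf.1.sub hψ.continuous.aestronglyMeasurable)).trans ?_)
    gcongr
    exact hψe
  set ψ' : ℝ → ℝ := fun t => ψ t - m * η.normed volume t
  have hψ' : ContDiff ℝ ∞ ψ' := hψ.sub (contDiff_const.mul hηs)
  have htest : IsTestFunction L (fun t => ∫ r in (0 : ℝ)..t, ψ' r) := by
    refine isTestFunction_primitive (s := min s (L / 4)) (lt_min hs (by linarith)) hψ' ?_ ?_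
    · intro t ht
      have h1 : t ∉ Icc s (L - s) := fun h => ht ⟨(min_le_left _ _).trans h.1,
        h.2.trans (by linarith [min_le_left s (L / 4)])⟩
      have h2 : t ∉ Icc (L / 4) (L - L / 4) := fun h => ht ⟨(min_le_right _ _).trans h.1,
        h.2.trans (by linarith [min_le_right s (L / 4)])⟩
      simp only [ψ', hψ0 t h1, hη0 t h2]; ring
    · rw [intervalIntegral.integral_sub (hψ.continuous.intervalIntegrable _ _)
        ((hηs.continuous.intervalIntegrable _ _).const_mul m),
        intervalIntegral.integral_const_mul, hη1]
      simp [m]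
  refine ⟨_, htest, ?_⟩
  have hderiv : deriv (fun t => ∫ r in (0 : ℝ)..t, ψ' r) = ψ' := funext fun t =>
    hψ'.continuous.deriv_integral _ _ _
  rw [hderiv]
  have hsplit : (fun t => f t - ψ' t) = (fun t => f t - ψ t) + m • η.normed volume := by
    ext t; simp only [ψ', Pi.add_apply, Pi.smul_apply, smul_eq_mul]; ring
  rw [hsplit]
  refine (eLpNorm_add_le (hf.1.sub hψ.continuous.aestronglyMeasurable)
    (hηs.continuous.aestronglyMeasurable.const_smul m) (one_le_ofReal hp)).trans_lt
    (lt_of_le_of_lt ?_ heε)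
  rw [eLpNorm_const_smul, add_mul, one_mul]
  refine add_le_add hψe ?_
  calc ‖m‖ₑ * Nη ≤ lpToL1Const p L * ENNReal.ofReal e * Nη := by gcongr
    _ = _ := by ring

/-- The primitive of an `L^p` function of zero mean is in `W₀^{1,p}`. -/
lemma isW01p_of_primitive {p L : ℝ} (hp : 1 < p) (hL : 0 < L) {u u' : ℝ → ℝ}
    (hu' : MemLp u' (ENNReal.ofReal p) (intervalMeasure L))
    (hint : ∫ t in (0 : ℝ)..L, u' t = 0)
    (hu : ∀ᵐ t ∂(intervalMeasure L), u t = ∫ s in (0 : ℝ)..t, u' s) : IsW01p p L u u' := by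
  have hi := intervalIntegrable_of_memLp hp hL hu'
  have hcont : ContinuousOn (fun t => ∫ s in (0 : ℝ)..t, u' s) (Icc 0 L) := by
    have := intervalIntegral.continuousOn_primitive_interval' hi left_mem_uIcc
    rwa [uIcc_of_le hL.le] at this
  have hm : AEStronglyMeasurable (fun t => ∫ s in (0 : ℝ)..t, u' s) (intervalMeasure L) :=
    (hcont.mono Ioo_subset_Icc_self).aestronglyMeasurable measurableSet_Ioo
  obtain ⟨C, hC⟩ := isCompact_Icc.exists_bound_of_continuousOn hcont
  refine ⟨?_, hu', ?_, ?_⟩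
  · refine (memLp_congr_ae hu).2 (MemLp.of_bound hm C ?_)
    rw [intervalMeasure, ae_restrict_iff' measurableSet_Ioo]
    exact Filter.Eventually.of_forall fun t ht => hC t (Ioo_subset_Icc_self ht)
  · intro φ hφ
    have := integral_primitive_mul (c := 0) hL hi (hφ.continuous_deriv.intervalIntegrable _ _)
      hφ.integral_deriv
    simp only [zero_add, hφ.eq_integral] at this
    rw [← this]
    refine integral_congr_ae ?_
    filter_upwards [hu] with t ht
    rw [ht]
  · intro ε hε
    -- The difference `u - φ` is bounded pointwise by the `L^1` norm of `u' - φ'`; `K` converts this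
    -- into an `L^p` bound, so only the derivative has to be approximated.
    set K := lpToL1Const p L * intervalMeasure L univ ^ (ENNReal.ofReal p).toReal⁻¹
    have hK : K ≠ ⊤ := ENNReal.mul_ne_top (lpToL1Const_ne_top hp)
      (ENNReal.rpow_ne_top_of_nonneg (by positivity) (measure_ne_top _ _))
    obtain ⟨e, he, heε⟩ := exists_pos_const_mul_lt (C := 1 + K)
      (ENNReal.add_ne_top.2 ⟨ENNReal.one_ne_top, hK⟩) hε
    obtain ⟨φ, hφ, hφe⟩ := exists_isTestFunction_deriv_sub_lt hp hL hu' hint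
      (ε := ENNReal.ofReal e) (by simpa using he)
    rw [add_mul, one_mul] at heε
    refine ⟨φ, hφ, lt_of_le_of_lt ?_ heε, hφe.trans (lt_of_le_of_lt le_self_add heε)⟩
    refine le_trans ?_ le_add_self
    have hb : ∀ᵐ t ∂(intervalMeasure L),
        ‖u t - φ t‖ₑ ≤ lpToL1Const p L * ENNReal.ofReal e := by
      have hI : ∀ᵐ t ∂(intervalMeasure L), t ∈ Ioo 0 L := ae_restrict_mem measurableSet_Ioo
      filter_upwards [hu, hI] with t ht htI
      have := enorm_intervalIntegral_sub_le hi
        (hφ.continuous_deriv.intervalIntegrable _ _) (Ioo_subset_Icc_self htI)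
      rw [hφ.eq_integral, ← ht] at this
      refine this.trans ((lintegral_enorm_le_eLpNorm hp
        (hu'.1.sub hφ.continuous_deriv.aestronglyMeasurable)).trans ?_)
      gcongr
      exact hφe.le
    refine (eLpNorm_le_of_ae_enorm_bound hb).trans (le_of_eq ?_)
    simp only [K, smul_eq_mul]; ring

/-! ### Weak solutions and the first order system -/

/-- `(U, W)` is a classical solution of the first order system `U' = A⁻¹(W)`, `W' = -f(U)`
on `(0, L)` with `U(0) = U(L) = 0`. -/
structure IsFlow (p a b μ ν L : ℝ) (U W : ℝ → ℝ) : Prop where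
  contU : ContinuousOn U (Icc 0 L)
  contW : ContinuousOn W (Icc 0 L)
  derivU : ∀ t ∈ Ioo 0 L, HasDerivAt U (asymFluxInv p a b (W t)) t
  derivW : ∀ t ∈ Ioo 0 L, HasDerivAt W (-fucikTerm p μ ν (U t)) t
  left : U 0 = 0
  right : U L = 0

/-- First symmetry: a change of sign exchanges `a` with `b` and `μ` with `ν`, which reduces negative
arches to positive ones. -/
lemma IsFlow.neg {p a b μ ν L : ℝ} {U W : ℝ → ℝ} (h : IsFlow p a b μ ν L U W) :
    IsFlow p b a ν μ L (fun t => -U t) (fun t => -W t) where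
  contU := h.contU.neg
  contW := h.contW.neg
  derivU t ht := by rw [asymFluxInv_neg]; exact (h.derivU t ht).fun_neg
  derivW t ht := by rw [fucikTerm_neg]; exact (h.derivW t ht).fun_neg
  left := by simp [h.left]
  right := by simp [h.right]

lemma hasDerivAt_primitive_of_continuousOn {L : ℝ} {g : ℝ → ℝ} (hg : ContinuousOn g (Icc 0 L))
    {t : ℝ} (ht : t ∈ Ioo 0 L) : HasDerivAt (fun t => ∫ s in (0 : ℝ)..t, g s) (g t) t := by
  have hi : IntervalIntegrable g volume 0 t :=
    (hg.mono (by rw [uIcc_of_le ht.1.le]; exact Icc_subset_Icc_right ht.2.le)).intervalIntegrable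
  refine intervalIntegral.integral_hasDerivAt_right hi ?_
    (hg.continuousAt (Icc_mem_nhds ht.1 ht.2))
  exact (hg.mono Ioo_subset_Icc_self).stronglyMeasurableAtFilter isOpen_Ioo t ht

/-- A function orthogonal to all bounded functions of zero mean is constant. -/
lemma ae_eq_const_of_orthogonal {L : ℝ} (hL : 0 < L) {g : ℝ → ℝ}
    (hg : Integrable g (intervalMeasure L))
    (h : ∀ ψ : ℝ → ℝ, Measurable ψ → (∃ C, ∀ t, ‖ψ t‖ ≤ C) → ∫ t in (0 : ℝ)..L, ψ t = 0 →
      ∫ t in Ioo 0 L, g t * ψ t = 0) :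
    ∃ c, ∀ᵐ t ∂(intervalMeasure L), g t = c := by
  set m := (∫ t in Ioo 0 L, g t) / L
  refine ⟨m, Integrable.ae_eq_of_forall_setIntegral_eq g (fun _ => m) hg (integrable_const m) ?_⟩
  intro E hE _
  set r := (intervalMeasure L).real E / L
  have hIE : Integrable (E.indicator fun _ => (1 : ℝ)) (intervalMeasure L) :=
    (integrable_const 1).indicator hE
  -- The indicator of `E` minus its mean is an admissible test, and it compares the integral of `g`
  -- over `E` with that of the mean of `g`.
  have key := h (fun t => E.indicator (fun _ => (1 : ℝ)) t - r)
    ((measurable_const.indicator hE).sub measurable_const) ⟨1 + ‖r‖, fun t => ?_⟩ ?_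
  · have e1 : ∫ t in Ioo 0 L, g t * (E.indicator (fun _ => (1 : ℝ)) t - r) =
        (∫ t in Ioo 0 L, E.indicator g t) - (∫ t in Ioo 0 L, g t) * r := by
      rw [← integral_mul_const, ← integral_sub]
      · refine integral_congr_ae (Filter.Eventually.of_forall fun t => ?_)
        by_cases ht : t ∈ E
        · simp [ht]; ring
        · simp [ht]
      · exact hg.indicator hE
      · exact hg.mul_const r
    rw [e1, integral_indicator hE] at key
    rw [setIntegral_const, smul_eq_mul]
    change (∫ t in E, g t ∂(intervalMeasure L)) - _ = 0 at key
    rw [sub_eq_zero.1 key]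
    simp only [m, r, Measure.real]; ring
  · refine (norm_sub_le _ _).trans ?_
    gcongr
    by_cases ht : t ∈ E <;> simp [ht]
  · rw [intervalIntegral.integral_of_le hL.le, integral_Ioc_eq_integral_Ioo]
    change ∫ t, _ ∂(intervalMeasure L) = 0
    rw [integral_sub hIE (integrable_const r), integral_indicator hE, setIntegral_const,
      integral_const]
    simp only [smul_eq_mul, mul_one, r]
    have : (intervalMeasure L).real univ = L := by
      simp [intervalMeasure, Measure.real, hL.le]
    rw [this]; field_simp; ring

/-- The bound `y ^ (p - 1) ≤ 1 + y ^ p` yields integrability, which suffices for pairing with the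
bounded test derivatives of `ae_eq_const_of_orthogonal`. -/
lemma integrable_asymFlux {p a b L : ℝ} (hp : 1 < p) (ha : 0 < a) (hb : 0 < b) {v : ℝ → ℝ}
    (hv : MemLp v (ENNReal.ofReal p) (intervalMeasure L)) :
    Integrable (fun t => asymFlux p a b (v t)) (intervalMeasure L) := by
  have h1 := hv.integrable_norm_rpow (by simpa using (by linarith : 0 < p)) ENNReal.ofReal_ne_top
  rw [ENNReal.toReal_ofReal (by linarith)] at h1
  refine Integrable.mono' (((integrable_const (1 : ℝ)).add h1).const_mul (a ^ p + b ^ p))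
    ((continuous_asymFlux hp).comp_aestronglyMeasurable hv.1) (Filter.Eventually.of_forall ?_)
  intro t
  have key : ∀ y : ℝ, 0 ≤ y → y ^ (p - 1) ≤ 1 + y ^ p := by
    intro y hy
    rcases le_total y 1 with h | h
    · have := Real.rpow_le_one hy h (by linarith : 0 ≤ p - 1)
      have := Real.rpow_nonneg hy p
      linarith
    · have := Real.rpow_le_rpow_of_exponent_le h (by linarith : p - 1 ≤ p)
      linarith
  have hap := Real.rpow_pos_of_pos ha p
  have hbp := Real.rpow_pos_of_pos hb p
  have hk := key _ (norm_nonneg (v t))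
  have hn : 0 ≤ ‖v t‖ ^ (p - 1) := Real.rpow_nonneg (norm_nonneg _) _
  have hb' : ‖asymFlux p a b (v t)‖ ≤ (a ^ p + b ^ p) * ‖v t‖ ^ (p - 1) := by
    rw [Real.norm_eq_abs, Real.norm_eq_abs] at *
    rcases le_total 0 (v t) with h | h
    · rw [asymFlux_of_nonneg hp h]
      rw [abs_of_nonneg h] at hn ⊢
      rw [abs_of_nonneg (by positivity)]
      nlinarith
    · have e := asymFlux_neg p b a (v t)
      rw [asymFlux_of_nonneg hp (neg_nonneg.2 h)] at e
      rw [abs_of_nonpos h] at hn ⊢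
      rw [← abs_neg, ← e, abs_of_nonneg (by positivity)]
      nlinarith
  refine hb'.trans ?_
  simp only [Pi.add_apply]
  gcongr

lemma memLp_of_bounded {p L C : ℝ} {ψ : ℝ → ℝ} (hψ : Measurable ψ) (hC : ∀ t, ‖ψ t‖ ≤ C) :
    MemLp ψ (ENNReal.ofReal p) (intervalMeasure L) :=
  MemLp.of_bound hψ.aestronglyMeasurable C (Filter.Eventually.of_forall hC)

/-- Weak solutions are represented by classical solutions of the first order system. -/
lemma IsWeakSolution.exists_isFlow {p a b μ ν L : ℝ} (hp : 1 < p) (ha : 0 < a) (hb : 0 < b)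
    (hL : 0 < L) {u : ℝ → ℝ} (h : IsWeakSolution p L (asymFlux p a b) (fucikTerm p μ ν) u) :
    ∃ U W, IsFlow p a b μ ν L U W ∧ ∀ᵐ t ∂(intervalMeasure L), u t = U t := by
  obtain ⟨u', hu, hw⟩ := h
  have hu0 := hu.integral_deriv_eq_zero hp hL
  have huU := hu.ae_eq_primitive hp hL
  have hi := intervalIntegrable_of_memLp hp hL hu.memLp_deriv
  set U : ℝ → ℝ := fun t => ∫ s in (0 : ℝ)..t, u' s with hU
  have hUc : ContinuousOn U (Icc 0 L) := by
    have := intervalIntegral.continuousOn_primitive_interval' hi left_mem_uIcc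
    rwa [uIcc_of_le hL.le] at this
  set f : ℝ → ℝ := fun t => fucikTerm p μ ν (U t) with hf
  have hfc : ContinuousOn f (Icc 0 L) := (continuous_fucikTerm hp).comp_continuousOn hUc
  have hfi : IntervalIntegrable f volume 0 L :=
    ContinuousOn.intervalIntegrable (by rwa [uIcc_of_le hL.le])
  set F : ℝ → ℝ := fun t => ∫ s in (0 : ℝ)..t, f s with hF
  have hFc : ContinuousOn F (Icc 0 L) := by
    have := intervalIntegral.continuousOn_primitive_interval' hfi left_mem_uIcc
    rwa [uIcc_of_le hL.le] at this
  have hFi : Integrable F (intervalMeasure L) :=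
    (hFc.integrableOn_Icc).mono_set Ioo_subset_Icc_self
  have hAi := integrable_asymFlux hp ha hb hu.memLp_deriv
  -- Du Bois-Reymond: primitives of bounded functions of zero mean are admissible tests, and after
  -- integration by parts the weak equation says that `A(u') + F` is orthogonal to all such
  -- functions.
  obtain ⟨c, hc⟩ := ae_eq_const_of_orthogonal hL (hAi.add hFi) (by
    intro ψ hψ ⟨C, hC⟩ hψ0
    have hψp : MemLp ψ (ENNReal.ofReal p) (intervalMeasure L) := memLp_of_bounded hψ hC
    have hψi := intervalIntegrable_of_memLp hp hL hψp
    have h1 := hw _ ψ (isW01p_of_primitive hp hL hψp hψ0 (Filter.Eventually.of_forall fun _ => rfl))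
    have h2 := integral_primitive_mul (c := 0) hL hfi hψi hψ0
    have h3 : ∫ t in Ioo 0 L, fucikTerm p μ ν (u t) * ∫ s in (0 : ℝ)..t, ψ s =
        ∫ t in Ioo 0 L, f t * ∫ s in (0 : ℝ)..t, ψ s := by
      refine integral_congr_ae ?_
      filter_upwards [huU] with t ht
      rw [ht]
    have hbd : ∀ᵐ t ∂(intervalMeasure L), ‖ψ t‖ ≤ C := Filter.Eventually.of_forall hC
    have e : ∫ t in Ioo 0 L, ((fun t => asymFlux p a b (u' t)) + F) t * ψ t =
        (∫ t in Ioo 0 L, asymFlux p a b (u' t) * ψ t) + ∫ t in Ioo 0 L, F t * ψ t := by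
      rw [← integral_add]
      · simp only [Pi.add_apply, add_mul]
      · exact hAi.mul_bdd hψ.aestronglyMeasurable hbd
      · exact hFi.mul_bdd hψ.aestronglyMeasurable hbd
    rw [e, h1, h3]
    simp only [zero_add] at h2
    rw [h2]; ring)
  set W : ℝ → ℝ := fun t => c - F t with hW
  -- Inverting the flux shows that `u'` coincides almost everywhere with a continuous function,
  -- which makes `U` continuously differentiable.
  have hu' : ∀ᵐ t ∂(intervalMeasure L), u' t = asymFluxInv p a b (W t) := by
    filter_upwards [hc] with t ht
    simp only [Pi.add_apply] at ht
    rw [hW, ← ht]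
    simp only [add_sub_cancel_right]
    rw [asymFluxInv_asymFlux hp ha hb]
  have hWc : ContinuousOn W (Icc 0 L) := continuousOn_const.sub hFc
  have hBc : ContinuousOn (fun t => asymFluxInv p a b (W t)) (Icc 0 L) :=
    (continuous_asymFluxInv hp).comp_continuousOn hWc
  have hUe : ∀ t ∈ Icc 0 L, U t = ∫ s in (0 : ℝ)..t, asymFluxInv p a b (W s) := by
    intro t ht
    apply intervalIntegral.integral_congr_ae
    rw [intervalMeasure, restrict_Ioo_eq_restrict_Ioc, ae_restrict_iff' measurableSet_Ioc] at hu'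
    filter_upwards [hu'] with s hs hs'
    rw [uIoc_of_le ht.1] at hs'
    exact hs ⟨hs'.1, hs'.2.trans ht.2⟩
  refine ⟨U, W, ⟨hUc, hWc, ?_, ?_, ?_, hu0⟩, huU⟩
  · intro t ht
    refine (hasDerivAt_primitive_of_continuousOn hBc ht).congr_of_eventuallyEq ?_
    filter_upwards [Icc_mem_nhds ht.1 ht.2] with s hs using hUe s hs
  · intro t ht
    exact (hasDerivAt_primitive_of_continuousOn hfc ht).const_sub c
  · simp [hU]

/-- A continuous pair solving the first order system off a countable set gives a weak solution. -/
lemma isWeakSolution_of_flow_off_countable {p a b μ ν L : ℝ} (hp : 1 < p) (ha : 0 < a)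
    (hb : 0 < b) (hL : 0 < L) {u U W : ℝ → ℝ} {s : Set ℝ} (hs : s.Countable)
    (contU : ContinuousOn U (Icc 0 L)) (contW : ContinuousOn W (Icc 0 L))
    (derivU : ∀ t ∈ Ioo 0 L \ s, HasDerivAt U (asymFluxInv p a b (W t)) t)
    (derivW : ∀ t ∈ Ioo 0 L \ s, HasDerivAt W (-fucikTerm p μ ν (U t)) t)
    (left : U 0 = 0) (right : U L = 0) (hu : ∀ᵐ t ∂(intervalMeasure L), u t = U t) :
    IsWeakSolution p L (asymFlux p a b) (fucikTerm p μ ν) u := by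
  have hBc : ContinuousOn (fun t => asymFluxInv p a b (W t)) (Icc 0 L) :=
    (continuous_asymFluxInv hp).comp_continuousOn contW
  have hfc : ContinuousOn (fun t => -fucikTerm p μ ν (U t)) (Icc 0 L) :=
    ((continuous_fucikTerm hp).comp_continuousOn contU).neg
  have hI : ∀ᵐ t ∂(intervalMeasure L), t ∈ Ioo 0 L := ae_restrict_mem measurableSet_Ioo
  -- The fundamental theorem tolerates a countable exceptional set, so junctions and peaks of
  -- concatenated arches need no derivative computation.
  have ftc : ∀ {G g : ℝ → ℝ}, ContinuousOn G (Icc 0 L) → ContinuousOn g (Icc 0 L) →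
      (∀ t ∈ Ioo 0 L \ s, HasDerivAt G (g t) t) → ∀ t ∈ Icc 0 L,
      ∫ r in (0 : ℝ)..t, g r = G t - G 0 := by
    intro G g hG hg hd t ht
    have hsub : Icc 0 t ⊆ Icc 0 L := Icc_subset_Icc_right ht.2
    refine integral_eq_of_hasDerivAt_off_countable_of_le G g ht.1 hs (hG.mono hsub)
      (fun x hx => hd x ⟨⟨hx.1.1, hx.1.2.trans_le ht.2⟩, hx.2⟩) ?_
    exact ContinuousOn.intervalIntegrable (by rw [uIcc_of_le ht.1]; exact hg.mono hsub)
  have hUe := ftc contU hBc derivU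
  have hWe := ftc contW hfc derivW
  have hBi : IntervalIntegrable (fun t => asymFluxInv p a b (W t)) volume 0 L :=
    ContinuousOn.intervalIntegrable (by rwa [uIcc_of_le hL.le])
  have hfi : IntervalIntegrable (fun t => -fucikTerm p μ ν (U t)) volume 0 L :=
    ContinuousOn.intervalIntegrable (by rwa [uIcc_of_le hL.le])
  refine ⟨fun t => asymFluxInv p a b (W t), isW01p_of_primitive hp hL ?_ ?_ ?_, ?_⟩
  · obtain ⟨C, hC⟩ := isCompact_Icc.exists_bound_of_continuousOn hBc
    refine MemLp.of_bound ((hBc.mono Ioo_subset_Icc_self).aestronglyMeasurable measurableSet_Ioo)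
      C ?_
    filter_upwards [hI] with t ht using hC t (Ioo_subset_Icc_self ht)
  · rw [hUe L ⟨hL.le, le_rfl⟩, left, right, sub_zero]
  · filter_upwards [hu, hI] with t ht htI
    rw [ht, hUe t (Ioo_subset_Icc_self htI), left, sub_zero]
  · intro φ φ' hφ
    have hφi := intervalIntegrable_of_memLp hp hL hφ.memLp_deriv
    have hφe := hφ.ae_eq_primitive hp hL
    -- With the constant `W 0`, the primitive of `-f(U)` becomes `W` itself.
    have key := integral_primitive_mul (c := W 0) hL hfi hφi (hφ.integral_deriv_eq_zero hp hL)
    have e1 : ∫ t in Ioo 0 L, asymFlux p a b (asymFluxInv p a b (W t)) * φ' t =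
        ∫ t in Ioo 0 L, (W 0 + ∫ s in (0 : ℝ)..t, -fucikTerm p μ ν (U s)) * φ' t := by
      refine integral_congr_ae ?_
      filter_upwards [hI] with t ht
      rw [asymFlux_asymFluxInv hp ha hb, hWe t (Ioo_subset_Icc_self ht), add_sub_cancel]
    rw [e1, key, ← integral_neg]
    refine integral_congr_ae ?_
    filter_upwards [hu, hφe] with t ht ht'
    rw [ht, ht']; ring

lemma isNontrivial_iff {L : ℝ} {u U : ℝ → ℝ} (hU : ContinuousOn U (Icc 0 L))
    (hu : ∀ᵐ t ∂(intervalMeasure L), u t = U t) :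
    IsNontrivial L u ↔ ∃ t ∈ Ioo 0 L, U t ≠ 0 := by
  have hI : ∀ᵐ t ∂(intervalMeasure L), t ∈ Ioo 0 L := ae_restrict_mem measurableSet_Ioo
  constructor
  · intro h
    by_contra! hcon
    apply h
    filter_upwards [hu, hI] with t ht htI
    rw [ht, hcon t htI]
  · rintro ⟨t, ht, hne⟩ h
    have h0 : U =ᵐ[volume.restrict (Ioo 0 L)] fun _ => (0 : ℝ) := by
      filter_upwards [hu, h] with s hs hs'
      rw [← hs, hs']
    have := Measure.eqOn_open_of_ae_eq h0 isOpen_Ioo (hU.mono Ioo_subset_Icc_self)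
      continuousOn_const
    exact hne (this ht)

/-! ### Time reversal and energy conservation -/

/-- The first order system `U' = A⁻¹(W)`, `W' = -f(U)` on `(α, β)`, without boundary conditions. -/
structure IsFlowOn (p a b μ ν α β : ℝ) (U W : ℝ → ℝ) : Prop where
  contU : ContinuousOn U (Icc α β)
  contW : ContinuousOn W (Icc α β)
  derivU : ∀ t ∈ Ioo α β, HasDerivAt U (asymFluxInv p a b (W t)) t
  derivW : ∀ t ∈ Ioo α β, HasDerivAt W (-fucikTerm p μ ν (U t)) t

lemma IsFlow.flowOn {p a b μ ν L : ℝ} {U W : ℝ → ℝ} (h : IsFlow p a b μ ν L U W) :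
    IsFlowOn p a b μ ν 0 L U W := ⟨h.contU, h.contW, h.derivU, h.derivW⟩

namespace IsFlowOn

variable {p a b μ ν α β : ℝ} {U W : ℝ → ℝ}

lemma mono (h : IsFlowOn p a b μ ν α β U W) {α' β' : ℝ} (h1 : α ≤ α') (h2 : β' ≤ β) :
    IsFlowOn p a b μ ν α' β' U W where
  contU := h.contU.mono (Icc_subset_Icc h1 h2)
  contW := h.contW.mono (Icc_subset_Icc h1 h2)
  derivU t ht := h.derivU t (Ioo_subset_Ioo h1 h2 ht)
  derivW t ht := h.derivW t (Ioo_subset_Ioo h1 h2 ht)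

/-- Second symmetry: reversing time negates `U'`, so the flux changes sign and `a`, `b` are
exchanged. The derivative of the flux is negated twice, which leaves `μ` and `ν` in place. -/
lemma reverse (h : IsFlowOn p a b μ ν α β U W) :
    IsFlowOn p b a μ ν (-β) (-α) (fun t => U (-t)) (fun t => -W (-t)) where
  contU := h.contU.comp continuousOn_neg fun t ht => ⟨by linarith [ht.2], by linarith [ht.1]⟩
  contW := (h.contW.comp continuousOn_neg
    fun t ht => ⟨by linarith [ht.2], by linarith [ht.1]⟩).neg
  derivU t ht := by
    have hd := h.derivU (-t) ⟨by linarith [ht.2], by linarith [ht.1]⟩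
    have := HasDerivAt.comp t hd (hasDerivAt_neg t)
    rw [asymFluxInv_neg]
    simpa [Function.comp_def] using this
  derivW t ht := by
    have hd := h.derivW (-t) ⟨by linarith [ht.2], by linarith [ht.1]⟩
    have := (HasDerivAt.comp t hd (hasDerivAt_neg t)).fun_neg
    simpa [Function.comp_def] using this

end IsFlowOn

lemma eq_of_hasDerivAt_zero {α β : ℝ} (hαβ : α ≤ β) {g : ℝ → ℝ} (hc : ContinuousOn g (Icc α β))
    (hd : ∀ t ∈ Ioo α β, HasDerivAt g 0 t) : g β = g α := by
  have := intervalIntegral.integral_eq_sub_of_hasDerivAt_of_le hαβ hc hd intervalIntegrable_const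
  simp only [intervalIntegral.integral_zero] at this
  linarith

/-- The conserved energy of the first order system. -/
def flowEnergy (p a b μ ν u w : ℝ) : ℝ :=
  (p - 1) * ((max w 0 / a) ^ (p / (p - 1)) + (max (-w) 0 / b) ^ (p / (p - 1))) +
    (μ * (max u 0) ^ p + ν * (max (-u) 0) ^ p)

lemma continuous_flowEnergy {p a b μ ν : ℝ} (hp : 1 < p) :
    Continuous fun z : ℝ × ℝ => flowEnergy p a b μ ν z.1 z.2 := by
  have h1 : 0 ≤ p := by linarith
  have h2 : 0 ≤ p / (p - 1) := div_nonneg h1 (by linarith)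
  have c1 : Continuous fun z : ℝ × ℝ => max z.2 0 / a := by fun_prop
  have c2 : Continuous fun z : ℝ × ℝ => max (-z.2) 0 / b := by fun_prop
  have c3 : Continuous fun z : ℝ × ℝ => max z.1 0 := by fun_prop
  have c4 : Continuous fun z : ℝ × ℝ => max (-z.1) 0 := by fun_prop
  have d1 := c1.rpow_const fun _ => Or.inr h2
  have d2 := c2.rpow_const fun _ => Or.inr h2
  have d3 := c3.rpow_const fun _ => Or.inr h1
  have d4 := c4.rpow_const fun _ => Or.inr h1
  exact (continuous_const.mul (d1.add d2)).add
    ((continuous_const.mul d3).add (continuous_const.mul d4))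

lemma div_rpow_flux {p a y : ℝ} (hp : 1 < p) (ha : 0 < a) (hy : 0 ≤ y) :
    (y / a ^ p) ^ (1 / (p - 1)) = (y / a) ^ (1 / (p - 1)) / a := by
  have h1 : a ^ p = a * a ^ (p - 1) := by
    rw [← Real.rpow_one_add' ha.le (by linarith)]; congr 1; ring
  rw [h1, ← div_div, Real.div_rpow (by positivity) (by positivity), ← Real.rpow_mul ha.le,
    mul_one_div_cancel (by linarith), Real.rpow_one]

lemma div_max_zero {w a : ℝ} (ha : 0 < a) : max w 0 / a = max (w / a) 0 := by
  rw [← zero_div a, max_div_div_right ha.le, zero_div]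

/-- The kinetic term has derivative `p * A⁻¹(W) * W'` and the potential term `p * f(U) * U'`; along
the system these cancel. -/
lemma IsFlowOn.energy_eq {p a b μ ν α β : ℝ} {U W : ℝ → ℝ} (hp : 1 < p) (ha : 0 < a) (hb : 0 < b)
    (h : IsFlowOn p a b μ ν α β U W) {t : ℝ} (ht : t ∈ Icc α β) :
    flowEnergy p a b μ ν (U t) (W t) = flowEnergy p a b μ ν (U α) (W α) := by
  have h' := h.mono le_rfl ht.2
  have hp1 : p - 1 ≠ 0 := by linarith
  have hq : 1 < p / (p - 1) := by rw [one_lt_div (by linarith)]; linarith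
  have hc : ContinuousOn (fun t => flowEnergy p a b μ ν (U t) (W t)) (Icc α t) :=
    Continuous.comp_continuousOn' (g := fun z : ℝ × ℝ => flowEnergy p a b μ ν z.1 z.2)
      (f := fun t => (U t, W t)) (continuous_flowEnergy hp) (h'.contU.prodMk h'.contW)
  have hd : ∀ r ∈ Ioo α t, HasDerivAt (fun t => flowEnergy p a b μ ν (U t) (W t)) 0 r := by
    intro r hr
    have hU := h'.derivU r hr
    have hW := h'.derivW r hr
    have e1 := (hasDerivAt_posPart_rpow hq (W r / a)).comp r (hW.div_const a)
    have e2 := (hasDerivAt_posPart_rpow hq (-W r / b)).comp r (hW.fun_neg.div_const b)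
    have e3 := (hasDerivAt_posPart_rpow hp (U r)).comp r hU
    have e4 := (hasDerivAt_posPart_rpow hp (-U r)).comp r hU.fun_neg
    simp only [Function.comp_def] at e1 e2 e3 e4
    have hsum := ((e1.fun_add e2).const_mul (p - 1)).fun_add
      ((e3.const_mul μ).fun_add (e4.const_mul ν))
    simp only [flowEnergy, div_max_zero ha, div_max_zero hb]
    refine hsum.congr_deriv ?_
    have hexp : p / (p - 1) - 1 = 1 / (p - 1) := by field_simp; ring
    rw [asymFluxInv, fucikTerm, div_rpow_flux hp ha (le_max_right _ _),
      div_rpow_flux hp hb (le_max_right _ _), div_max_zero ha, div_max_zero hb, hexp]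
    generalize max (W r / a) 0 ^ (1 / (p - 1)) = A
    generalize max (-W r / b) 0 ^ (1 / (p - 1)) = B
    generalize max (U r) 0 ^ (p - 1) = C
    generalize max (-U r) 0 ^ (p - 1) = D
    field_simp
    ring
  exact eq_of_hasDerivAt_zero ht.1 hc hd

/-! ### Integration of a single arch -/

/-- The frequency `(μ / (p - 1)) ^ (1/p)`. -/
def freq (p μ : ℝ) : ℝ := (μ / (p - 1)) ^ (1 / p)

lemma freq_pos {p μ : ℝ} (hp : 1 < p) (hμ : 0 < μ) : 0 < freq p μ :=
  Real.rpow_pos_of_pos (div_pos hμ (by linarith)) _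

lemma freq_rpow {p μ : ℝ} (hp : 1 < p) (hμ : 0 < μ) : freq p μ ^ p = μ / (p - 1) := by
  rw [freq, ← Real.rpow_mul (div_pos hμ (by linarith)).le, one_div_mul_cancel (by linarith),
    Real.rpow_one]

/-- Until the flux vanishes, a positive solution starting from zero is a rescaled `sinp`. -/
lemma IsFlowOn.rising {p a b μ ν s m : ℝ} {U W : ℝ → ℝ} (hp : 1 < p) (ha : 0 < a) (hb : 0 < b)
    (hμ : 0 < μ) (hsm : s < m) (h : IsFlowOn p a b μ ν s m U W) (hUs : U s = 0)
    (hUpos : ∀ t ∈ Ioc s m, 0 < U t) (hWpos : ∀ t ∈ Ico s m, 0 < W t) (hWm : W m = 0) :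
    m - s = a * halfPip p / freq p μ ∧
    (∀ t ∈ Icc s m, U t = U m * sinp p (freq p μ * (t - s) / a)) ∧
    W s = a * (freq p μ * U m) ^ (p - 1) := by
  have hκ := freq_pos hp hμ
  have hκp := freq_rpow hp hμ
  have hM : 0 < U m := hUpos m ⟨hsm, le_rfl⟩
  set κ := freq p μ
  set M := U m with hMdef
  have hp1 : 0 < p - 1 := by linarith
  have hq : 0 < p / (p - 1) := div_pos (by linarith) hp1
  have hU0 : ∀ t ∈ Icc s m, 0 ≤ U t := fun t ht => by
    rcases ht.1.eq_or_lt with rfl | h'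
    · exact hUs.ge
    · exact (hUpos t ⟨h', ht.2⟩).le
  have hW0 : ∀ t ∈ Icc s m, 0 ≤ W t := fun t ht => by
    rcases ht.2.eq_or_lt with rfl | h'
    · exact hWm.ge
    · exact (hWpos t ⟨ht.1, h'⟩).le
  have hE : ∀ t ∈ Icc s m, flowEnergy p a b μ ν (U t) (W t) =
      (p - 1) * ((W t / a) ^ (p / (p - 1)) + (κ * U t) ^ p) := by
    intro t ht
    rw [flowEnergy, max_eq_left (hU0 t ht), max_eq_left (hW0 t ht),
      max_eq_right (by linarith [hU0 t ht] : -U t ≤ 0),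
      max_eq_right (by linarith [hW0 t ht] : -W t ≤ 0), zero_div, Real.zero_rpow hq.ne',
      Real.zero_rpow (by linarith), Real.mul_rpow hκ.le (hU0 t ht), hκp]
    field_simp
    ring
  -- The conserved value is read off at `m`, where the flux vanishes and all the energy is
  -- potential.
  have hcons : ∀ t ∈ Icc s m, (W t / a) ^ (p / (p - 1)) + (κ * U t) ^ p = (κ * M) ^ p := by
    intro t ht
    have h1 := (h.energy_eq hp ha hb ht).trans (h.energy_eq hp ha hb (right_mem_Icc.2 hsm.le)).symm
    rw [hE t ht, hE m (right_mem_Icc.2 hsm.le), hWm, zero_div, Real.zero_rpow hq.ne', zero_add]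
      at h1
    exact mul_left_cancel₀ hp1.ne' h1
  have hlt : ∀ t ∈ Ico s m, U t / M < 1 := by
    intro t ht
    have h1 := hcons t ⟨ht.1, ht.2.le⟩
    have h2 : 0 < (W t / a) ^ (p / (p - 1)) := Real.rpow_pos_of_pos (div_pos (hWpos t ht) ha) _
    have h3 : (κ * U t) ^ p < (κ * M) ^ p := by linarith
    have h4 := lt_of_mul_lt_mul_left ((Real.rpow_lt_rpow_iff
      (mul_nonneg hκ.le (hU0 t ⟨ht.1, ht.2.le⟩)) (mul_pos hκ hM).le (by linarith)).1 h3) hκ.le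
    rwa [div_lt_one hM]
  -- Solving the energy identity for the flux gives `U' = κ / a * M * (1 - (U / M) ^ p) ^ (1 / p)`,
  -- so `arcsinp p (U / M)` has the constant slope `κ / a`.
  have hderiv : ∀ t ∈ Ioo s m, HasDerivAt (fun t => arcsinp p (U t / M) - κ / a * t) 0 t := by
    intro t ht
    have hy := hlt t (Ioo_subset_Ico_self ht)
    have hUt := hUpos t (Ioo_subset_Ioc_self ht)
    have hWt := hWpos t (Ioo_subset_Ico_self ht)
    have hy0 : 0 < U t / M := div_pos hUt hM
    have hpos := one_sub_rpow_pos hp hy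
    rw [max_eq_left hy0.le] at hpos
    have d1 := (hasDerivAt_arcsinp hp hy).comp t ((h.derivU t ht).div_const M)
    have d2 := d1.sub ((hasDerivAt_id t).const_mul (κ / a))
    refine d2.congr_deriv ?_
    rw [max_eq_left hy0.le, asymFluxInv_of_nonneg hp hWt.le, div_rpow_flux hp ha hWt.le]
    have h1 := hcons t (Ioo_subset_Icc_self ht)
    have h2 : (W t / a) ^ (p / (p - 1)) = (κ * M) ^ p * (1 - (U t / M) ^ p) := by
      rw [Real.div_rpow hUt.le hM.le]
      rw [Real.mul_rpow hκ.le hUt.le, Real.mul_rpow hκ.le hM.le] at h1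
      rw [Real.mul_rpow hκ.le hM.le]
      have := (Real.rpow_pos_of_pos hM p).ne'
      field_simp
      linarith
    have h3 : (W t / a) ^ (1 / (p - 1)) = κ * M * (1 - (U t / M) ^ p) ^ (1 / p) := by
      have e : (1 : ℝ) / (p - 1) = p / (p - 1) * (1 / p) := by field_simp
      rw [e, Real.rpow_mul (div_pos hWt ha).le, h2, Real.mul_rpow (by positivity) hpos.le,
        ← Real.rpow_mul (mul_pos hκ hM).le, mul_one_div_cancel (by linarith), Real.rpow_one]
    rw [h3, Real.rpow_neg hpos.le]
    have := (Real.rpow_pos_of_pos hpos (1 / p)).ne'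
    field_simp
    ring
  have hcont : ContinuousOn (fun t => arcsinp p (U t / M) - κ / a * t) (Icc s m) :=
    ((continuous_arcsinp hp).comp_continuousOn (h.contU.div_const M)).sub (by fun_prop)
  have hform : ∀ t ∈ Icc s m, arcsinp p (U t / M) = κ * (t - s) / a := by
    intro t ht
    have := eq_of_hasDerivAt_zero ht.1 (hcont.mono (Icc_subset_Icc_right ht.2))
      fun r hr => hderiv r ⟨hr.1, hr.2.trans_le ht.2⟩
    simp only [hUs, zero_div, arcsinp_zero] at this
    rw [sub_eq_iff_eq_add.1 this]; field_simp; ring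
  refine ⟨?_, ?_, ?_⟩
  · have := hform m (right_mem_Icc.2 hsm.le)
    rw [← hMdef, div_self hM.ne'] at this
    rw [halfPip, this]
    field_simp
  · intro t ht
    rw [← hform t ht, sinp_arcsinp hp]
    field_simp
  -- At `s` all the energy is kinetic, which determines the initial flux from the amplitude.
  · have h1 := hcons s (left_mem_Icc.2 hsm.le)
    rw [hUs, mul_zero, Real.zero_rpow (by linarith), add_zero] at h1
    have hWs : 0 < W s / a := div_pos (hWpos s ⟨le_rfl, hsm⟩) ha
    have e : (W s / a) = ((W s / a) ^ (p / (p - 1))) ^ ((p - 1) / p) := by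
      rw [← Real.rpow_mul hWs.le, div_mul_div_cancel₀ hp1.ne', div_self (by linarith),
        Real.rpow_one]
    rw [h1, ← Real.rpow_mul (mul_pos hκ hM).le, mul_div_cancel₀ _ (by linarith)] at e
    rw [← e]; field_simp

/-- The shape on `[0, 1]` of a positive arch of a solution, with maximum `1`. -/
def arch (p a b x : ℝ) : ℝ :=
  if x < a / (a + b) then sinp p (halfPip p * (a + b) / a * x)
  else sinp p (halfPip p * (a + b) / b * (1 - x))

/-- The length of a positive arch. -/
def archLength (p a b μ : ℝ) : ℝ := (a + b) * halfPip p / freq p μ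

lemma archLength_pos {p a b μ : ℝ} (hp : 1 < p) (ha : 0 < a) (hb : 0 < b) (hμ : 0 < μ) :
    0 < archLength p a b μ :=
  div_pos (mul_pos (add_pos ha hb) (halfPip_pos hp)) (freq_pos hp hμ)

lemma archLength_comm (p a b μ : ℝ) : archLength p a b μ = archLength p b a μ := by
  rw [archLength, archLength, add_comm]

/-- Classification of the positive arches of a solution. -/
lemma IsFlowOn.positive_arch {p a b μ ν α β : ℝ} {U W : ℝ → ℝ} (hp : 1 < p) (ha : 0 < a)
    (hb : 0 < b) (hαβ : α < β) (h : IsFlowOn p a b μ ν α β U W) (hα : U α = 0) (hβ : U β = 0)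
    (hpos : ∀ t ∈ Ioo α β, 0 < U t) :
    0 < μ ∧ β - α = archLength p a b μ ∧ ∃ M, 0 < M ∧
      (∀ t ∈ Icc α β, U t = M * arch p a b ((t - α) / (β - α))) ∧
      W α = a * (freq p μ * M) ^ (p - 1) ∧ W β = -(b * (freq p μ * M) ^ (p - 1)) := by
  obtain ⟨m, hm, hm0⟩ := exists_hasDerivAt_eq_zero hαβ h.contU (hα.trans hβ.symm) h.derivU
  have hWm : W m = 0 := by
    rcases lt_trichotomy (W m) 0 with hw | hw | hw
    · exact absurd hm0 (asymFluxInv_neg_of_neg hp hb hw).ne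
    · exact hw
    · exact absurd hm0 (asymFluxInv_pos hp ha hw).ne'
  have hW' : ∀ t ∈ Ioo α β, deriv W t = -(μ * U t ^ (p - 1)) := fun t ht => by
    rw [(h.derivW t ht).deriv, fucikTerm_of_nonneg hp (hpos t ht).le]
  have hUp : ∀ t ∈ Ioo α β, 0 < U t ^ (p - 1) := fun t ht => Real.rpow_pos_of_pos (hpos t ht) _
  -- If `μ ≤ 0`, then `W` is nondecreasing and vanishes at `m`, so `U` is nonincreasing on `[α, m]`
  -- and cannot have risen from `0`.
  have hμ : 0 < μ := by
    by_contra! hμ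
    have hmono : MonotoneOn W (Icc α β) := by
      refine monotoneOn_of_deriv_nonneg (convex_Icc _ _) h.contW ?_ ?_ <;> rw [interior_Icc]
      · exact fun t ht => (h.derivW t ht).differentiableAt.differentiableWithinAt
      · intro t ht
        rw [hW' t ht]
        nlinarith [hUp t ht]
    have hanti : AntitoneOn U (Icc α m) := by
      refine antitoneOn_of_deriv_nonpos (convex_Icc _ _)
        (h.contU.mono (Icc_subset_Icc_right hm.2.le)) ?_ ?_ <;> rw [interior_Icc]
      · exact fun t ht => (h.derivU t ⟨ht.1, ht.2.trans hm.2⟩).differentiableAt.differentiableWithinAt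
      · intro t ht
        have ht' : t ∈ Ioo α β := ⟨ht.1, ht.2.trans hm.2⟩
        rw [(h.derivU t ht').deriv]
        have : W t ≤ 0 := hWm ▸ hmono (Ioo_subset_Icc_self ht') (Ioo_subset_Icc_self hm) ht.2.le
        rcases this.eq_or_lt with h0 | h0
        · rw [h0, asymFluxInv_zero hp]
        · exact (asymFluxInv_neg_of_neg hp hb h0).le
    have := hanti (left_mem_Icc.2 hm.1.le) (right_mem_Icc.2 hm.1.le) hm.1.le
    linarith [hpos m hm]
  have hanti : StrictAntiOn W (Icc α β) := by
    refine strictAntiOn_of_deriv_neg (convex_Icc _ _) h.contW ?_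
    rw [interior_Icc]
    intro t ht
    rw [hW' t ht]
    nlinarith [hUp t ht]
  obtain ⟨r1, r2, r3⟩ := (h.mono le_rfl hm.2.le).rising hp ha hb hμ hm.1 hα
    (fun t ht => hpos t ⟨ht.1, ht.2.trans_lt hm.2⟩)
    (fun t ht => hWm ▸ hanti ⟨ht.1, (ht.2.trans hm.2).le⟩ (Ioo_subset_Icc_self hm) ht.2) hWm
  -- The descending half, run backwards, is a rising half with `a` and `b` exchanged.
  obtain ⟨f1, f2, f3⟩ := (h.mono hm.1.le le_rfl).reverse.rising hp hb ha hμ (by linarith [hm.2])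
    (by simpa using hβ)
    (fun t ht => hpos (-t) ⟨by linarith [ht.2, hm.1], by linarith [ht.1]⟩)
    (fun t ht => by
      have := hanti (a := m) (b := -t) (Ioo_subset_Icc_self hm)
        ⟨by linarith [ht.2, hm.1], by linarith [ht.1]⟩ (by linarith [ht.2])
      linarith)
    (by simp [hWm])
  simp only [neg_neg] at f1 f2 f3
  have hκ := freq_pos hp hμ
  have hh := halfPip_pos hp
  have hlen : β - α = archLength p a b μ := by
    have : β - α = (m - α) + (-m - -β) := by ring
    rw [this, r1, f1, archLength]; ring
  refine ⟨hμ, hlen, U m, hpos m hm, ?_, r3, by linarith⟩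
  intro t ht
  have hl : 0 < β - α := by linarith
  -- The two halves have lengths in the ratio `a : b`, so the maximum sits at the fraction `a / (a +
  -- b)`.
  have hcond : (t - α) / (β - α) < a / (a + b) ↔ t < m := by
    rw [div_lt_iff₀ hl, hlen, archLength]
    have : a / (a + b) * ((a + b) * halfPip p / freq p μ) = m - α := by
      rw [r1]; field_simp
    rw [this]
    constructor <;> intro h <;> linarith
  rw [arch]
  split_ifs with hc
  · rw [r2 t ⟨ht.1, (hcond.1 hc).le⟩, hlen, archLength]
    congr 2
    field_simp
  · have htm : m ≤ t := not_lt.1 fun h => hc (hcond.2 h)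
    have := f2 (-t) ⟨by linarith [ht.2], by linarith⟩
    rw [neg_neg] at this
    have e : 1 - (t - α) / (β - α) = (β - t) / archLength p a b μ := by
      rw [← hlen]; field_simp; ring
    rw [this, e, archLength]
    congr 2
    field_simp
    ring

/-! ### Shooting from zero to zero -/

/-- The zero set is compact and has a least element; a sign change before it would create an earlier
zero by the intermediate value theorem. -/
lemma exists_first_zero_right {U : ℝ → ℝ} {t L : ℝ} (hU : ContinuousOn U (Icc t L)) (htL : t ≤ L)
    (ht : 0 < U t) (hL : U L = 0) : ∃ β ∈ Ioc t L, U β = 0 ∧ ∀ r ∈ Ico t β, 0 < U r := by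
  have hcl : IsClosed (Icc t L ∩ U ⁻¹' {0}) := hU.preimage_isClosed_of_isClosed isClosed_Icc
    isClosed_singleton
  have hcpt : IsCompact (Icc t L ∩ U ⁻¹' {0}) :=
    isCompact_Icc.of_isClosed_subset hcl inter_subset_left
  obtain ⟨β, ⟨hβ, hβ0⟩, hmin⟩ := hcpt.exists_isLeast ⟨L, ⟨htL, le_rfl⟩, hL⟩
  have hβ0 : U β = 0 := hβ0
  have htβ : t < β := lt_of_le_of_ne hβ.1 fun h => by rw [h, hβ0] at ht; exact lt_irrefl _ ht
  refine ⟨β, ⟨htβ, hβ.2⟩, hβ0, fun r hr => ?_⟩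
  by_contra! hneg
  obtain ⟨x, hx, hx0⟩ := intermediate_value_Icc' hr.1
    (hU.mono (Icc_subset_Icc_right (hr.2.le.trans hβ.2))) ⟨hneg, ht.le⟩
  have := hmin ⟨⟨hx.1, hx.2.trans (hr.2.le.trans hβ.2)⟩, hx0⟩
  linarith [hx.2, hr.2]

lemma exists_last_zero_left {U : ℝ → ℝ} {s t : ℝ} (hU : ContinuousOn U (Icc s t)) (hst : s ≤ t)
    (ht : 0 < U t) (hs : U s = 0) : ∃ α ∈ Ico s t, U α = 0 ∧ ∀ r ∈ Ioc α t, 0 < U r := by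
  obtain ⟨β, hβ, hβ0, hpos⟩ := exists_first_zero_right (U := fun r => U (-r)) (t := -t) (L := -s)
    (hU.comp continuousOn_neg fun r hr => ⟨by linarith [hr.2], by linarith [hr.1]⟩)
    (by linarith) (by simpa using ht) (by simpa using hs)
  refine ⟨-β, ⟨by linarith [hβ.2], by linarith [hβ.1]⟩, hβ0, fun r hr => ?_⟩
  simpa using hpos (-r) ⟨by linarith [hr.2], by linarith [hr.1]⟩

/-- The flux of a nontrivial solution does not vanish at the left end point. -/
lemma IsFlow.flux_left_ne_zero {p a b μ ν L : ℝ} {U W : ℝ → ℝ} (hp : 1 < p) (ha : 0 < a)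
    (hb : 0 < b) (h : IsFlow p a b μ ν L U W) {t : ℝ} (ht : t ∈ Ioo 0 L) (hne : U t ≠ 0) :
    W 0 ≠ 0 := by
  wlog hpos : 0 < U t generalizing a b μ ν U W
  · have := this hb ha h.neg (neg_ne_zero.2 hne)
      (neg_pos.2 (lt_of_le_of_ne (not_lt.1 hpos) hne))
    simpa using this
  intro hW
  obtain ⟨α, hα, hα0, hαp⟩ := exists_last_zero_left
    (h.contU.mono (Icc_subset_Icc_right ht.2.le)) ht.1.le hpos h.left
  obtain ⟨β, hβ, hβ0, hβp⟩ := exists_first_zero_right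
    (h.contU.mono (Icc_subset_Icc_left ht.1.le)) ht.2.le hpos h.right
  -- The zeros surrounding `t` bound a full arch, so the flux and the energy at `α` are positive,
  -- whereas zero flux at `0` would make the conserved energy zero.
  obtain ⟨hμ, -, M, hM, -, hWα, -⟩ := (h.flowOn.mono hα.1 hβ.2).positive_arch hp ha hb
    (hα.2.trans hβ.1) hα0 hβ0 fun r hr => by
      rcases le_total r t with hrt | hrt
      · exact hαp r ⟨hr.1, hrt⟩
      · exact hβp r ⟨hrt, hr.2⟩
  have hWα' : 0 < W α := by
    rw [hWα]; exact mul_pos ha (Real.rpow_pos_of_pos (mul_pos (freq_pos hp hμ) hM) _)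
  have hE := h.flowOn.energy_eq hp ha hb (t := α) ⟨hα.1, (hα.2.trans ht.2).le⟩
  have hq : p / (p - 1) ≠ 0 := (div_pos (by linarith) (by linarith)).ne'
  rw [hα0, h.left, hW, flowEnergy, flowEnergy, max_eq_left hWα'.le,
    max_eq_right (by linarith : -W α ≤ 0)] at hE
  simp only [neg_zero, max_self, zero_div, Real.zero_rpow hq, add_zero, mul_zero,
    Real.zero_rpow (by linarith : p ≠ 0)] at hE
  have : 0 < (p - 1) * (W α / a) ^ (p / (p - 1)) :=
    mul_pos (by linarith) (Real.rpow_pos_of_pos (div_pos hWα' ha) _)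
  linarith

/-- From a zero with positive flux, a solution performs a full positive arch. -/
lemma IsFlow.positive_step {p a b μ ν L s : ℝ} {U W : ℝ → ℝ} (hp : 1 < p) (ha : 0 < a)
    (hb : 0 < b) (h : IsFlow p a b μ ν L U W) (hs : s ∈ Ico 0 L) (hU : U s = 0) (hW : 0 < W s) :
    0 < μ ∧ s + archLength p a b μ ≤ L ∧
      (∀ t ∈ Icc s (s + archLength p a b μ), U t = (W s / a) ^ (1 / (p - 1)) / freq p μ *
        arch p a b ((t - s) / archLength p a b μ)) ∧
      U (s + archLength p a b μ) = 0 ∧ W (s + archLength p a b μ) = -(b / a * W s) := by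
  have hWc : ContinuousWithinAt W (Ici s) s := (h.contW s ⟨hs.1, hs.2.le⟩).mono_of_mem_nhdsWithin
    (Filter.mem_of_superset (Icc_mem_nhdsGE hs.2) (Icc_subset_Icc_left hs.1))
  -- The flux stays positive just to the right of `s`; up to the midpoint `t` of such an interval
  -- `U` increases strictly, so an arch really begins at `s`.
  obtain ⟨r, hr, hrW⟩ := (mem_nhdsGE_iff_exists_Ico_subset' hs.2).1
    (Filter.inter_mem (hWc.eventually (lt_mem_nhds hW)) (Ico_mem_nhdsGE hs.2))
  set t := (s + r) / 2
  have hst : s < t := by simp only [t]; linarith [show s < r from hr]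
  have htr : t < r := by simp only [t]; linarith [show s < r from hr]
  have htL : t < L := (hrW ⟨hst.le, htr⟩).2.2
  have hmono : StrictMonoOn U (Icc s t) := by
    refine strictMonoOn_of_deriv_pos (convex_Icc _ _)
      (h.contU.mono (Icc_subset_Icc hs.1 htL.le)) ?_
    rw [interior_Icc]
    intro x hx
    rw [(h.derivU x ⟨hs.1.trans_lt hx.1, hx.2.trans htL⟩).deriv]
    exact asymFluxInv_pos hp ha (hrW ⟨hx.1.le, hx.2.trans htr⟩).1
  have hUpos : ∀ x ∈ Ioc s t, 0 < U x := fun x hx => by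
    rw [← hU]; exact hmono ⟨le_rfl, hst.le⟩ ⟨hx.1.le, hx.2⟩ hx.1
  obtain ⟨β, hβ, hβ0, hβp⟩ := exists_first_zero_right
    (h.contU.mono (Icc_subset_Icc_left (hs.1.trans hst.le))) htL.le (hUpos t ⟨hst, le_rfl⟩) h.right
  obtain ⟨hμ, hlen, M, hM, hprof, hWs, hWβ⟩ := (h.flowOn.mono hs.1 hβ.2).positive_arch hp ha hb
    (hst.trans hβ.1) hU hβ0 fun x hx => by
      rcases le_total x t with hxt | hxt
      · exact hUpos x ⟨hx.1, hxt⟩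
      · exact hβp x ⟨hxt, hx.2⟩
  have hκ := freq_pos hp hμ
  have hβe : s + archLength p a b μ = β := by rw [← hlen]; ring
  -- The amplitude is expressed by the initial flux, the quantity that can be passed from one arch
  -- to the next.
  have hθ : (W s / a) ^ (1 / (p - 1)) = freq p μ * M := by
    rw [hWs, mul_div_cancel_left₀ _ ha.ne', ← Real.rpow_mul (mul_pos hκ hM).le,
      mul_one_div_cancel (by linarith), Real.rpow_one]
  rw [hβe, ← hlen]
  refine ⟨hμ, hβ.2, fun x hx => ?_, hβ0, ?_⟩
  · rw [hprof x hx, hθ, mul_div_cancel_left₀ _ hκ.ne']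
  · rw [hWβ, hWs]; field_simp

lemma IsFlow.negative_step {p a b μ ν L s : ℝ} {U W : ℝ → ℝ} (hp : 1 < p) (ha : 0 < a)
    (hb : 0 < b) (h : IsFlow p a b μ ν L U W) (hs : s ∈ Ico 0 L) (hU : U s = 0) (hW : W s < 0) :
    0 < ν ∧ s + archLength p a b ν ≤ L ∧
      (∀ t ∈ Icc s (s + archLength p a b ν), U t = -((-W s / b) ^ (1 / (p - 1)) / freq p ν *
        arch p b a ((t - s) / archLength p a b ν))) ∧
      U (s + archLength p a b ν) = 0 ∧ W (s + archLength p a b ν) = -(a / b * W s) := by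
  obtain ⟨h1, h2, h3, h4, h5⟩ := h.neg.positive_step hp hb ha hs (by simp [hU]) (neg_pos.2 hW)
  rw [archLength_comm p b a] at h2 h3 h4 h5
  refine ⟨h1, h2, fun t ht => ?_, neg_eq_zero.1 h4, by linarith⟩
  rw [← h3 t ht, neg_neg]

/-! ### Solutions as concatenations of arches -/

/-- The end points of alternating adjacent intervals of lengths `l` and `m`. -/
def alternatingNodes (l m : ℝ) : ℕ → ℝ
  | 0 => 0
  | k + 1 => alternatingNodes l m k + if Even k then l else m

lemma alternatingNodes_two_mul (l m : ℝ) (k : ℕ) :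
    alternatingNodes l m (2 * k) = k * (l + m) := by
  induction k with
  | zero => simp [alternatingNodes]
  | succ k ih =>
    have h1 : ¬ Even (2 * k + 1) := by simp
    have h2 : Even (2 * k) := by simp
    rw [Nat.mul_succ, alternatingNodes, alternatingNodes, ih, if_pos h2, if_neg h1]
    push_cast; ring

/-- Intervals of even index form the first family and those of odd index the second, hence the
counts `(n + 1) / 2` and `n / 2`. Members of one family are separated by a nondegenerate member of
the other, so even their closures are disjoint. -/
lemma isInterspersedCover_of_nodes {L : ℝ} (hL : 0 < L) {z : ℕ → ℝ} {n : ℕ} (h0 : z 0 = 0)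
    (hn : z n = L) (hz : ∀ j < n, z j < z (j + 1)) :
    IsInterspersedCover L (P := (n + 1) / 2) (N := n / 2) (fun i => z (2 * i))
      (fun i => z (2 * i + 1)) (fun j => z (2 * j + 1)) (fun j => z (2 * j + 2)) := by
  have hlt : ∀ j k, j < k → k ≤ n → z j < z k := by
    intro j k hjk
    induction k, hjk using Nat.le_induction with
    | base => intro h; exact hz j h
    | succ k hk ih => intro h; exact (ih (by omega)).trans (hz k h)
  have hle : ∀ j k, j ≤ k → k ≤ n → z j ≤ z k := by
    intro j k hjk hk
    rcases hjk.eq_or_lt with rfl | h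
    · exact le_rfl
    · exact (hlt j k h hk).le
  have hdisj : ∀ j k, j + 1 < k → k < n → Disjoint (Icc (z j) (z (j + 1))) (Icc (z k) (z (k + 1))) := by
    intro j k hjk hk
    rw [Set.disjoint_left]
    intro t ht ht'
    linarith [ht.2, ht'.1, hlt (j + 1) k hjk (by omega)]
  refine ⟨fun i => hz _ (by omega), fun j => hz _ (by omega), ?_, ?_, ?_, ?_, ?_, ?_⟩
  · intro i i' hii
    rcases lt_or_gt_of_ne (Fin.val_ne_of_ne hii) with h | h
    · exact hdisj _ _ (by omega) (by omega)
    · exact (hdisj _ _ (by omega) (by omega)).symm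
  · intro i i' hii
    rcases lt_or_gt_of_ne (Fin.val_ne_of_ne hii) with h | h
    · exact hdisj _ _ (by omega) (by omega)
    · exact (hdisj _ _ (by omega) (by omega)).symm
  · intro i j
    rw [Set.disjoint_left]
    intro t ht ht'
    rcases le_or_gt (i : ℕ) j with h | h
    · linarith [ht.2, ht'.1, hle (2 * i + 1) (2 * j + 1) (by omega) (by omega)]
    · linarith [ht.1, ht'.2, hle (2 * j + 2) (2 * i) (by omega) (by omega)]
  · intro i i' hii x hx y hy
    have : (i : ℕ) < i' := hii
    linarith [hx.2, hy.1, hle (2 * i + 1) (2 * i') (by omega) (by omega)]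
  · intro i i' hii x hx y hy
    have : (i : ℕ) < i' := hii
    linarith [hx.2, hy.1, hle (2 * i + 2) (2 * i' + 1) (by omega) (by omega)]
  · apply Subset.antisymm
    · refine union_subset (iUnion_subset fun i => ?_) (iUnion_subset fun j => ?_)
      · exact Icc_subset_Icc (h0 ▸ hle _ _ (by omega) (by omega)) (hn ▸ hle _ _ (by omega) (by omega))
      · exact Icc_subset_Icc (h0 ▸ hle _ _ (by omega) (by omega)) (hn ▸ hle _ _ (by omega) (by omega))
    · intro t ht
      have hex : ∃ j < n, t ∈ Icc (z j) (z (j + 1)) := by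
        have hn0 : 0 < n := by
          rcases Nat.eq_zero_or_pos n with rfl | h
          · linarith
          · exact h
        -- The first node at or beyond `t` is the right end of an interval containing `t`, except
        -- when it is node `0`, where `t = 0`.
        have hfind : ∃ k, t ≤ z k := ⟨n, hn ▸ ht.2⟩
        classical
        rcases Nat.eq_zero_or_pos (Nat.find hfind) with h | h
        · have h1 := Nat.find_spec hfind
          rw [h] at h1
          exact ⟨0, hn0, by linarith [ht.1], h1.trans (hz 0 hn0).le⟩
        · refine ⟨Nat.find hfind - 1, ?_, ?_, ?_⟩
          · have := Nat.find_min' hfind (hn ▸ ht.2 : t ≤ z n)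
            omega
          · exact (not_le.1 (Nat.find_min hfind (Nat.sub_lt h one_pos))).le
          · rw [Nat.sub_add_cancel h]; exact Nat.find_spec hfind
      obtain ⟨j, hj, htj⟩ := hex
      rcases Nat.even_or_odd' j with ⟨k, rfl | rfl⟩
      · exact Or.inl (mem_iUnion.2 ⟨⟨k, by omega⟩, htj⟩)
      · exact Or.inr (mem_iUnion.2 ⟨⟨k, by omega⟩, htj⟩)

/-- `U` is, up to a positive factor, a concatenation of alternating positive and negative arches
of the lengths prescribed by `μ` and `ν`. -/
def IsArchConcatenation (p a b μ ν L : ℝ) {P N : ℕ} (α β : Fin P → ℝ) (γ δ : Fin N → ℝ)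
    (θ : ℝ) (U : ℝ → ℝ) : Prop :=
  (0 < P → 0 < μ) ∧ (0 < N → 0 < ν) ∧ IsInterspersedCover L α β γ δ ∧
  (∀ i, β i - α i = archLength p a b μ) ∧ (∀ j, δ j - γ j = archLength p a b ν) ∧ 0 < θ ∧
  (∀ i, ∀ t ∈ Icc (α i) (β i),
    U t = θ * (archLength p a b μ * arch p a b ((t - α i) / (β i - α i)))) ∧
  (∀ j, ∀ t ∈ Icc (γ j) (δ j),
    U t = -(θ * (archLength p a b ν * arch p b a ((t - γ j) / (δ j - γ j)))))

lemma IsInterspersedCover.swap {L : ℝ} {P N : ℕ} {α β : Fin P → ℝ} {γ δ : Fin N → ℝ}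
    (h : IsInterspersedCover L α β γ δ) : IsInterspersedCover L γ δ α β :=
  ⟨h.nonempty_J, h.nonempty_I, h.closure_disjoint_J, h.closure_disjoint_I,
    fun j i => (h.disjoint_I_J i j).symm, h.ordered_J, h.ordered_I, by rw [union_comm, h.cover]⟩

lemma IsArchConcatenation.neg {p a b μ ν L θ : ℝ} {P N : ℕ} {α β : Fin P → ℝ}
    {γ δ : Fin N → ℝ} {U : ℝ → ℝ} (h : IsArchConcatenation p a b μ ν L α β γ δ θ U) :
    IsArchConcatenation p b a ν μ L γ δ α β θ (fun t => -U t) := by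
  obtain ⟨h1, h2, h3, h4, h5, h6, h7, h8⟩ := h
  refine ⟨h2, h1, h3.swap, ?_, ?_, h6, ?_, ?_⟩
  · simpa only [archLength_comm p b a] using h5
  · simpa only [archLength_comm p b a] using h4
  · intro j t ht; simp only [h8 j t ht, neg_neg, archLength_comm p b a]
  · intro i t ht; simp only [h7 i t ht, archLength_comm p b a]

lemma IsFlow.exists_isArchConcatenation_of_pos {p a b μ ν L : ℝ} {U W : ℝ → ℝ} (hp : 1 < p)
    (ha : 0 < a) (hb : 0 < b) (hL : 0 < L) (h : IsFlow p a b μ ν L U W) (hW : 0 < W 0) :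
    ∃ (P N : ℕ) (α β : Fin P → ℝ) (γ δ : Fin N → ℝ) (θ : ℝ),
      IsArchConcatenation p a b μ ν L α β γ δ θ U := by
  -- If a parameter is not positive, the corresponding length has no meaning. A node built from it
  -- is used only after a completed arch has proved positivity.
  set l := archLength p a b μ with hl
  set m := archLength p a b ν with hm
  set z := alternatingNodes l m with hz
  set θ := (W 0 / a) ^ (1 / (p - 1)) with hθ
  have hθ0 : 0 < θ := Real.rpow_pos_of_pos (div_pos hW ha) _
  have hzs : ∀ k, z (k + 1) = z k + if Even k then l else m := fun k => rfl
  let good : ℕ → Prop := fun k =>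
    (∀ j < k, z j < z (j + 1) ∧ (Even j → 0 < μ ∧ ∀ t ∈ Icc (z j) (z (j + 1)),
        U t = θ / freq p μ * arch p a b ((t - z j) / (z (j + 1) - z j))) ∧
      (¬ Even j → 0 < ν ∧ ∀ t ∈ Icc (z j) (z (j + 1)),
        U t = -(θ / freq p ν * arch p b a ((t - z j) / (z (j + 1) - z j))))) ∧
    U (z k) = 0 ∧ W (z k) = (if Even k then W 0 else -(b / a * W 0)) ∧ 0 ≤ z k ∧ z k ≤ L
  have hgood0 : good 0 := ⟨fun j hj => absurd hj (Nat.not_lt_zero j), h.left, by simp [z, alternatingNodes],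
    le_rfl, hL.le⟩
  have hstep : ∀ k, good k → z k < L → good (k + 1) := by
    intro k ⟨g1, g2, g3, g4, g5⟩ hk
    by_cases he : Even k
    · rw [if_pos he] at g3
      obtain ⟨s1, s2, s3, s4, s5⟩ := h.positive_step hp ha hb ⟨g4, hk⟩ g2 (g3 ▸ hW)
      have hlpos := archLength_pos hp ha hb s1
      have hzk : z (k + 1) = z k + l := by rw [hzs, if_pos he]
      rw [← hl, ← hzk] at s2 s3 s4 s5
      refine ⟨fun j hj => ?_, s4, ?_, by rw [hzk]; positivity, s2⟩
      · rcases Nat.lt_succ_iff_lt_or_eq.1 hj with hj | rfl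
        · exact g1 j hj
        · refine ⟨by rw [hzk]; linarith, fun _ => ⟨s1, fun t ht => ?_⟩, fun hne => absurd he hne⟩
          rw [s3 t ht, g3, hzk, add_sub_cancel_left]
      · rw [s5, g3, if_neg (by rw [Nat.even_add_one]; exact not_not.2 he)]
    · rw [if_neg he] at g3
      have hneg : W (z k) < 0 := by rw [g3]; have := div_pos hb ha; nlinarith
      obtain ⟨s1, s2, s3, s4, s5⟩ := h.negative_step hp ha hb ⟨g4, hk⟩ g2 hneg
      have hlpos := archLength_pos hp ha hb s1
      have hzk : z (k + 1) = z k + m := by rw [hzs, if_neg he]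
      rw [← hm, ← hzk] at s2 s3 s4 s5
      -- The flux `-(b / a * W 0)` normalized by `b` returns `W 0 / a`: arches of both signs share
      -- the scale `θ`, hence a single constant multiplies the whole profile.
      have hθ' : -W (z k) / b = W 0 / a := by rw [g3]; field_simp
      refine ⟨fun j hj => ?_, s4, ?_, by rw [hzk]; positivity, s2⟩
      · rcases Nat.lt_succ_iff_lt_or_eq.1 hj with hj | rfl
        · exact g1 j hj
        · refine ⟨by rw [hzk]; linarith, fun h => absurd h he, fun _ => ⟨s1, fun t ht => ?_⟩⟩
          rw [s3 t ht, hθ', hzk, add_sub_cancel_left]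
      · rw [s5, g3, if_pos (by rw [Nat.even_add_one]; exact he)]
        field_simp
  -- Otherwise the steps never stop. The first two arches then give `0 < μ` and `0 < ν`, and the
  -- even nodes `k * (l + m)` eventually exceed `L`.
  obtain ⟨n, hgn, hzn⟩ : ∃ n, good n ∧ z n = L := by
    by_contra! hcon
    have hall : ∀ k, good k ∧ z k < L := by
      intro k
      induction k with
      | zero => exact ⟨hgood0, lt_of_le_of_ne hgood0.2.2.2.2 (hcon 0 hgood0)⟩
      | succ k ih =>
        have := hstep k ih.1 ih.2
        exact ⟨this, lt_of_le_of_ne this.2.2.2.2 (hcon _ this)⟩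
    have hμ : 0 < μ := (((hall 2).1.1 0 (by norm_num)).2.1 (by simp)).1
    have hν : 0 < ν := (((hall 2).1.1 1 (by norm_num)).2.2 (by simp)).1
    have hlm : 0 < l + m := add_pos (archLength_pos hp ha hb hμ) (archLength_pos hp ha hb hν)
    obtain ⟨k, hk⟩ := exists_nat_gt (L / (l + m))
    have := (hall (2 * k)).2
    rw [hz, alternatingNodes_two_mul] at this
    rw [div_lt_iff₀ hlm] at hk
    linarith
  have hh := halfPip_pos hp
  have hab : 0 < a + b := add_pos ha hb
  -- The divisor `(a + b) * halfPip p` rewrites each amplitude `θ / freq` as a common factor times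
  -- the arch length.
  refine ⟨(n + 1) / 2, n / 2, fun i => z (2 * i), fun i => z (2 * i + 1), fun j => z (2 * j + 1),
    fun j => z (2 * j + 2), θ / ((a + b) * halfPip p), ?_, ?_,
    isInterspersedCover_of_nodes hL rfl hzn fun j hj => (hgn.1 j hj).1, ?_, ?_, by positivity,
    ?_, ?_⟩
  · intro hP
    exact ((hgn.1 0 (by omega)).2.1 (by simp)).1
  · intro hN
    exact ((hgn.1 1 (by omega)).2.2 (by simp)).1
  · intro i
    change z (2 * i + 1) - _ = _
    rw [hzs, if_pos (by simp)]; ring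
  · intro j
    change z (2 * j + 1 + 1) - _ = _
    rw [hzs (2 * j + 1), if_neg (by simp)]; ring
  · intro i t ht
    obtain ⟨hμ, hprof⟩ := (hgn.1 (2 * i) (by omega)).2.1 (by simp)
    have := freq_pos hp hμ
    rw [hprof t ht, archLength]
    field_simp
  · intro j t ht
    obtain ⟨hν, hprof⟩ := (hgn.1 (2 * j + 1) (by omega)).2.2 (by simp)
    have := freq_pos hp hν
    rw [hprof t ht, archLength]
    field_simp

/-- Nontrivial solutions are concatenations of arches. -/
lemma IsFlow.exists_isArchConcatenation {p a b μ ν L : ℝ} {U W : ℝ → ℝ} (hp : 1 < p)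
    (ha : 0 < a) (hb : 0 < b) (h : IsFlow p a b μ ν L U W) (hne : ∃ t ∈ Ioo 0 L, U t ≠ 0) :
    ∃ (P N : ℕ) (α β : Fin P → ℝ) (γ δ : Fin N → ℝ) (θ : ℝ),
      IsArchConcatenation p a b μ ν L α β γ δ θ U := by
  obtain ⟨t, ht, hUt⟩ := hne
  have hL : 0 < L := ht.1.trans ht.2
  rcases lt_or_gt_of_ne (h.flux_left_ne_zero hp ha hb ht hUt) with hW | hW
  · obtain ⟨P, N, α, β, γ, δ, θ, hc⟩ :=
      h.neg.exists_isArchConcatenation_of_pos hp hb ha hL (neg_pos.2 hW)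
    exact ⟨N, P, γ, δ, α, β, θ, by simpa using hc.neg⟩
  · exact h.exists_isArchConcatenation_of_pos hp ha hb hL hW

/-! ### The explicit arch solves the system -/

/-- The flux along `arch`. -/
def archFlux (p a b x : ℝ) : ℝ :=
  if x < a / (a + b) then a * cosFlux p (halfPip p * (a + b) / a * x)
  else -(b * cosFlux p (halfPip p * (a + b) / b * (1 - x)))

section Arch

variable {p a b : ℝ}

lemma peak_pos (ha : 0 < a) (hb : 0 < b) : 0 < a / (a + b) := by positivity

lemma peak_lt_one (ha : 0 < a) (hb : 0 < b) : a / (a + b) < 1 := by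
  rw [div_lt_one (by positivity)]; linarith

lemma peak_left_eq (ha : 0 < a) (hb : 0 < b) :
    halfPip p * (a + b) / a * (a / (a + b)) = halfPip p := by field_simp

lemma peak_right_eq (ha : 0 < a) (hb : 0 < b) :
    halfPip p * (a + b) / b * (1 - a / (a + b)) = halfPip p := by field_simp; ring

lemma arch_zero (hp : 1 < p) (ha : 0 < a) (hb : 0 < b) : arch p a b 0 = 0 := by
  rw [arch, if_pos (peak_pos ha hb), mul_zero, sinp_zero hp]

lemma arch_one (hp : 1 < p) (ha : 0 < a) (hb : 0 < b) : arch p a b 1 = 0 := by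
  rw [arch, if_neg (peak_lt_one ha hb).not_gt, sub_self, mul_zero, sinp_zero hp]

lemma archFlux_zero (hp : 1 < p) (ha : 0 < a) (hb : 0 < b) : archFlux p a b 0 = a := by
  rw [archFlux, if_pos (peak_pos ha hb), mul_zero, cosFlux_zero hp, mul_one]

lemma archFlux_one (hp : 1 < p) (ha : 0 < a) (hb : 0 < b) : archFlux p a b 1 = -b := by
  rw [archFlux, if_neg (peak_lt_one ha hb).not_gt, sub_self, mul_zero, cosFlux_zero hp, mul_one]

lemma arch_pos (hp : 1 < p) (ha : 0 < a) (hb : 0 < b) {x : ℝ} (hx : x ∈ Ioo 0 1) :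
    0 < arch p a b x := by
  have hh := halfPip_pos hp
  have h1 := hx.1
  have h2 : 0 < 1 - x := by linarith [hx.2]
  rw [arch]
  split_ifs <;> exact sinp_pos hp (by positivity)

lemma continuous_arch (hp : 1 < p) (ha : 0 < a) (hb : 0 < b) : Continuous (arch p a b) := by
  have : arch p a b = fun x => if a / (a + b) ≤ x then sinp p (halfPip p * (a + b) / b * (1 - x))
      else sinp p (halfPip p * (a + b) / a * x) := by
    ext x; rw [arch]; rcases lt_or_ge x (a / (a + b)) with h | h
    · rw [if_pos h, if_neg h.not_ge]
    · rw [if_pos h, if_neg h.not_gt]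
  rw [this]
  refine Continuous.if_le ((continuous_sinp hp).comp (by fun_prop))
    ((continuous_sinp hp).comp (by fun_prop)) continuous_const continuous_id ?_
  rintro x rfl
  rw [peak_left_eq ha hb, peak_right_eq ha hb]

lemma continuous_archFlux (hp : 1 < p) (ha : 0 < a) (hb : 0 < b) : Continuous (archFlux p a b) := by
  have : archFlux p a b = fun x => if a / (a + b) ≤ x
      then -(b * cosFlux p (halfPip p * (a + b) / b * (1 - x)))
      else a * cosFlux p (halfPip p * (a + b) / a * x) := by
    ext x; rw [archFlux]; rcases lt_or_ge x (a / (a + b)) with h | h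
    · rw [if_pos h, if_neg h.not_ge]
    · rw [if_pos h, if_neg h.not_gt]
  rw [this]
  refine Continuous.if_le
    (continuous_const.mul ((continuous_cosFlux hp).comp (by fun_prop))).neg
    (continuous_const.mul ((continuous_cosFlux hp).comp (by fun_prop)))
    continuous_const continuous_id ?_
  rintro x rfl
  rw [peak_left_eq ha hb, peak_right_eq ha hb, cosFlux_halfPip hp]
  simp

/-- The factor `a` in front of `cosFlux` in `archFlux` is the one for which `asymFluxInv` returns
the slope `cosFlux ^ (1 / (p - 1)) / a`. -/
lemma hasDerivAt_left_of_peak (hp : 1 < p) (ha : 0 < a) (hb : 0 < b) {x : ℝ} (h0 : 0 < x)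
    (hx : x < a / (a + b)) :
    HasDerivAt (arch p a b) (halfPip p * (a + b) * asymFluxInv p a b (archFlux p a b x)) x ∧
    HasDerivAt (archFlux p a b) (-((p - 1) * (halfPip p * (a + b)) * arch p a b x ^ (p - 1))) x := by
  have hh := halfPip_pos hp
  have hs : 0 < halfPip p * (a + b) / a := by positivity
  have hlt : halfPip p * (a + b) / a * x < halfPip p := by
    calc _ < halfPip p * (a + b) / a * (a / (a + b)) := by gcongr
      _ = _ := peak_left_eq ha hb
  have hlin : HasDerivAt (fun y => halfPip p * (a + b) / a * y) (halfPip p * (a + b) / a) x := by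
    simpa using (hasDerivAt_id x).const_mul (halfPip p * (a + b) / a)
  have d1 := (hasDerivAt_sinp hp hlt).comp x hlin
  have d2 := ((hasDerivAt_cosFlux hp (mul_pos hs h0) hlt).comp x hlin).const_mul a
  have hev := gt_mem_nhds hx
  constructor
  · refine (d1.congr_of_eventuallyEq ?_).congr_deriv ?_
    · filter_upwards [hev] with y hy
      rw [arch, if_pos hy]; rfl
    · have hD := (cosFlux_pos hp hlt).le
      rw [archFlux, if_pos hx, asymFluxInv_of_nonneg hp (by positivity),
        div_rpow_flux hp ha (by positivity), mul_div_cancel_left₀ _ ha.ne']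
      ring
  · refine (d2.congr_of_eventuallyEq ?_).congr_deriv ?_
    · filter_upwards [hev] with y hy
      rw [archFlux, if_pos hy]; rfl
    · rw [arch, if_pos hx]; field_simp

/-- Reflection exchanges the rising and falling sides, hence `a` and `b`. It transfers the
derivative formulas across the peak. -/
lemma arch_one_sub (hp : 1 < p) (ha : 0 < a) (hb : 0 < b) (x : ℝ) :
    arch p a b (1 - x) = arch p b a x ∧ archFlux p a b (1 - x) = -archFlux p b a x := by
  have hab : b / (b + a) = 1 - a / (a + b) := by field_simp; ring
  have hl := peak_left_eq (p := p) ha hb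
  have hr := peak_right_eq (p := p) ha hb
  rw [arch, arch, archFlux, archFlux, hab, sub_sub_cancel, add_comm b a]
  rcases lt_trichotomy x (1 - a / (a + b)) with h | h | h
  · rw [if_pos h, if_neg (by linarith), if_neg (by linarith), if_pos h]; simp
  · rw [if_neg (by linarith), if_neg (by linarith), if_neg (by linarith), if_neg (by linarith), h]
    rw [sub_sub_cancel, hl, hr, cosFlux_halfPip hp]; simp
  · rw [if_pos (by linarith), if_neg (by linarith), if_pos (by linarith), if_neg (by linarith)]
    simp

lemma hasDerivAt_arch (hp : 1 < p) (ha : 0 < a) (hb : 0 < b) {x : ℝ} (h0 : x ∈ Ioo 0 1)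
    (hx : x ≠ a / (a + b)) :
    HasDerivAt (arch p a b) (halfPip p * (a + b) * asymFluxInv p a b (archFlux p a b x)) x ∧
    HasDerivAt (archFlux p a b) (-((p - 1) * (halfPip p * (a + b)) * arch p a b x ^ (p - 1))) x := by
  rcases lt_or_gt_of_ne hx with hx | hx
  · exact hasDerivAt_left_of_peak hp ha hb h0.1 hx
  · have hab : b / (b + a) = 1 - a / (a + b) := by field_simp; ring
    obtain ⟨d1, d2⟩ := hasDerivAt_left_of_peak (x := 1 - x) hp hb ha (by linarith [h0.2])
      (by linarith)
    have hlin : HasDerivAt (fun y : ℝ => 1 - y) (-1) x := by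
      simpa using (hasDerivAt_id x).const_sub 1
    have e1 := d1.comp x hlin
    have e2 := (d2.comp x hlin).fun_neg
    have f1 : arch p a b = arch p b a ∘ fun y => 1 - y := by
      ext y; exact (arch_one_sub hp hb ha y).1.symm
    have f2 : archFlux p a b = fun y => -(archFlux p b a ∘ fun y => 1 - y) y := by
      ext y; simp [(arch_one_sub hp hb ha y).2]
    constructor
    · rw [← f1] at e1
      refine e1.congr_deriv ?_
      rw [(arch_one_sub hp hb ha x).2, asymFluxInv_neg]; ring
    · rw [← f2] at e2
      refine e2.congr_deriv ?_
      rw [(arch_one_sub hp hb ha x).1]; ring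

lemma asymFluxInv_rpow_mul (hp : 1 < p) (ha : 0 < a) (hb : 0 < b) {c : ℝ} (hc : 0 < c) (w : ℝ) :
    asymFluxInv p a b (c ^ (p - 1) * w) = c * asymFluxInv p a b w := by
  have hcp := Real.rpow_pos_of_pos hc (p - 1)
  have key : ∀ {a b w : ℝ}, 0 < a → 0 ≤ w →
      asymFluxInv p a b (c ^ (p - 1) * w) = c * asymFluxInv p a b w := by
    intro a b w ha hw
    have hap := Real.rpow_pos_of_pos ha p
    rw [asymFluxInv_of_nonneg hp (by positivity), asymFluxInv_of_nonneg hp hw, mul_div_assoc,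
      Real.mul_rpow hcp.le (by positivity), ← Real.rpow_mul hc.le,
      mul_one_div_cancel (by linarith), Real.rpow_one]
  rcases le_total 0 w with hw | hw
  · exact key ha hw
  · have := key (b := a) hb (neg_nonneg.2 hw)
    rw [mul_neg, asymFluxInv_neg, asymFluxInv_neg] at this
    linarith

/-- A rescaled arch solves the first order system away from its maximum. -/
lemma hasDerivAt_rescaled_arch (hp : 1 < p) (ha : 0 < a) (hb : 0 < b) {μ ν θ α t : ℝ} (hμ : 0 < μ)
    (hθ : 0 < θ) (ht : t ∈ Ioo α (α + archLength p a b μ))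
    (hne : t ≠ α + archLength p a b μ * (a / (a + b))) :
    HasDerivAt
      (fun t => θ * (archLength p a b μ * arch p a b ((t - α) / archLength p a b μ)))
      (asymFluxInv p a b ((θ * (halfPip p * (a + b))) ^ (p - 1) *
        archFlux p a b ((t - α) / archLength p a b μ))) t ∧
    HasDerivAt
      (fun t => (θ * (halfPip p * (a + b))) ^ (p - 1) *
        archFlux p a b ((t - α) / archLength p a b μ))
      (-fucikTerm p μ ν
        (θ * (archLength p a b μ * arch p a b ((t - α) / archLength p a b μ)))) t := by
  have hl := archLength_pos hp ha hb hμ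
  have hκ := freq_pos hp hμ
  have hh := halfPip_pos hp
  have hK : 0 < halfPip p * (a + b) := by positivity
  have hlK : freq p μ * archLength p a b μ = halfPip p * (a + b) := by
    rw [archLength]; field_simp
  set l := archLength p a b μ
  set K := halfPip p * (a + b)
  have hx : (t - α) / l ∈ Ioo 0 1 :=
    ⟨div_pos (by linarith [ht.1]) hl, by rw [div_lt_one hl]; linarith [ht.2]⟩
  have hxne : (t - α) / l ≠ a / (a + b) := by
    intro h
    rw [div_eq_iff hl.ne'] at h
    exact hne (by linarith)
  obtain ⟨d1, d2⟩ := hasDerivAt_arch hp ha hb hx hxne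
  have hlin : HasDerivAt (fun t => (t - α) / l) (1 / l) t :=
    ((hasDerivAt_id t).sub_const α).div_const l
  have hA := arch_pos hp ha hb hx
  constructor
  · refine (((d1.comp t hlin).const_mul l).const_mul θ).congr_deriv ?_
    rw [asymFluxInv_rpow_mul hp ha hb (by positivity)]
    field_simp
    exact mul_comm _ _
  · refine ((d2.comp t hlin).const_mul ((θ * K) ^ (p - 1))).congr_deriv ?_
    rw [fucikTerm_of_nonneg hp (by positivity), Real.mul_rpow hθ.le hK.le,
      Real.mul_rpow hθ.le (mul_pos hl hA).le, Real.mul_rpow hl.le hA.le]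
    -- Here the choice of the length enters: `freq p μ * l = K` is exactly what turns the
    -- coefficient of the normalized arch into `μ`.
    have e1 : μ * l ^ (p - 1) = (p - 1) * K * K ^ (p - 1) / l := by
      have h1 : K * K ^ (p - 1) = K ^ p := by
        rw [← Real.rpow_one_add' hK.le (by linarith)]; congr 1; ring
      have h2 : l ^ (p - 1) * l = l ^ p := by
        rw [← Real.rpow_add_one hl.ne']; congr 1; ring
      have h3 : K ^ p = μ / (p - 1) * l ^ p := by
        rw [← hlK, Real.mul_rpow hκ.le hl.le, freq_rpow hp hμ]
      have : p - 1 ≠ 0 := by linarith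
      rw [eq_div_iff hl.ne', mul_assoc, h2, mul_assoc, h1, h3]
      field_simp
    have e2 : μ * (θ ^ (p - 1) * (l ^ (p - 1) * arch p a b ((t - α) / l) ^ (p - 1))) =
        μ * l ^ (p - 1) * (θ ^ (p - 1) * arch p a b ((t - α) / l) ^ (p - 1)) := by ring
    rw [e2, e1]
    change _ * (-((p - 1) * K * _) * (1 / l)) = _
    ring

end Arch

/-! ### Gluing arches into weak solutions -/

/-- Intersections of closed intervals with disjoint interiors are common end points. -/
lemma endpoints_of_mem_inter {α β γ δ t : ℝ} (hαβ : α < β) (hγδ : γ < δ)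
    (hd : Disjoint (Ioo α β) (Ioo γ δ)) (h1 : t ∈ Icc α β) (h2 : t ∈ Icc γ δ) :
    (t = β ∧ t = γ) ∨ (t = α ∧ t = δ) := by
  rw [Set.Ioo_disjoint_Ioo, min_le_iff, le_max_iff, le_max_iff] at hd
  rcases hd with (h | h) | (h | h)
  · linarith
  · exact Or.inl ⟨le_antisymm h1.2 (h.trans h2.1), le_antisymm (h1.2.trans h) h2.1⟩
  · exact Or.inr ⟨le_antisymm (h2.2.trans h) h1.1, le_antisymm h2.2 (h.trans h1.1)⟩
  · linarith

namespace IsInterspersedCover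

variable {L : ℝ} {P N : ℕ} {α β : Fin P → ℝ} {γ δ : Fin N → ℝ}

/-- Functions given on the intervals of an interspersed cover and agreeing at common end points
can be glued. -/
lemma exists_glued (h : IsInterspersedCover L α β γ δ) (f : Fin P → ℝ → ℝ) (g : Fin N → ℝ → ℝ)
    (h1 : ∀ i j, β i = γ j → f i (β i) = g j (γ j))
    (h2 : ∀ i j, α i = δ j → f i (α i) = g j (δ j)) :
    ∃ F : ℝ → ℝ, (∀ i, ∀ t ∈ Icc (α i) (β i), F t = f i t) ∧
      ∀ j, ∀ t ∈ Icc (γ j) (δ j), F t = g j t := by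
  classical
  refine ⟨fun t => if hi : ∃ i, t ∈ Icc (α i) (β i) then f hi.choose t
    else if hj : ∃ j, t ∈ Icc (γ j) (δ j) then g hj.choose t else 0, ?_, ?_⟩
  · intro i t ht
    have hi : ∃ i, t ∈ Icc (α i) (β i) := ⟨i, ht⟩
    have : hi.choose = i := by
      by_contra hne
      exact Set.disjoint_left.1 (h.closure_disjoint_I _ _ hne) hi.choose_spec ht
    simp only [dif_pos hi, this]
  · intro j t ht
    by_cases hi : ∃ i, t ∈ Icc (α i) (β i)
    · simp only [dif_pos hi]
      rcases endpoints_of_mem_inter (h.nonempty_I _) (h.nonempty_J j) (h.disjoint_I_J _ j)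
        hi.choose_spec ht with ⟨e1, e2⟩ | ⟨e1, e2⟩
      · have := h1 hi.choose j (e1.symm.trans e2)
        rwa [← e1, ← e2] at this
      · have := h2 hi.choose j (e1.symm.trans e2)
        rwa [← e1, ← e2] at this
    · have hj : ∃ j, t ∈ Icc (γ j) (δ j) := ⟨j, ht⟩
      have : hj.choose = j := by
        by_contra hne
        exact Set.disjoint_left.1 (h.closure_disjoint_J _ _ hne) hj.choose_spec ht
      simp only [dif_neg hi, dif_pos hj, this]

lemma continuousOn (h : IsInterspersedCover L α β γ δ) {F : ℝ → ℝ}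
    (h1 : ∀ i, ContinuousOn F (Icc (α i) (β i))) (h2 : ∀ j, ContinuousOn F (Icc (γ j) (δ j))) :
    ContinuousOn F (Icc 0 L) := by
  rw [← h.cover]
  refine ContinuousOn.union_of_isClosed ?_ ?_ (isClosed_iUnion_of_finite fun _ => isClosed_Icc)
    (isClosed_iUnion_of_finite fun _ => isClosed_Icc)
  · exact (locallyFinite_of_finite _).continuousOn_iUnion (fun _ => isClosed_Icc) h1
  · exact (locallyFinite_of_finite _).continuousOn_iUnion (fun _ => isClosed_Icc) h2

lemma mem_cases (h : IsInterspersedCover L α β γ δ) {t : ℝ} (ht : t ∈ Icc 0 L) :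
    (∃ i, t ∈ Icc (α i) (β i)) ∨ ∃ j, t ∈ Icc (γ j) (δ j) := by
  rw [← h.cover] at ht
  exact ht.imp mem_iUnion.1 mem_iUnion.1

lemma subset_I (h : IsInterspersedCover L α β γ δ) (i : Fin P) : Icc (α i) (β i) ⊆ Icc 0 L := by
  rw [← h.cover]
  exact subset_union_of_subset_left (subset_iUnion (fun i => Icc (α i) (β i)) i) _

lemma subset_J (h : IsInterspersedCover L α β γ δ) (j : Fin N) : Icc (γ j) (δ j) ⊆ Icc 0 L :=
  h.swap.subset_I j

end IsInterspersedCover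

section Concatenation

variable {p a b μ ν L θ : ℝ} {P N : ℕ} {α β : Fin P → ℝ} {γ δ : Fin N → ℝ} {U : ℝ → ℝ}

lemma IsArchConcatenation.eq_zero_of_endpoint (hp : 1 < p) (ha : 0 < a) (hb : 0 < b)
    (h : IsArchConcatenation p a b μ ν L α β γ δ θ U) :
    (∀ i, U (α i) = 0 ∧ U (β i) = 0) ∧ ∀ j, U (γ j) = 0 ∧ U (δ j) = 0 := by
  obtain ⟨-, -, hc, -, -, -, h7, h8⟩ := h
  constructor
  · intro i
    have hi := hc.nonempty_I i
    rw [h7 i _ (left_mem_Icc.2 hi.le), h7 i _ (right_mem_Icc.2 hi.le), sub_self, zero_div,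
      div_self (by linarith), arch_zero hp ha hb, arch_one hp ha hb]
    simp
  · intro i
    have hi := hc.nonempty_J i
    rw [h8 i _ (left_mem_Icc.2 hi.le), h8 i _ (right_mem_Icc.2 hi.le), sub_self, zero_div,
      div_self (by linarith), arch_zero hp hb ha, arch_one hp hb ha]
    simp

/-- All intervals lie in `[0, L]`, so one that contains `0` must start there and one that contains
`L` must end there. -/
lemma IsArchConcatenation.boundary (hp : 1 < p) (ha : 0 < a) (hb : 0 < b) (hL : 0 < L)
    (h : IsArchConcatenation p a b μ ν L α β γ δ θ U) : U 0 = 0 ∧ U L = 0 := by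
  obtain ⟨z1, z2⟩ := h.eq_zero_of_endpoint hp ha hb
  have hc := h.2.2.1
  constructor
  · rcases hc.mem_cases (left_mem_Icc.2 hL.le) with ⟨i, hi⟩ | ⟨j, hj⟩
    · have := (hc.subset_I i (left_mem_Icc.2 (hc.nonempty_I i).le)).1
      exact le_antisymm hi.1 this ▸ (z1 i).1
    · have := (hc.subset_J j (left_mem_Icc.2 (hc.nonempty_J j).le)).1
      exact le_antisymm hj.1 this ▸ (z2 j).1
  · rcases hc.mem_cases (right_mem_Icc.2 hL.le) with ⟨i, hi⟩ | ⟨j, hj⟩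
    · have := (hc.subset_I i (right_mem_Icc.2 (hc.nonempty_I i).le)).2
      exact (le_antisymm hi.2 this) ▸ (z1 i).2
    · have := (hc.subset_J j (right_mem_Icc.2 (hc.nonempty_J j).le)).2
      exact (le_antisymm hj.2 this) ▸ (z2 j).2

lemma IsArchConcatenation.continuousOn (hp : 1 < p) (ha : 0 < a) (hb : 0 < b)
    (h : IsArchConcatenation p a b μ ν L α β γ δ θ U) : ContinuousOn U (Icc 0 L) := by
  obtain ⟨-, -, hc, -, -, -, h7, h8⟩ := h
  refine hc.continuousOn (fun i => ?_) fun j => ?_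
  · refine ContinuousOn.congr (Continuous.continuousOn ?_) (h7 i)
    exact continuous_const.mul (continuous_const.mul
      ((continuous_arch hp ha hb).comp (by fun_prop)))
  · refine ContinuousOn.congr (Continuous.continuousOn ?_) (h8 j)
    exact (continuous_const.mul (continuous_const.mul
      ((continuous_arch hp hb ha).comp (by fun_prop)))).neg

lemma IsArchConcatenation.exists_ne_zero (hp : 1 < p) (ha : 0 < a) (hb : 0 < b) (hL : 0 < L)
    (h : IsArchConcatenation p a b μ ν L α β γ δ θ U) : ∃ t ∈ Ioo 0 L, U t ≠ 0 := by
  -- The point `0` lies in an interval of one of the families, and by the sign symmetry it may be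
  -- the positive one.
  wlog hI : ∃ i, (0 : ℝ) ∈ Icc (α i) (β i) generalizing a b μ ν P N α β γ δ U
  · have hJ := (h.2.2.1.mem_cases (left_mem_Icc.2 hL.le)).resolve_left hI
    obtain ⟨t, ht, hne⟩ := this hb ha h.neg hJ
    exact ⟨t, ht, by simpa using hne⟩
  obtain ⟨hμ, -, hc, hlen, -, hθ, h7, -⟩ := h
  obtain ⟨i, -⟩ := hI
  have hi := hc.nonempty_I i
  have hl := archLength_pos hp ha hb (hμ (Fin.pos i))
  refine ⟨(α i + β i) / 2, ⟨?_, ?_⟩, ?_⟩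
  · linarith [(hc.subset_I i (left_mem_Icc.2 hi.le)).1]
  · linarith [(hc.subset_I i (right_mem_Icc.2 hi.le)).2]
  · rw [h7 i _ ⟨by linarith, by linarith⟩]
    have hx : ((α i + β i) / 2 - α i) / (β i - α i) ∈ Ioo 0 1 := by
      constructor
      · exact div_pos (by linarith) (by linarith)
      · rw [div_lt_one (by linarith)]; linarith
    exact (mul_pos hθ (mul_pos hl (arch_pos hp ha hb hx))).ne'

/-- Concatenations of arches are weak solutions. -/
lemma IsArchConcatenation.isNontrivialSolution (hp : 1 < p) (ha : 0 < a) (hb : 0 < b) (hL : 0 < L)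
    (h : IsArchConcatenation p a b μ ν L α β γ δ θ U) {u : ℝ → ℝ}
    (hu : ∀ᵐ t ∂(intervalMeasure L), u t = U t) : IsNontrivialSolution p a b L μ ν u := by
  have hUc := h.continuousOn hp ha hb
  refine ⟨?_, (isNontrivial_iff hUc hu).2 (h.exists_ne_zero hp ha hb hL)⟩
  obtain ⟨hU0, hUL⟩ := h.boundary hp ha hb hL
  obtain ⟨hμ, hν, hc, hlI, hlJ, hθ, h7, h8⟩ := h
  set T := (θ * (halfPip p * (a + b))) ^ (p - 1) with hT
  -- Up to the common factor `T`, a positive arch has flux `a` at its start and `-b` at its end, a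
  -- negative one `-b` and `a`. So the fluxes agree at every junction, and junctions only join
  -- opposite families.
  obtain ⟨W, w1, w2⟩ := hc.exists_glued
    (fun i t => T * archFlux p a b ((t - α i) / archLength p a b μ))
    (fun j t => -(T * archFlux p b a ((t - γ j) / archLength p a b ν)))
    (fun i j _ => by
      have hl := archLength_pos hp ha hb (hμ (Fin.pos i))
      simp only [hlI i, sub_self, zero_div, div_self hl.ne']
      rw [archFlux_one hp ha hb, archFlux_zero hp hb ha]; ring)
    (fun i j _ => by
      have hl := archLength_pos hp ha hb (hν (Fin.pos j))
      simp only [hlJ j, sub_self, zero_div, div_self hl.ne']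
      rw [archFlux_one hp hb ha, archFlux_zero hp ha hb]; ring)
  have hWc : ContinuousOn W (Icc 0 L) := by
    refine hc.continuousOn (fun i => ?_) fun j => ?_
    · refine ContinuousOn.congr (Continuous.continuousOn ?_) (w1 i)
      exact continuous_const.mul ((continuous_archFlux hp ha hb).comp (by fun_prop))
    · refine ContinuousOn.congr (Continuous.continuousOn ?_) (w2 j)
      exact (continuous_const.mul ((continuous_archFlux hp hb ha).comp (by fun_prop))).neg
  -- End points and peaks, where the formulas for the two sides meet.
  let S : Set ℝ := (range α ∪ range β ∪ range fun i => α i + archLength p a b μ * (a / (a + b))) ∪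
    (range γ ∪ range δ ∪ range fun j => γ j + archLength p a b ν * (b / (b + a)))
  have hS : S.Countable := (((countable_range _).union (countable_range _)).union
    (countable_range _)).union (((countable_range _).union (countable_range _)).union
    (countable_range _))
  have hboth : ∀ t ∈ Ioo 0 L \ S, HasDerivAt U (asymFluxInv p a b (W t)) t ∧
      HasDerivAt W (-fucikTerm p μ ν (U t)) t := by
    intro t ⟨ht, htS⟩
    simp only [S, mem_union, mem_range, not_or, not_exists] at htS
    obtain ⟨⟨⟨s1, s2⟩, s3⟩, ⟨⟨s4, s5⟩, s6⟩⟩ := htS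
    rcases hc.mem_cases (Ioo_subset_Icc_self ht) with ⟨i, hi⟩ | ⟨j, hj⟩
    · have hio : t ∈ Ioo (α i) (β i) :=
        ⟨lt_of_le_of_ne hi.1 (s1 i), lt_of_le_of_ne hi.2 fun h => s2 i h.symm⟩
      have hβ : β i = α i + archLength p a b μ := by linarith [hlI i]
      obtain ⟨d1, d2⟩ := hasDerivAt_rescaled_arch (ν := ν) hp ha hb (hμ (Fin.pos i)) hθ
        (hβ ▸ hio) fun h => s3 i h.symm
      have hnhds := Icc_mem_nhds hio.1 hio.2
      have h7' := h7 i
      simp only [hlI i] at h7'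
      rw [w1 i t hi, h7' t hi]
      refine ⟨d1.congr_of_eventuallyEq ?_, d2.congr_of_eventuallyEq ?_⟩
      · filter_upwards [hnhds] with s hs using h7' s hs
      · filter_upwards [hnhds] with s hs using w1 i s hs
    · have hjo : t ∈ Ioo (γ j) (δ j) :=
        ⟨lt_of_le_of_ne hj.1 (s4 j), lt_of_le_of_ne hj.2 fun h => s5 j h.symm⟩
      have hδ : δ j = γ j + archLength p b a ν := by
        rw [archLength_comm p b a]; linarith [hlJ j]
      obtain ⟨d1, d2⟩ := hasDerivAt_rescaled_arch (ν := μ) hp hb ha (hν (Fin.pos j)) hθ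
        (hδ ▸ hjo) fun h => s6 j (by rw [archLength_comm p a b]; exact h.symm)
      rw [archLength_comm p b a, add_comm b a] at d1 d2
      have hnhds := Icc_mem_nhds hjo.1 hjo.2
      have h8' := h8 j
      simp only [hlJ j] at h8'
      rw [w2 j t hj, h8' t hj, asymFluxInv_neg, fucikTerm_neg]
      refine ⟨d1.fun_neg.congr_of_eventuallyEq ?_, d2.fun_neg.congr_of_eventuallyEq ?_⟩
      · filter_upwards [hnhds] with s hs using h8' s hs
      · filter_upwards [hnhds] with s hs using w2 j s hs
  exact isWeakSolution_of_flow_off_countable hp ha hb hL hS hUc hWc (fun t ht => (hboth t ht).1)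
    (fun t ht => (hboth t ht).2) hU0 hUL hu

end Concatenation

/-! ### Characterization of nontrivial solutions -/

/-- Nontrivial weak solutions are exactly the concatenations of arches. -/
theorem isNontrivialSolution_iff {p a b L μ ν : ℝ} (hp : 1 < p) (ha : 0 < a) (hb : 0 < b)
    (hL : 0 < L) {u : ℝ → ℝ} : IsNontrivialSolution p a b L μ ν u ↔
      ∃ (P N : ℕ) (α β : Fin P → ℝ) (γ δ : Fin N → ℝ) (θ : ℝ) (U : ℝ → ℝ),
        IsArchConcatenation p a b μ ν L α β γ δ θ U ∧
        ∀ᵐ t ∂(intervalMeasure L), u t = U t := by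
  constructor
  · rintro ⟨hw, hn⟩
    obtain ⟨U, W, hf, hu⟩ := hw.exists_isFlow hp ha hb hL
    obtain ⟨P, N, α, β, γ, δ, θ, hc⟩ :=
      hf.exists_isArchConcatenation hp ha hb ((isNontrivial_iff hf.contU hu).1 hn)
    exact ⟨P, N, α, β, γ, δ, θ, U, hc, hu⟩
  · rintro ⟨P, N, α, β, γ, δ, θ, U, hc, hu⟩
    exact hc.isNontrivialSolution hp ha hb hL hu

/-! ### Picone inequality and the sharp Poincaré constant -/

/-- Convexity of the energy density: the tangent inequality. -/
lemma asymEnergy_tangent {p a b : ℝ} (hp : 1 < p) (ha : 0 < a) (hb : 0 < b) (s x : ℝ) :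
    p * asymFlux p a b s * x - (p - 1) * asymEnergy p a b s ≤ asymEnergy p a b x := by
  have key : ∀ {a b s x : ℝ}, 0 < a → 0 < b → 0 ≤ s →
      p * asymFlux p a b s * x - (p - 1) * asymEnergy p a b s ≤ asymEnergy p a b x := by
    intro a b s x ha hb hs
    have hap := Real.rpow_pos_of_pos ha p
    have hbp := Real.rpow_pos_of_pos hb p
    have h1 : 0 ≤ s ^ (p - 1) := Real.rpow_nonneg hs _
    have h2 : 0 ≤ s ^ p := Real.rpow_nonneg hs _
    rw [asymFlux_of_nonneg hp hs, asymEnergy_of_nonneg hp hs]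
    -- For `x ≥ 0` this is Young's inequality for `x` and `s ^ (p - 1)`; for `x ≤ 0` the left side
    -- is nonpositive.
    rcases le_total 0 x with hx | hx
    · rw [asymEnergy_of_nonneg hp hx]
      have hpq : p.HolderConjugate (p / (p - 1)) := Real.HolderConjugate.conjExponent hp
      have hy := Real.young_inequality_of_nonneg hx h1 hpq
      rw [← Real.rpow_mul hs, mul_div_cancel₀ _ (by linarith : p - 1 ≠ 0)] at hy
      have hp1 : p - 1 ≠ 0 := by linarith
      have hy' : p * (s ^ (p - 1) * x) - (p - 1) * s ^ p ≤ x ^ p := by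
        have h3 : p * (x * s ^ (p - 1)) ≤ p * (x ^ p / p + s ^ p / (p / (p - 1))) := by gcongr
        have h4 : p * (x ^ p / p + s ^ p / (p / (p - 1))) = x ^ p + (p - 1) * s ^ p := by
          field_simp
        linarith
      nlinarith
    · have h3 : 0 ≤ asymEnergy p a b x := by
        unfold asymEnergy
        have := Real.rpow_nonneg (le_max_right x 0) p
        have := Real.rpow_nonneg (le_max_right (-x) 0) p
        positivity
      have h4 : p * (a ^ p * s ^ (p - 1)) * x ≤ 0 :=
        mul_nonpos_of_nonneg_of_nonpos (by positivity) hx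
      have h5 : 0 ≤ (p - 1) * (a ^ p * s ^ p) := mul_nonneg (by linarith) (by positivity)
      linarith
  rcases le_total 0 s with hs | hs
  · exact key ha hb hs
  · have := key (a := b) (b := a) (s := -s) (x := -x) hb ha (by linarith)
    rw [asymFlux_neg, asymEnergy_neg, asymEnergy_neg] at this
    linarith

lemma asymEnergy_nonneg {p a b : ℝ} (ha : 0 < a) (hb : 0 < b) (x : ℝ) :
    0 ≤ asymEnergy p a b x := by
  unfold asymEnergy
  have := Real.rpow_nonneg (le_max_right x 0) p
  have := Real.rpow_nonneg (le_max_right (-x) 0) p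
  positivity

lemma asymFlux_mul {p a b c : ℝ} (hc : 0 ≤ c) (x : ℝ) :
    asymFlux p a b (c * x) = c ^ (p - 1) * asymFlux p a b x := by
  have h1 : max (c * x) 0 = c * max x 0 := by rw [mul_max_of_nonneg _ _ hc, mul_zero]
  have h2 : max (-(c * x)) 0 = c * max (-x) 0 := by
    rw [mul_max_of_nonneg _ _ hc, mul_zero, mul_neg]
  rw [asymFlux, asymFlux, h1, h2, Real.mul_rpow hc (le_max_right _ _),
    Real.mul_rpow hc (le_max_right _ _)]
  ring

lemma asymEnergy_mul {p a b c : ℝ} (hc : 0 ≤ c) (x : ℝ) :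
    asymEnergy p a b (c * x) = c ^ p * asymEnergy p a b x := by
  have h1 : max (c * x) 0 = c * max x 0 := by rw [mul_max_of_nonneg _ _ hc, mul_zero]
  have h2 : max (-(c * x)) 0 = c * max (-x) 0 := by
    rw [mul_max_of_nonneg _ _ hc, mul_zero, mul_neg]
  rw [asymEnergy, asymEnergy, h1, h2, Real.mul_rpow hc (le_max_right _ _),
    Real.mul_rpow hc (le_max_right _ _)]
  ring

/-- The closed form of the first eigenvalue on the unit interval. -/
def eigenvalueFormula (p a b : ℝ) : ℝ := (p - 1) * (halfPip p * (a + b)) ^ p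

lemma eigenvalueFormula_comm (p a b : ℝ) : eigenvalueFormula p a b = eigenvalueFormula p b a := by
  rw [eigenvalueFormula, eigenvalueFormula, add_comm]

lemma eigenvalueFormula_pos {p a b : ℝ} (hp : 1 < p) (ha : 0 < a) (hb : 0 < b) :
    0 < eigenvalueFormula p a b :=
  mul_pos (by linarith)
    (Real.rpow_pos_of_pos (mul_pos (halfPip_pos hp) (add_pos ha hb)) _)

lemma archLength_eigenvalueFormula {p a b : ℝ} (hp : 1 < p) (ha : 0 < a) (hb : 0 < b) :
    archLength p a b (eigenvalueFormula p a b) = 1 := by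
  have hK : 0 < halfPip p * (a + b) := mul_pos (halfPip_pos hp) (add_pos ha hb)
  rw [archLength, freq, eigenvalueFormula, mul_div_cancel_left₀ _ (by linarith : p - 1 ≠ 0),
    ← Real.rpow_mul hK.le, mul_one_div_cancel (by linarith), Real.rpow_one, mul_comm (a + b),
    div_self hK.ne']

/-- The flux `A(U')` along the profile `U = arch p a b`. -/
def profileFlux (p a b t : ℝ) : ℝ := (halfPip p * (a + b)) ^ (p - 1) * archFlux p a b t

/-- This is the rescaled arch for the parameter that makes its length `1`; the value given to `ν` is
immaterial because the arch is positive. -/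
lemma hasDerivAt_profile {p a b t : ℝ} (hp : 1 < p) (ha : 0 < a) (hb : 0 < b) (ht : t ∈ Ioo 0 1)
    (hne : t ≠ a / (a + b)) :
    HasDerivAt (arch p a b) (asymFluxInv p a b (profileFlux p a b t)) t ∧
    HasDerivAt (profileFlux p a b) (-(eigenvalueFormula p a b * arch p a b t ^ (p - 1))) t := by
  have hμ := eigenvalueFormula_pos hp ha hb
  have hl := archLength_eigenvalueFormula hp ha hb
  have key := hasDerivAt_rescaled_arch (ν := 0) (θ := 1) (α := 0) (t := t) hp ha hb hμ one_pos
    (by rw [hl]; simpa using ht) (by rw [hl]; simpa using hne)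
  simp only [hl, one_mul, sub_zero, div_one] at key
  rw [fucikTerm_of_nonneg hp (arch_pos hp ha hb ht).le] at key
  exact key

/-- The derivative of `A(U') (v⁺)^p / U^(p-1)`, where `U = arch p a b`. -/
def piconeIntegrand (p a b t v v' : ℝ) : ℝ :=
  (-eigenvalueFormula p a b - (p - 1) * (profileFlux p a b t *
    asymFluxInv p a b (profileFlux p a b t)) / arch p a b t ^ p) * max v 0 ^ p +
  profileFlux p a b t / arch p a b t ^ (p - 1) * (p * max v 0 ^ (p - 1) * v')

lemma piconeIntegrand_of_nonpos {p a b t v v' : ℝ} (hp : 1 < p) (hv : v ≤ 0) :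
    piconeIntegrand p a b t v v' = 0 := by
  rw [piconeIntegrand, max_eq_right hv, Real.zero_rpow (by linarith), Real.zero_rpow (by linarith)]
  ring

/-- Picone's inequality: the tangent inequality taken at the slope `(v / U) * U'`, with homogeneity
turning the powers of `v / U` into the Picone quotient. -/
lemma piconeIntegrand_le {p a b t v v' : ℝ} (hp : 1 < p) (ha : 0 < a) (hb : 0 < b)
    (ht : t ∈ Ioo 0 1) (hv : 0 < v) :
    piconeIntegrand p a b t v v' ≤ asymEnergy p a b v' - eigenvalueFormula p a b * v ^ p := by
  have hU := arch_pos hp ha hb ht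
  set U := arch p a b t
  set w := profileFlux p a b t
  have hw := asymFlux_asymFluxInv hp ha hb w
  set B := asymFluxInv p a b w
  have hc : 0 ≤ v / U := by positivity
  have h := asymEnergy_tangent hp ha hb (v / U * B) v'
  rw [asymFlux_mul hc, asymEnergy_mul hc, ← asymFlux_mul_self hp a b B, hw,
    Real.div_rpow hv.le hU.le, Real.div_rpow hv.le hU.le] at h
  have e : piconeIntegrand p a b t v v' = p * (v ^ (p - 1) / U ^ (p - 1) * w) * v' -
      (p - 1) * (v ^ p / U ^ p * (w * B)) - eigenvalueFormula p a b * v ^ p := by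
    rw [piconeIntegrand, max_eq_left hv.le]
    simp only [U, w, B]
    ring
  rw [e]
  linarith

/-- The positive part of `v` is compared with `arch p a b` and the negative part with `arch p b a`.
Both have the same eigenvalue, so sign changes do no harm. -/
lemma picone_sum_le {p a b t v v' : ℝ} (hp : 1 < p) (ha : 0 < a) (hb : 0 < b)
    (ht : t ∈ Ioo 0 1) :
    piconeIntegrand p a b t v v' + piconeIntegrand p b a t (-v) (-v') ≤
      asymEnergy p a b v' - eigenvalueFormula p a b * |v| ^ p := by
  rcases lt_trichotomy v 0 with hv | rfl | hv
  · have := piconeIntegrand_le (v' := -v') hp hb ha ht (neg_pos.2 hv)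
    rw [asymEnergy_neg, eigenvalueFormula_comm] at this
    rw [piconeIntegrand_of_nonpos hp hv.le, abs_of_neg hv]
    linarith
  · rw [piconeIntegrand_of_nonpos hp le_rfl, piconeIntegrand_of_nonpos hp (by simp), abs_zero,
      Real.zero_rpow (by linarith)]
    linarith [asymEnergy_nonneg (p := p) ha hb v']
  · rw [piconeIntegrand_of_nonpos (a := b) hp (by linarith : -v ≤ 0), abs_of_pos hv, add_zero]
    exact piconeIntegrand_le hp ha hb ht hv

lemma hasDerivAt_picone {p a b t : ℝ} (hp : 1 < p) (ha : 0 < a) (hb : 0 < b) (ht : t ∈ Ioo 0 1)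
    (hne : t ≠ a / (a + b)) {v : ℝ → ℝ} {v' : ℝ} (hv : HasDerivAt v v' t) :
    HasDerivAt (fun t => profileFlux p a b t / arch p a b t ^ (p - 1) * max (v t) 0 ^ p)
      (piconeIntegrand p a b t (v t) v') t := by
  obtain ⟨d1, d2⟩ := hasDerivAt_profile hp ha hb ht hne
  have hU := arch_pos hp ha hb ht
  have hUp := Real.rpow_pos_of_pos hU (p - 1)
  have d3 := d1.rpow_const (p := p - 1) (Or.inl hU.ne')
  have d4 := (hasDerivAt_posPart_rpow hp (v t)).comp t hv
  have d5 := (d2.fun_div d3 hUp.ne').fun_mul d4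
  refine d5.congr_deriv ?_
  have e1 : arch p a b t ^ p = arch p a b t ^ (p - 1) * arch p a b t := by
    rw [← Real.rpow_add_one hU.ne']; congr 1; ring
  have e2 : arch p a b t ^ (p - 1 - 1) = arch p a b t ^ (p - 1) / arch p a b t := by
    rw [Real.rpow_sub_one hU.ne']
  rw [piconeIntegrand, e1, e2, Function.comp]
  field_simp

lemma continuous_profileFlux {p a b : ℝ} (hp : 1 < p) (ha : 0 < a) (hb : 0 < b) :
    Continuous (profileFlux p a b) := continuous_const.mul (continuous_archFlux hp ha hb)

lemma continuousOn_piconeIntegrand {p a b s : ℝ} (hp : 1 < p) (ha : 0 < a) (hb : 0 < b)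
    (hs : 0 < s) {v v' : ℝ → ℝ} (hv : Continuous v) (hv' : Continuous v') :
    ContinuousOn (fun t => piconeIntegrand p a b t (v t) (v' t)) (Icc s (1 - s)) ∧
    ContinuousOn (fun t => profileFlux p a b t / arch p a b t ^ (p - 1) * max (v t) 0 ^ p)
      (Icc s (1 - s)) := by
  have hpos : ∀ t ∈ Icc s (1 - s), 0 < arch p a b t := fun t ht =>
    arch_pos hp ha hb ⟨by linarith [ht.1], by linarith [ht.2]⟩
  have cU := (continuous_arch hp ha hb).continuousOn (s := Icc s (1 - s))
  have cw := (continuous_profileFlux hp ha hb).continuousOn (s := Icc s (1 - s))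
  have cB := (continuous_asymFluxInv (a := a) (b := b) hp).comp_continuousOn cw
  have c1 : ContinuousOn (fun t => arch p a b t ^ p) (Icc s (1 - s)) :=
    cU.rpow_const fun t _ => Or.inr (by linarith)
  have c2 : ContinuousOn (fun t => arch p a b t ^ (p - 1)) (Icc s (1 - s)) :=
    cU.rpow_const fun t _ => Or.inr (by linarith)
  have cm : Continuous fun t => max (v t) 0 := hv.max continuous_const
  have c3 : Continuous fun t => max (v t) 0 ^ p := cm.rpow_const fun _ => Or.inr (by linarith)
  have c4 : Continuous fun t => max (v t) 0 ^ (p - 1) :=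
    cm.rpow_const fun _ => Or.inr (by linarith)
  have n1 : ∀ t ∈ Icc s (1 - s), arch p a b t ^ p ≠ 0 := fun t ht =>
    (Real.rpow_pos_of_pos (hpos t ht) _).ne'
  have n2 : ∀ t ∈ Icc s (1 - s), arch p a b t ^ (p - 1) ≠ 0 := fun t ht =>
    (Real.rpow_pos_of_pos (hpos t ht) _).ne'
  constructor
  · exact ((continuousOn_const.sub ((continuousOn_const.mul (cw.mul cB)).div c1 n1)).mul
      c3.continuousOn).add ((cw.div c2 n2).mul
      ((continuous_const.mul c4).mul hv').continuousOn)
  · exact (cw.div c2 n2).mul c3.continuousOn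

/-- Away from the peak the integrand is an exact derivative, and `v` vanishes at both ends.
Restriction to `[s, 1 - s]` keeps the denominator away from zero. -/
lemma integral_piconeIntegrand {p a b s : ℝ} (hp : 1 < p) (ha : 0 < a) (hb : 0 < b)
    (hs : 0 < s) (hs1 : s ≤ 1 - s) {v v' : ℝ → ℝ} (hv : ∀ t, HasDerivAt v (v' t) t)
    (hv' : Continuous v') (h0 : v s = 0) (h1 : v (1 - s) = 0) :
    ∫ t in s..(1 - s), piconeIntegrand p a b t (v t) (v' t) = 0 := by
  have hvc : Continuous v := continuous_iff_continuousAt.2 fun t => (hv t).continuousAt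
  obtain ⟨c1, c2⟩ := continuousOn_piconeIntegrand hp ha hb hs hvc hv'
  rw [integral_eq_of_hasDerivAt_off_countable_of_le
    (fun t => profileFlux p a b t / arch p a b t ^ (p - 1) * max (v t) 0 ^ p) _ hs1
    (countable_singleton (a / (a + b))) c2 ?_ ?_]
  · simp [h0, h1, Real.zero_rpow (by linarith : p ≠ 0)]
  · intro t ht
    exact hasDerivAt_picone hp ha hb ⟨hs.trans ht.1.1, by linarith [ht.1.2]⟩ ht.2 (hv t)
  · exact ContinuousOn.intervalIntegrable (by rwa [uIcc_of_le hs1])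

lemma continuous_asymEnergy {p a b : ℝ} (hp : 1 < p) : Continuous (asymEnergy p a b) := by
  unfold asymEnergy
  have h : ∀ x : ℝ, x ≠ 0 ∨ 0 ≤ p := fun x => Or.inr (by linarith)
  refine (continuous_const.mul (Continuous.rpow_const (by fun_prop) fun x => ?_)).add
    (continuous_const.mul (Continuous.rpow_const (by fun_prop) fun x => ?_)) <;> exact h _

/-- The Poincaré inequality with the sharp constant, for test functions. -/
lemma IsTestFunction.eigenvalueFormula_mul_le {p a b : ℝ} (hp : 1 < p) (ha : 0 < a) (hb : 0 < b)
    {φ : ℝ → ℝ} (hφ : IsTestFunction 1 φ) :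
    eigenvalueFormula p a b * ∫ t in Ioo (0 : ℝ) 1, |φ t| ^ p ≤
      ∫ t in Ioo (0 : ℝ) 1, asymEnergy p a b (deriv φ t) := by
  -- Compact support leaves a margin at both ends. Halving puts `s` and `1 - s` strictly outside the
  -- support, and the minimum with `1` ensures `s ≤ 1 - s`.
  obtain ⟨s, hs, hs2, hsupp⟩ : ∃ s : ℝ, 0 < s ∧ s ≤ 1 - s ∧ ∀ t, t ≤ s ∨ 1 - s ≤ t → φ t = 0 := by
    rcases (tsupport φ).eq_empty_or_nonempty with hem | hne
    · refine ⟨1 / 2, by norm_num, by norm_num, fun t _ => ?_⟩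
      exact image_eq_zero_of_notMem_tsupport (by rw [hem]; simp)
    · have hcpt : IsCompact (tsupport φ) := hφ.2.1
      obtain ⟨x, hx, hxmin⟩ := hcpt.exists_isLeast hne
      obtain ⟨y, hy, hymax⟩ := hcpt.exists_isGreatest hne
      have hx0 := (hφ.2.2 hx).1
      have hy1 := (hφ.2.2 hy).2
      refine ⟨min (min x (1 - y)) 1 / 2, ?_, ?_, fun t ht => ?_⟩
      · have : 0 < min (min x (1 - y)) 1 := lt_min (lt_min hx0 (by linarith)) one_pos
        linarith
      · have := min_le_right (min x (1 - y)) 1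
        linarith
      · have h1 : min (min x (1 - y)) 1 ≤ x := (min_le_left _ _).trans (min_le_left _ _)
        have h2 : min (min x (1 - y)) 1 ≤ 1 - y := (min_le_left _ _).trans (min_le_right _ _)
        refine image_eq_zero_of_notMem_tsupport fun hmem => ?_
        rcases ht with ht | ht
        · linarith [hxmin hmem]
        · linarith [hymax hmem]
  have hd := hφ.hasDerivAt
  have hc := hφ.continuous_deriv
  have i1 := integral_piconeIntegrand hp ha hb hs hs2 hd hc (hsupp s (Or.inl le_rfl))
    (hsupp _ (Or.inr le_rfl))
  have i2 := integral_piconeIntegrand (v := fun t => -φ t) (v' := fun t => -deriv φ t) hp hb ha hs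
    hs2 (fun t => (hd t).fun_neg) hc.neg (by simp [hsupp s (Or.inl le_rfl)])
    (by simp [hsupp (1 - s) (Or.inr le_rfl)])
  have c1 := (continuousOn_piconeIntegrand (p := p) hp ha hb hs hφ.1.continuous hc).1
  have c2 := (continuousOn_piconeIntegrand (p := p) hp hb ha hs hφ.1.continuous.neg hc.neg).1
  have cE : Continuous fun t => asymEnergy p a b (deriv φ t) := (continuous_asymEnergy hp).comp hc
  have cφ : Continuous fun t => |φ t| ^ p :=
    hφ.1.continuous.abs.rpow_const fun _ => Or.inr (by linarith)
  have cφ' : Continuous fun t => eigenvalueFormula p a b * |φ t| ^ p := continuous_const.mul cφ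
  have hmain : (0 : ℝ) ≤ ∫ t in s..(1 - s),
      (asymEnergy p a b (deriv φ t) - eigenvalueFormula p a b * |φ t| ^ p) := by
    have hii1 : IntervalIntegrable (fun t => piconeIntegrand p a b t (φ t) (deriv φ t)) volume s
        (1 - s) := ContinuousOn.intervalIntegrable (by rwa [uIcc_of_le hs2])
    have hii2 : IntervalIntegrable (fun t => piconeIntegrand p b a t (-φ t) (-deriv φ t)) volume s
        (1 - s) := ContinuousOn.intervalIntegrable (by rwa [uIcc_of_le hs2])
    have : (0 : ℝ) = ∫ t in s..(1 - s), (piconeIntegrand p a b t (φ t) (deriv φ t) +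
        piconeIntegrand p b a t (-φ t) (-deriv φ t)) := by
      rw [intervalIntegral.integral_add hii1 hii2, i1, i2, add_zero]
    rw [this]
    refine intervalIntegral.integral_mono_on hs2 (hii1.add hii2)
      (Continuous.intervalIntegrable (cE.sub cφ') _ _) fun t ht => ?_
    exact picone_sum_le hp ha hb ⟨by linarith [ht.1], by linarith [ht.2]⟩
  have hout : ∀ {g : ℝ → ℝ}, (∀ t, t ∉ Icc s (1 - s) → g t = 0) →
      ∫ t in s..(1 - s), g t = ∫ t in Ioo (0 : ℝ) 1, g t := by
    intro g hg
    rw [intervalIntegral.integral_of_le hs2, ← integral_Icc_eq_integral_Ioc]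
    symm
    apply setIntegral_eq_of_subset_of_forall_sdiff_eq_zero measurableSet_Ioo
    · exact fun t ht => ⟨hs.trans_le ht.1, by linarith [ht.2]⟩
    · exact fun t ht => hg t ht.2
  have hφ0 : ∀ t, t ∉ Icc s (1 - s) → φ t = 0 := fun t ht => by
    rw [mem_Icc, not_and_or, not_le, not_le] at ht
    exact hsupp t (ht.imp le_of_lt le_of_lt)
  have hφ'0 : ∀ t, t ∉ Icc s (1 - s) → deriv φ t = 0 := fun t ht => by
    have hev : φ =ᶠ[nhds t] fun _ => 0 := by
      filter_upwards [isClosed_Icc.isOpen_compl.mem_nhds ht] with r hr using hφ0 r hr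
    rw [hev.deriv_eq]; simp
  rw [intervalIntegral.integral_sub (cE.intervalIntegrable _ _)
    (cφ'.intervalIntegrable _ _), intervalIntegral.integral_const_mul,
    hout (g := fun t => |φ t| ^ p) (fun t ht => by
      simp [hφ0 t ht, Real.zero_rpow (by linarith : p ≠ 0)]),
    hout (g := fun t => asymEnergy p a b (deriv φ t)) (fun t ht => by
      simp [hφ'0 t ht, asymEnergy, Real.zero_rpow (by linarith : p ≠ 0)])] at hmain
  linarith

/-! ### From test functions to `W₀^{1,p}` -/

/-- The asymmetric norm `a x⁺ + b x⁻`. -/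
def asymNorm (a b x : ℝ) : ℝ := a * max x 0 + b * max (-x) 0

section AsymNorm

variable {p a b : ℝ}

lemma asymNorm_nonneg (ha : 0 < a) (hb : 0 < b) (x : ℝ) : 0 ≤ asymNorm a b x := by
  have := le_max_right x 0
  have := le_max_right (-x) 0
  unfold asymNorm; positivity

/-- The energy density is the `p`-th power of this gauge, so its triangle inequality controls the
`L^p` norm under approximation and preserves the sharp constant. -/
lemma asymNorm_add_le (ha : 0 < a) (hb : 0 < b) (x y : ℝ) :
    asymNorm a b (x + y) ≤ asymNorm a b x + asymNorm a b y := by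
  have h1 : max (x + y) 0 ≤ max x 0 + max y 0 := max_le
    (add_le_add (le_max_left _ _) (le_max_left _ _))
    (add_nonneg (le_max_right _ _) (le_max_right _ _))
  have h2 : max (-(x + y)) 0 ≤ max (-x) 0 + max (-y) 0 := max_le
    (by rw [neg_add]; exact add_le_add (le_max_left _ _) (le_max_left _ _))
    (add_nonneg (le_max_right _ _) (le_max_right _ _))
  unfold asymNorm
  nlinarith [mul_le_mul_of_nonneg_left h1 ha.le, mul_le_mul_of_nonneg_left h2 hb.le]

lemma asymNorm_le (ha : 0 < a) (hb : 0 < b) (x : ℝ) : asymNorm a b x ≤ (a + b) * |x| := by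
  have h1 : max x 0 ≤ |x| := max_le (le_abs_self x) (abs_nonneg x)
  have h2 : max (-x) 0 ≤ |x| := max_le (neg_le_abs x) (abs_nonneg x)
  unfold asymNorm
  nlinarith [mul_le_mul_of_nonneg_left h1 ha.le, mul_le_mul_of_nonneg_left h2 hb.le]

lemma asymNorm_rpow (hp : 1 < p) (ha : 0 < a) (hb : 0 < b) (x : ℝ) :
    asymNorm a b x ^ p = asymEnergy p a b x := by
  have h0 : p ≠ 0 := by linarith
  rcases le_total 0 x with hx | hx
  · rw [asymNorm, asymEnergy, max_eq_left hx, max_eq_right (by linarith : -x ≤ 0),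
      Real.zero_rpow h0, mul_zero, add_zero, Real.mul_rpow ha.le hx, mul_zero, add_zero]
  · rw [asymNorm, asymEnergy, max_eq_right hx, max_eq_left (by linarith : 0 ≤ -x),
      Real.zero_rpow h0, mul_zero, zero_add, Real.mul_rpow hb.le (by linarith), mul_zero, zero_add]

lemma continuous_asymNorm : Continuous (asymNorm a b) := by unfold asymNorm; fun_prop

lemma norm_asymNorm_le (ha : 0 < a) (hb : 0 < b) (x : ℝ) :
    ‖asymNorm a b x‖ ≤ (a + b) * ‖x‖ := by
  rw [Real.norm_of_nonneg (asymNorm_nonneg ha hb x)]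
  exact asymNorm_le ha hb x

lemma memLp_asymNorm {L : ℝ} (ha : 0 < a) (hb : 0 < b) {v : ℝ → ℝ}
    (hv : MemLp v (ENNReal.ofReal p) (intervalMeasure L)) :
    MemLp (fun t => asymNorm a b (v t)) (ENNReal.ofReal p) (intervalMeasure L) :=
  hv.of_le_mul (continuous_asymNorm.comp_aestronglyMeasurable hv.1)
    (Filter.Eventually.of_forall fun t => norm_asymNorm_le ha hb (v t))

lemma eLpNorm_asymNorm (hp : 1 < p) (ha : 0 < a) (hb : 0 < b) {L : ℝ} {v : ℝ → ℝ}
    (hv : MemLp v (ENNReal.ofReal p) (intervalMeasure L)) :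
    eLpNorm (fun t => asymNorm a b (v t)) (ENNReal.ofReal p) (intervalMeasure L) =
      ENNReal.ofReal ((∫ t in Ioo 0 L, asymEnergy p a b (v t)) ^ (1 / p)) := by
  rw [(memLp_asymNorm ha hb hv).eLpNorm_eq_integral_rpow_norm
    (by simpa using (by linarith : 0 < p)) ENNReal.ofReal_ne_top,
    ENNReal.toReal_ofReal (by linarith), one_div]
  congr 3
  ext t
  rw [Real.norm_of_nonneg (asymNorm_nonneg ha hb _), asymNorm_rpow hp ha hb]

lemma eLpNorm_eq_integral_abs (hp : 1 < p) {L : ℝ} {v : ℝ → ℝ}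
    (hv : MemLp v (ENNReal.ofReal p) (intervalMeasure L)) :
    eLpNorm v (ENNReal.ofReal p) (intervalMeasure L) =
      ENNReal.ofReal ((∫ t in Ioo 0 L, |v t| ^ p) ^ (1 / p)) := by
  rw [hv.eLpNorm_eq_integral_rpow_norm
    (by simpa using (by linarith : 0 < p)) ENNReal.ofReal_ne_top,
    ENNReal.toReal_ofReal (by linarith), one_div]
  rfl

end AsymNorm

/-- The Poincaré inequality with the sharp constant on `W₀^{1,p}(0, 1)`. -/
lemma IsW01p.eigenvalueFormula_le {p a b : ℝ} (hp : 1 < p) (ha : 0 < a) (hb : 0 < b)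
    {u u' : ℝ → ℝ} (h : IsW01p p 1 u u') (h1 : ∫ t in Ioo (0 : ℝ) 1, |u t| ^ p = 1) :
    eigenvalueFormula p a b ≤ ∫ t in Ioo (0 : ℝ) 1, asymEnergy p a b (u' t) := by
  have hlam := eigenvalueFormula_pos hp ha hb
  have hp0 : 0 < 1 / p := one_div_pos.2 (by linarith)
  set k := eigenvalueFormula p a b ^ (1 / p)
  have hk : 0 ≤ k := Real.rpow_nonneg hlam.le _
  have hE : 0 ≤ ∫ t in Ioo (0 : ℝ) 1, asymEnergy p a b (u' t) :=
    integral_nonneg fun t => asymEnergy_nonneg ha hb _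
  have hun : eLpNorm u (ENNReal.ofReal p) (intervalMeasure 1) = 1 := by
    rw [eLpNorm_eq_integral_abs hp h.memLp, h1]; simp
  -- In root form, replacing `u` by a test function costs `k * e` on the side of `u` and `(a + b) *
  -- e` on the side of `u'`.
  have hmain : ∀ e : ℝ, 0 < e → ENNReal.ofReal k ≤
      eLpNorm (fun t => asymNorm a b (u' t)) (ENNReal.ofReal p) (intervalMeasure 1) +
        ENNReal.ofReal (k + (a + b)) * ENNReal.ofReal e := by
    intro e he
    obtain ⟨φ, hφ, hφ1, hφ2⟩ := h.approx (ENNReal.ofReal e) (by simpa using he)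
    have hφp : MemLp φ (ENNReal.ofReal p) (intervalMeasure 1) :=
      hφ.1.continuous.memLp_of_hasCompactSupport hφ.2.1
    have hφ'p : MemLp (deriv φ) (ENNReal.ofReal p) (intervalMeasure 1) :=
      hφ.continuous_deriv.memLp_of_hasCompactSupport hφ.2.1.deriv
    have ineq : ENNReal.ofReal k * eLpNorm φ (ENNReal.ofReal p) (intervalMeasure 1) ≤
        eLpNorm (fun t => asymNorm a b (deriv φ t)) (ENNReal.ofReal p) (intervalMeasure 1) := by
      rw [eLpNorm_asymNorm hp ha hb hφ'p, eLpNorm_eq_integral_abs hp hφp, ← ENNReal.ofReal_mul hk]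
      refine ENNReal.ofReal_le_ofReal ?_
      have hI : 0 ≤ ∫ t in Ioo (0 : ℝ) 1, |φ t| ^ p :=
        integral_nonneg fun t => Real.rpow_nonneg (abs_nonneg _) _
      rw [← Real.mul_rpow hlam.le hI]
      exact Real.rpow_le_rpow (mul_nonneg hlam.le hI)
        (hφ.eigenvalueFormula_mul_le hp ha hb) hp0.le
    have tri1 : (1 : ENNReal) ≤ ENNReal.ofReal e +
        eLpNorm φ (ENNReal.ofReal p) (intervalMeasure 1) := by
      rw [← hun]
      have : u = (fun t => u t - φ t) + φ := by ext t; simp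
      calc eLpNorm u (ENNReal.ofReal p) (intervalMeasure 1)
          = eLpNorm ((fun t => u t - φ t) + φ) (ENNReal.ofReal p) (intervalMeasure 1) := by
            rw [← this]
        _ ≤ _ := eLpNorm_add_le (h.memLp.1.sub hφp.1) hφp.1 (one_le_ofReal hp)
        _ ≤ _ := by gcongr
    have hdiff : MemLp (fun t => u' t - deriv φ t) (ENNReal.ofReal p) (intervalMeasure 1) :=
      h.memLp_deriv.sub hφ'p
    have tri2 : eLpNorm (fun t => asymNorm a b (deriv φ t)) (ENNReal.ofReal p) (intervalMeasure 1)
        ≤ eLpNorm (fun t => asymNorm a b (u' t)) (ENNReal.ofReal p) (intervalMeasure 1) +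
          ENNReal.ofReal (a + b) * ENNReal.ofReal e := by
      calc _ ≤ eLpNorm ((fun t => asymNorm a b (u' t)) + fun t => (a + b) * ‖u' t - deriv φ t‖)
            (ENNReal.ofReal p) (intervalMeasure 1) := by
            refine eLpNorm_mono_real fun t => ?_
            rw [Real.norm_of_nonneg (asymNorm_nonneg ha hb _), Pi.add_apply]
            have e1 := asymNorm_add_le ha hb (u' t) (deriv φ t - u' t)
            have e2 := asymNorm_le ha hb (deriv φ t - u' t)
            rw [add_sub_cancel] at e1
            rw [Real.norm_eq_abs, abs_sub_comm]
            linarith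
        _ ≤ eLpNorm (fun t => asymNorm a b (u' t)) (ENNReal.ofReal p) (intervalMeasure 1) +
            eLpNorm (fun t => (a + b) * ‖u' t - deriv φ t‖)
            (ENNReal.ofReal p) (intervalMeasure 1) :=
          eLpNorm_add_le (memLp_asymNorm ha hb h.memLp_deriv).1
            (hdiff.1.norm.const_mul _) (one_le_ofReal hp)
        _ ≤ _ := by
          gcongr
          refine (eLpNorm_le_mul_eLpNorm_of_ae_le_mul (g := fun t => u' t - deriv φ t) (c := a + b)
            (Filter.Eventually.of_forall fun t => ?_) _).trans (by gcongr)
          rw [norm_mul, norm_norm, Real.norm_of_nonneg (by linarith : 0 ≤ a + b)]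
    calc ENNReal.ofReal k = ENNReal.ofReal k * 1 := (mul_one _).symm
      _ ≤ ENNReal.ofReal k * (ENNReal.ofReal e +
          eLpNorm φ (ENNReal.ofReal p) (intervalMeasure 1)) := by gcongr
      _ = ENNReal.ofReal k * ENNReal.ofReal e +
          ENNReal.ofReal k * eLpNorm φ (ENNReal.ofReal p) (intervalMeasure 1) := mul_add _ _ _
      _ ≤ ENNReal.ofReal k * ENNReal.ofReal e +
          (eLpNorm (fun t => asymNorm a b (u' t)) (ENNReal.ofReal p) (intervalMeasure 1) +
          ENNReal.ofReal (a + b) * ENNReal.ofReal e) := by gcongr; exact ineq.trans tri2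
      _ = _ := by rw [ENNReal.ofReal_add hk (by linarith)]; ring
  have hle : ENNReal.ofReal k ≤
      eLpNorm (fun t => asymNorm a b (u' t)) (ENNReal.ofReal p) (intervalMeasure 1) := by
    have hlim := (tendsto_const_mul_nhds_zero
      (C := ENNReal.ofReal (k + (a + b))) ENNReal.ofReal_ne_top).const_add
      (eLpNorm (fun t => asymNorm a b (u' t)) (ENNReal.ofReal p) (intervalMeasure 1))
    rw [add_zero] at hlim
    refine ge_of_tendsto hlim ?_
    filter_upwards [self_mem_nhdsWithin] with e he using hmain e he
  rw [eLpNorm_asymNorm hp ha hb h.memLp_deriv,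
    ENNReal.ofReal_le_ofReal_iff (Real.rpow_nonneg hE _)] at hle
  exact (Real.rpow_le_rpow_iff hlam.le hE hp0).1 hle

/-! ### First eigenvalue, nodal lengths and principal eigenfunction -/

/-- Multiples of `arch` on the unit interval solve the eigenvalue problem. -/
lemma isNontrivialSolution_arch {p a b θ : ℝ} (hp : 1 < p) (ha : 0 < a) (hb : 0 < b) (hθ : 0 < θ) :
    IsNontrivialSolution p a b 1 (eigenvalueFormula p a b) (eigenvalueFormula p a b)
      (fun t => θ * arch p a b t) := by
  have hl := archLength_eigenvalueFormula hp ha hb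
  have hc : IsArchConcatenation p a b (eigenvalueFormula p a b) (eigenvalueFormula p a b) 1
      (fun _ : Fin 1 => (0 : ℝ)) (fun _ => 1) (Fin.elim0 : Fin 0 → ℝ) Fin.elim0 θ
      (fun t => θ * arch p a b t) := by
    refine ⟨fun _ => eigenvalueFormula_pos hp ha hb, fun h => absurd h (lt_irrefl 0),
      ⟨fun _ => one_pos, fun j => j.elim0, fun i i' h => absurd (Subsingleton.elim i i') h,
        fun j => j.elim0, fun _ j => j.elim0,
        fun i i' h => absurd h (by rw [Subsingleton.elim i i']; exact lt_irrefl _),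
        fun j => j.elim0, by rw [iUnion_const, iUnion_of_empty, union_empty]⟩,
      fun _ => by rw [hl, sub_zero], fun j => j.elim0, hθ, fun _ t _ => ?_, fun j => j.elim0⟩
    rw [hl, sub_zero, sub_zero, div_one, one_mul]
  exact hc.isNontrivialSolution hp ha hb one_pos (Filter.Eventually.of_forall fun _ => rfl)

lemma exists_normalizing_factor {p a b : ℝ} (hp : 1 < p) (ha : 0 < a) (hb : 0 < b) :
    ∃ θ, 0 < θ ∧ ∫ t in Ioo (0 : ℝ) 1, |θ * arch p a b t| ^ p = 1 := by
  have hc : Continuous fun t => |arch p a b t| ^ p :=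
    (continuous_arch hp ha hb).abs.rpow_const fun _ => Or.inr (by linarith)
  have hpos : 0 < ∫ t in Ioo (0 : ℝ) 1, |arch p a b t| ^ p := by
    rw [← integral_Ioc_eq_integral_Ioo, ← intervalIntegral.integral_of_le zero_le_one]
    refine intervalIntegral.intervalIntegral_pos_of_pos_on (hc.intervalIntegrable _ _)
      (fun t ht => ?_) one_pos
    exact Real.rpow_pos_of_pos (abs_pos.2 (arch_pos hp ha hb ht).ne') _
  set I := ∫ t in Ioo (0 : ℝ) 1, |arch p a b t| ^ p
  refine ⟨I ^ (-(1 / p)), Real.rpow_pos_of_pos hpos _, ?_⟩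
  have hθ := Real.rpow_pos_of_pos hpos (-(1 / p))
  have : ∀ t, |I ^ (-(1 / p)) * arch p a b t| ^ p = I⁻¹ * |arch p a b t| ^ p := by
    intro t
    rw [abs_mul, abs_of_pos hθ, Real.mul_rpow hθ.le (abs_nonneg _), ← Real.rpow_mul hpos.le,
      neg_mul, one_div_mul_cancel (by linarith), Real.rpow_neg_one]
  simp only [this]
  rw [integral_const_mul]
  exact inv_mul_cancel₀ hpos.ne'

/-- The infimum is attained: the weak equation for the normalized arch, tested with the arch itself,
equates energy and eigenvalue. The lower bound is the sharp Poincaré inequality. -/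
lemma firstEigenvalue_eq {p a b : ℝ} (hp : 1 < p) (ha : 0 < a) (hb : 0 < b) :
    firstEigenvalue p a b 1 = eigenvalueFormula p a b := by
  refine IsLeast.csInf_eq ⟨?_, ?_⟩
  · obtain ⟨θ, hθ, hnorm⟩ := exists_normalizing_factor hp ha hb
    obtain ⟨u', hu, hw⟩ := (isNontrivialSolution_arch hp ha hb hθ).1
    refine ⟨_, u', hu, hnorm, ?_⟩
    have := hw _ u' hu
    simp only [asymFlux_mul_self hp, fucikTerm_mul_self hp] at this
    rw [integral_const_mul, hnorm, mul_one] at this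
    exact this.symm
  · rintro E ⟨u, u', hu, h1, rfl⟩
    exact hu.eigenvalueFormula_le hp ha hb h1

lemma classicalFirstEigenvalue_eq {p : ℝ} (hp : 1 < p) :
    classicalFirstEigenvalue p 1 = eigenvalueFormula p 1 1 := by
  rw [← firstEigenvalue_eq hp one_pos one_pos, classicalFirstEigenvalue, firstEigenvalue]
  have : ∀ x : ℝ, |x| ^ p = (1 : ℝ) ^ p * max x 0 ^ p + (1 : ℝ) ^ p * max (-x) 0 ^ p := by
    intro x
    have h := asymNorm_rpow (p := p) hp one_pos one_pos x
    rw [asymEnergy] at h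
    rw [← h, asymNorm]
    congr 1
    rcases le_total 0 x with hx | hx
    · rw [abs_of_nonneg hx, max_eq_left hx, max_eq_right (by linarith)]; ring
    · rw [abs_of_nonpos hx, max_eq_right hx, max_eq_left (by linarith)]; ring
  congr 1
  ext E
  refine exists_congr fun u => exists_congr fun u' => ?_
  simp only [this]

lemma nodalLength_eq {p a b μ : ℝ} (hp : 1 < p) (ha : 0 < a) (hb : 0 < b) (hμ : 0 < μ) :
    nodalLength p a b μ = archLength p a b μ := by
  have hK : 0 < halfPip p * (a + b) := mul_pos (halfPip_pos hp) (add_pos ha hb)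
  have hp1 : 0 < p - 1 := by linarith
  rw [nodalLength, firstEigenvalue_eq hp ha hb, eigenvalueFormula, archLength, freq]
  have e : (p - 1) * (halfPip p * (a + b)) ^ p / μ =
      (halfPip p * (a + b)) ^ p / (μ / (p - 1)) := by field_simp
  rw [e, Real.div_rpow (Real.rpow_nonneg hK.le _) (by positivity), ← Real.rpow_mul hK.le,
    mul_one_div_cancel (by linarith), Real.rpow_one, mul_comm (a + b)]

lemma isWeakSolution_classical_iff {p c : ℝ} (hp : 1 < p) {u : ℝ → ℝ} :
    IsWeakSolution p 1 (classicalFlux p) (fun x => c * (|x| ^ (p - 2) * x)) u ↔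
      IsWeakSolution p 1 (asymFlux p 1 1) (fucikTerm p c c) u := by
  rw [classicalFlux_eq hp, fucikTerm_diag hp]

lemma exists_isPrincipalEigenfunction {p : ℝ} (hp : 1 < p) :
    ∃ φ, IsPrincipalEigenfunction p φ := by
  obtain ⟨θ, hθ, hnorm⟩ := exists_normalizing_factor hp one_pos one_pos
  refine ⟨fun t => θ * arch p 1 1 t,
    (continuous_const.mul (continuous_arch hp one_pos one_pos)).continuousOn,
    fun t ht => mul_pos hθ (arch_pos hp one_pos one_pos ht), ?_, hnorm⟩
  rw [isWeakSolution_classical_iff hp, classicalFirstEigenvalue_eq hp]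
  exact (isNontrivialSolution_arch hp one_pos one_pos hθ).1

/-- Positivity excludes interior zeros, so the eigenfunction is one classical arch. Continuity
upgrades almost everywhere equality to the closed interval. -/
lemma IsPrincipalEigenfunction.eq_arch {p : ℝ} (hp : 1 < p) {φ : ℝ → ℝ}
    (h : IsPrincipalEigenfunction p φ) :
    ∃ M, 0 < M ∧ ∀ t ∈ Icc (0 : ℝ) 1, φ t = M * arch p 1 1 t := by
  obtain ⟨U, W, hf, hu⟩ :=
    ((isWeakSolution_classical_iff hp).1 h.weakSolution).exists_isFlow hp one_pos one_pos one_pos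
  have hoo : EqOn φ U (Ioo 0 1) := Measure.eqOn_open_of_ae_eq hu isOpen_Ioo
    (h.continuousOn.mono Ioo_subset_Icc_self) (hf.contU.mono Ioo_subset_Icc_self)
  have hcc : EqOn φ U (Icc 0 1) := hoo.of_subset_closure h.continuousOn hf.contU
    Ioo_subset_Icc_self (by rw [closure_Ioo zero_ne_one])
  obtain ⟨-, -, M, hM, hprof, -⟩ := hf.flowOn.positive_arch hp one_pos one_pos one_pos hf.left
    hf.right fun t ht => by rw [← hoo ht]; exact h.pos t ht
  refine ⟨M, hM, fun t ht => ?_⟩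
  rw [hcc ht, hprof t ht, sub_zero, sub_zero, div_one]

lemma isPrincipalEigenfunction_principalEigenfunction {p : ℝ} (hp : 1 < p) :
    IsPrincipalEigenfunction p (principalEigenfunction p) :=
  Classical.epsilon_spec (exists_isPrincipalEigenfunction hp)

/-- The symmetric arch peaks at `1 / 2`; stretching its halves onto the two sides of `a / (a + b)`
reproduces the asymmetric arch. -/
lemma arch_one_one_rescale {p a b t : ℝ} (ha : 0 < a) (hb : 0 < b) :
    (if t < a / (a + b) then arch p 1 1 (t / (2 * (a / (a + b))))
      else arch p 1 1 ((t + 1 - 2 * (a / (a + b))) / (2 * (1 - a / (a + b))))) = arch p a b t := by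
  have hc := peak_pos ha hb
  have hc1 := peak_lt_one ha hb
  have e1 : halfPip p * (a + b) / a * t = halfPip p * (1 + 1) / 1 * (t / (2 * (a / (a + b)))) := by
    field_simp; ring
  have e2 : halfPip p * (a + b) / b * (1 - t) =
      halfPip p * (1 + 1) / 1 * (1 - (t + 1 - 2 * (a / (a + b))) / (2 * (1 - a / (a + b)))) := by
    have h : 1 - a / (a + b) = b / (a + b) := by field_simp; ring
    rw [h]; field_simp; ring
  rw [show arch p a b t = if t < a / (a + b) then sinp p (halfPip p * (a + b) / a * t)
    else sinp p (halfPip p * (a + b) / b * (1 - t)) from rfl, e1, e2]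
  split_ifs with h
  · rw [arch, if_pos]
    rw [div_lt_iff₀ (by linarith)]; linarith
  · rw [arch, if_neg]
    rw [not_lt, le_div_iff₀ (by linarith)]; linarith

lemma phiPlus_eq {p a b M : ℝ} (ha : 0 < a) (hb : 0 < b)
    (h : ∀ t ∈ Icc (0 : ℝ) 1, principalEigenfunction p t = M * arch p 1 1 t) {t : ℝ}
    (ht : t ∈ Icc (0 : ℝ) 1) : phiPlus p a b t = M * arch p a b t := by
  have hc := peak_pos ha hb
  have hc1 := peak_lt_one ha hb
  rw [← arch_one_one_rescale ha hb, phiPlus]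
  split_ifs with hlt
  · rw [h]
    refine ⟨div_nonneg ht.1 (by linarith), ?_⟩
    rw [div_le_one (by linarith)]; linarith
  · rw [h]
    refine ⟨div_nonneg (by linarith) (by linarith), ?_⟩
    rw [div_le_one (by linarith)]; linarith [ht.2]

lemma phiMinus_eq_neg_phiPlus {p a b : ℝ} (ha : 0 < a) (hb : 0 < b) (t : ℝ) :
    phiMinus p a b t = -phiPlus p b a t := by
  have e : b / (b + a) = 1 - a / (a + b) := by field_simp; ring
  rw [phiMinus, phiPlus, e]
  have e1 : t + 1 - 2 * (1 - a / (a + b)) = t + 2 * (a / (a + b)) - 1 := by ring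
  rw [sub_sub_cancel, e1]
  split_ifs <;> rfl

/-! ### The Fučík spectrum and the main theorem -/

/-- Arches can be put on any admissible cover, so membership is purely a question of tiling `[0, L]`
by intervals of two prescribed lengths. -/
lemma mem_fucikSpectrum_iff {p a b L μ ν : ℝ} (hp : 1 < p) (ha : 0 < a) (hb : 0 < b)
    (hL : 0 < L) : (μ, ν) ∈ fucikSpectrum p a b L ↔
      ∃ (P N : ℕ) (α β : Fin P → ℝ) (γ δ : Fin N → ℝ), (0 < P → 0 < μ) ∧ (0 < N → 0 < ν) ∧
        IsInterspersedCover L α β γ δ ∧ (∀ i, β i - α i = archLength p a b μ) ∧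
        (∀ j, δ j - γ j = archLength p a b ν) := by
  constructor
  · rintro ⟨u, hu⟩
    obtain ⟨P, N, α, β, γ, δ, θ, U, ⟨h1, h2, h3, h4, h5, -⟩, -⟩ :=
      (isNontrivialSolution_iff hp ha hb hL).1 hu
    exact ⟨P, N, α, β, γ, δ, h1, h2, h3, h4, h5⟩
  · rintro ⟨P, N, α, β, γ, δ, h1, h2, h3, h4, h5⟩
    obtain ⟨U, hU1, hU2⟩ := h3.exists_glued
      (fun i t => 1 * (archLength p a b μ * arch p a b ((t - α i) / (β i - α i))))
      (fun j t => -(1 * (archLength p a b ν * arch p b a ((t - γ j) / (δ j - γ j)))))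
      (fun i j _ => by
        have := h3.nonempty_I i
        simp only [sub_self, zero_div, div_self (by linarith : β i - α i ≠ 0)]
        rw [arch_one hp ha hb, arch_zero hp hb ha]; simp)
      (fun i j _ => by
        have := h3.nonempty_J j
        simp only [sub_self, zero_div, div_self (by linarith : δ j - γ j ≠ 0)]
        rw [arch_zero hp ha hb, arch_one hp hb ha]; simp)
    exact ⟨U, (isNontrivialSolution_iff hp ha hb hL).2 ⟨P, N, α, β, γ, δ, 1, U,
      ⟨h1, h2, h3, h4, h5, one_pos, hU1, hU2⟩, Filter.Eventually.of_forall fun _ => rfl⟩⟩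

/-- The length depends on the parameters only through `(a + b) / μ ^ (1 / p)`, so the scaling factor
cancels the asymmetry and the same covers serve both operators. -/
lemma archLength_mul {p a b μ : ℝ} (hp : 1 < p) (ha : 0 < a) (hb : 0 < b) (hμ : 0 < μ) :
    archLength p a b (((a + b) / 2) ^ p * μ) = archLength p 1 1 μ := by
  have hab : 0 < (a + b) / 2 := by positivity
  have hκ := freq_pos hp hμ
  have hf : freq p (((a + b) / 2) ^ p * μ) = (a + b) / 2 * freq p μ := by
    rw [freq, freq, mul_div_assoc, Real.mul_rpow (Real.rpow_nonneg hab.le _)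
      (div_nonneg hμ.le (by linarith)), ← Real.rpow_mul hab.le, mul_one_div_cancel (by linarith),
      Real.rpow_one]
  rw [archLength, archLength, hf]
  field_simp
  ring

lemma classicalFucikSpectrum_eq {p L : ℝ} (hp : 1 < p) :
    classicalFucikSpectrum p L = fucikSpectrum p 1 1 L := by
  rw [classicalFucikSpectrum, classicalFlux_eq hp]; rfl

theorem fucikSpectrum_eq_smul {p a b L : ℝ} (hp : 1 < p) (ha : 0 < a) (hb : 0 < b) (hL : 0 < L) :
    fucikSpectrum p a b L = (((a + b) / 2) ^ p : ℝ) • classicalFucikSpectrum p L := by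
  have hr : 0 < ((a + b) / 2) ^ p := Real.rpow_pos_of_pos (by positivity) _
  have key : ∀ μ ν : ℝ, (((a + b) / 2) ^ p * μ, ((a + b) / 2) ^ p * ν) ∈ fucikSpectrum p a b L ↔
      (μ, ν) ∈ fucikSpectrum p 1 1 L := by
    intro μ ν
    rw [mem_fucikSpectrum_iff hp ha hb hL, mem_fucikSpectrum_iff hp one_pos one_pos hL]
    refine exists_congr fun P => exists_congr fun N => exists_congr fun α => exists_congr fun β =>
      exists_congr fun γ => exists_congr fun δ => ?_
    rw [mul_pos_iff_of_pos_left hr, mul_pos_iff_of_pos_left hr]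
    refine and_congr_right fun h1 => and_congr_right fun h2 => and_congr_right fun _ => ?_
    refine and_congr (forall_congr' fun i => ?_) (forall_congr' fun j => ?_)
    · rw [archLength_mul hp ha hb (h1 (Fin.pos i))]
    · rw [archLength_mul hp ha hb (h2 (Fin.pos j))]
  rw [classicalFucikSpectrum_eq hp]
  ext ⟨μ, ν⟩
  rw [mem_smul_set_iff_inv_smul_mem₀ hr.ne', Prod.smul_mk, ← key, smul_eq_mul, smul_eq_mul,
    mul_inv_cancel_left₀ hr.ne', mul_inv_cancel_left₀ hr.ne']

end AsymPLap

end

theorem theorem3 (p a b L : ℝ) (hp : 1 < p) (ha : 0 < a) (hb : 0 < b) (hL : 0 < L) :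
    AsymPLap.IsPrincipalEigenfunction p (AsymPLap.principalEigenfunction p) ∧
    AsymPLap.fucikSpectrum p a b L =
      (((a + b) / 2) ^ p : ℝ) • AsymPLap.classicalFucikSpectrum p L ∧
    ∀ (μ ν : ℝ) (u : ℝ → ℝ),
      AsymPLap.IsNontrivialSolution p a b L μ ν u ↔
        ∃ (P N : ℕ) (α β : Fin P → ℝ) (γ δ : Fin N → ℝ),
          (0 < P → 0 < μ) ∧ (0 < N → 0 < ν) ∧
          AsymPLap.IsInterspersedCover L α β γ δ ∧
          (∀ i, β i - α i = AsymPLap.nodalLength p a b μ) ∧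
          (∀ j, δ j - γ j = AsymPLap.nodalLength p a b ν) ∧
          ∃ (c : ℝ) (Φ : ℝ → ℝ), 0 < c ∧
            AsymPLap.IsGluedProfile p a b μ ν α β γ δ Φ ∧
            ∀ᵐ t ∂(AsymPLap.intervalMeasure L), u t = c * Φ t := by
  have hφ := AsymPLap.isPrincipalEigenfunction_principalEigenfunction hp
  refine ⟨hφ, AsymPLap.fucikSpectrum_eq_smul hp ha hb hL, fun μ ν u => ?_⟩
  obtain ⟨M, hM, hφM⟩ := hφ.eq_arch hp
  rw [AsymPLap.isNontrivialSolution_iff hp ha hb hL]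
  have hunit : ∀ {x y t : ℝ}, x < y → t ∈ Icc x y → (t - x) / (y - x) ∈ Icc (0 : ℝ) 1 := by
    intro x y t hxy ht
    refine ⟨div_nonneg (by linarith [ht.1]) (by linarith), ?_⟩
    rw [div_le_one (by linarith)]; linarith [ht.2]
  constructor
  · rintro ⟨P, N, α, β, γ, δ, θ, U, ⟨h1, h2, h3, h4, h5, hθ, h7, h8⟩, hu⟩
    -- The principal eigenfunction is `M` times the unit arch, so the scale `θ` measured in unit
    -- arches becomes `θ / M`.
    refine ⟨P, N, α, β, γ, δ, h1, h2, h3, fun i => ?_, fun j => ?_, θ / M, fun t => U t / (θ / M),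
      by positivity, ⟨fun i t ht => ?_, fun j t ht => ?_⟩, ?_⟩
    · rw [AsymPLap.nodalLength_eq hp ha hb (h1 (Fin.pos i)), h4]
    · rw [AsymPLap.nodalLength_eq hp ha hb (h2 (Fin.pos j)), h5]
    · beta_reduce
      rw [AsymPLap.nodalLength_eq hp ha hb (h1 (Fin.pos i)),
        AsymPLap.phiPlus_eq ha hb hφM (hunit (h3.nonempty_I i) ht), h7 i t ht]
      field_simp
    · beta_reduce
      rw [AsymPLap.nodalLength_eq hp ha hb (h2 (Fin.pos j)),
        AsymPLap.phiMinus_eq_neg_phiPlus ha hb,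
        AsymPLap.phiPlus_eq hb ha hφM (hunit (h3.nonempty_J j) ht), h8 j t ht]
      field_simp
    · filter_upwards [hu] with t ht
      rw [ht]
      field_simp
  · rintro ⟨P, N, α, β, γ, δ, h1, h2, h3, h4, h5, c, Φ, hc, ⟨h7, h8⟩, hu⟩
    refine ⟨P, N, α, β, γ, δ, c * M, fun t => c * Φ t, ⟨h1, h2, h3, fun i => ?_, fun j => ?_,
      by positivity, fun i t ht => ?_, fun j t ht => ?_⟩, hu⟩
    · rw [← AsymPLap.nodalLength_eq hp ha hb (h1 (Fin.pos i)), h4]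
    · rw [← AsymPLap.nodalLength_eq hp ha hb (h2 (Fin.pos j)), h5]
    · beta_reduce
      rw [h7 i t ht, AsymPLap.nodalLength_eq hp ha hb (h1 (Fin.pos i)),
        AsymPLap.phiPlus_eq ha hb hφM (hunit (h3.nonempty_I i) ht)]
      ring
    · beta_reduce
      rw [h8 j t ht, AsymPLap.nodalLength_eq hp ha hb (h2 (Fin.pos j)),
        AsymPLap.phiMinus_eq_neg_phiPlus ha hb,
        AsymPLap.phiPlus_eq hb ha hφM (hunit (h3.nonempty_J j) ht)]
      ring
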